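/- **Setting.** Let $X$ be a locally compact Hausdorff space with a regular Borel measure $\mu$ and open sets $B(x,r)$ ($x\in X$, $r>0$), where for each $x$ the sets $B(x,r)$, $r>0$, form a neighbourhood basis of $x$, such that for some constants $c>1$, $A>1$: $x\in B(x,r)$; $B(x,r_1)\subset B(x,r_2)$ if $r_1\le r_2$; $0<\mu(B(x,r))<\infty$; $X=\bigcup_{r>0}B(x,r)$; $\mu(B(x,cr))\le A\,\mu(B(x,r))$; if $B(x_1,r_1)\cap B(x_2,r_2)\neq\emptyset$ and $r_1\ge r_2$, then $B(x_2,r_2)\subset B(x_1,cr_1)$; and $\mu(\{x\})=0$ for all $x$ (a space of homogeneous type). Put $d(x,y)=\inf\{t>0: y\in B(x,t),\ x\in B(y,t)\}$ and $\lambda(x,y)=\mu(B(x,d(x,y)))$. A standard kernel is a function $K:\{(x,y)\in X\times X:x\ne y\}\to\mathbb C$ for which there are $\epsilon>0$ and $0<C<\infty$ with $|K(x,y)|\le C/\lambda(x,y)$ for $x\neq y$, and $$|K(x,y)-K(x',y)|+|K(y,x)-K(y,x')|\le\Big(\frac{d(x,x')}{d(x,y)}\Big)^{\epsilon}\frac{C}{\lambda(x,y)}$$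 whenever $x\ne y$ and $d(x,y)\ge c\,d(x,x')$. For $\delta>0$ let $\Lambda_\delta$ be the space of compactly supported functions $f:X\to\mathbb C$ with $|f(x)-f(y)|\le C_f\,d(x,y)^\delta$ for all $x,y\in X$. A Calderón–Zygmund operator bounded on $L^2(X)$ is a bounded linear operator $T_K$ on $L^2(X)$ for which there are a standard kernel $K$, locally integrable off the diagonal with respect to $\mu\times\mu$, and a $\delta>0$ such that $d^\delta$ is comparable to a metric (which is the case for all small $\delta$) with $$\int_X (T_Kf)\,g\,d\mu=\int_X\int_X K(x,y)f(y)g(x)\,d\mu(y)\,d\mu(x)$$ for all $f,g\in\Lambda_\delta$ whose supports are separated by a positive $d$-distance. A function $b:X\to\mathbb C$ is in $BMO(X)$ if it is integrable on every ball $B=B(x,r)$ and $\sup_B \mu(B)^{-1}\int_B|b-m_B(b)|\,d\mu<\infty$, where $m_B(b)=\mu(B)^{-1}\int_B b\,d\mu$. **Corollary 6.3.** Let $T_K$ be a Calderón–Zygmund operator bounded on $L^2(X)$, and let $b\in BMO(X)$. Then the commutator $[M_b,T_K]f=b\,T_Kf-T_K(bf)$ is bounded on $L^p(X)$ for all $1<p<\infty$;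 that is, the space of all $f\in L^p(X)\cap L^2(X)$ with $bf\in L^2(X)$ is dense in $L^p(X)$, and there is a bounded linear operator $S$ on $L^p(X)$ with $Sf=b\,T_Kf-T_K(bf)$ a.e. for all $f$ in this space. -/

import Mathlib

open MeasureTheory Set Filter Topology
open scoped ENNReal NNReal

noncomputable section

/-- A homogeneous structure on a topological space `X` with a Borel measure `μ`: a family of basic
open sets `ball x r` (`x : X`, `r > 0`), where `ball x r`, `r > 0`, is a neighbourhood basis of `x`,
with constants `c > 1` and `K > 1` and the usual monotonicity, doubling and engulfing properties.
Points are required to have measure zero. The values of `ball x r` for `r ≤ 0` play no role. -/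
structure HomogeneousStructure (X : Type*) [TopologicalSpace X] [MeasurableSpace X]
    (μ : Measure X) where
  ball : X → ℝ → Set X
  c : ℝ
  K : ℝ≥0
  one_lt_c : 1 < c
  one_lt_K : 1 < K
  isOpen_ball : ∀ x r, 0 < r → IsOpen (ball x r)
  nhds_basis : ∀ x, (𝓝 x).HasBasis (fun r : ℝ => 0 < r) (ball x)
  mem_ball_self : ∀ x r, 0 < r → x ∈ ball x r
  ball_mono : ∀ x r₁ r₂, 0 < r₁ → r₁ ≤ r₂ → ball x r₁ ⊆ ball x r₂
  measure_ball_pos : ∀ x r, 0 < r → 0 < μ (ball x r)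
  measure_ball_lt_top : ∀ x r, 0 < r → μ (ball x r) < ∞
  iUnion_ball : ∀ x y, ∃ r, 0 < r ∧ y ∈ ball x r
  doubling : ∀ x r, 0 < r → μ (ball x (c * r)) ≤ K * μ (ball x r)
  engulfing : ∀ x₁ x₂ r₁ r₂, 0 < r₂ → r₂ ≤ r₁ → (ball x₁ r₁ ∩ ball x₂ r₂).Nonempty →
    ball x₂ r₂ ⊆ ball x₁ (c * r₁)
  measure_singleton : ∀ x, μ {x} = 0

namespace HomogeneousStructure

variable {X : Type*} [TopologicalSpace X] [MeasurableSpace X] {μ : Measure X}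

/-- The quasi-distance `d(x, y) = inf {t > 0 : y ∈ B(x, t) and x ∈ B(y, t)}`. -/
def qdist (H : HomogeneousStructure X μ) (x y : X) : ℝ :=
  sInf {t : ℝ | 0 < t ∧ y ∈ H.ball x t ∧ x ∈ H.ball y t}

/-- `λ(x, y) = μ(B(x, d(x, y)))`. -/
def lam (H : HomogeneousStructure X μ) (x y : X) : ℝ :=
  μ.real (H.ball x (H.qdist x y))

/-- `b ∈ BMO(X)`: `b` is integrable on every ball, and its mean oscillations
`μ(B)⁻¹ ∫_B |b - m_B(b)| dμ` over all balls `B` are uniformly bounded. -/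
def IsBMO (H : HomogeneousStructure X μ) (b : X → ℂ) : Prop :=
  (∀ x r, 0 < r → IntegrableOn b (H.ball x r) μ) ∧
    ∃ M : ℝ, ∀ x r, 0 < r →
      ⨍ y in H.ball x r, ‖b y - ⨍ z in H.ball x r, b z ∂μ‖ ∂μ ≤ M

/-- Standard kernels; only the values of `k` off the diagonal matter. In the regularity condition
`x ≠ y` and `c * d(x, x') ≤ d(x, y)` force `x' ≠ y`. -/
def IsStandardKernel (H : HomogeneousStructure X μ) (k : X → X → ℂ) : Prop :=
  ∃ ε C : ℝ, 0 < ε ∧ 0 < C ∧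
    (∀ x y, x ≠ y → ‖k x y‖ ≤ C / H.lam x y) ∧
    ∀ x x' y, x ≠ y → H.c * H.qdist x x' ≤ H.qdist x y →
      ‖k x y - k x' y‖ + ‖k y x - k y x'‖ ≤
        (H.qdist x x' / H.qdist x y) ^ ε * (C / H.lam x y)

/-- The exponents `δ > 0` for which `d ^ δ` is comparable to a metric `m`. By Macías and Segovia
all sufficiently small `δ > 0` are such; this is the range `(0, δ₀]` of exponents for which the
Hölder spaces of order `δ` are rich enough to serve as spaces of test functions. -/
def IsHolderExponent (H : HomogeneousStructure X μ) (δ : ℝ) : Prop :=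
  0 < δ ∧ ∃ m : X → X → ℝ,
    (∀ x y, m x y = m y x) ∧ (∀ x y z, m x z ≤ m x y + m y z) ∧
    ∃ A : ℝ, 0 < A ∧ ∀ x y, m x y ≤ A * H.qdist x y ^ δ ∧ H.qdist x y ^ δ ≤ A * m x y

/-- The space `Λ_δ` of compactly supported functions that are Hölder continuous of order `δ` with
respect to the quasi-distance. -/
def IsTest (H : HomogeneousStructure X μ) (δ : ℝ) (f : X → ℂ) : Prop :=
  HasCompactSupport f ∧ ∃ C : ℝ, ∀ x y, ‖f x - f y‖ ≤ C * H.qdist x y ^ δ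

/-- The bounded operator `T` on `L²`, restricted to `Λ_δ`, is associated to the kernel `k`:
`k` is locally integrable off the diagonal, and `⟨T f, g⟩ = ∫∫ k(x, y) f(y) g(x) dμ(y) dμ(x)`
for `f, g ∈ Λ_δ` with supports at a positive distance (the pairing is bilinear). -/
def IsAssociated (H : HomogeneousStructure X μ) (δ : ℝ)
    (T : Lp ℂ 2 μ →L[ℂ] Lp ℂ 2 μ) (k : X → X → ℂ) : Prop :=
  LocallyIntegrableOn (fun q : X × X => k q.1 q.2) {q | q.1 ≠ q.2} (μ.prod μ) ∧
    ∀ f g : X → ℂ, H.IsTest δ f → H.IsTest δ g →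
      (∃ η : ℝ, 0 < η ∧ ∀ x ∈ tsupport f, ∀ y ∈ tsupport g, η ≤ H.qdist x y) →
      ∀ hf : MemLp f 2 μ,
        ∫ x, T (hf.toLp f) x * g x ∂μ = ∫ x, ∫ y, k x y * f y * g x ∂μ ∂μ

/-- `T` is a Calderón–Zygmund (singular integral) operator with standard kernel `k`, bounded
on `L²(X)`. -/
def IsCalderonZygmund (H : HomogeneousStructure X μ)
    (T : Lp ℂ 2 μ →L[ℂ] Lp ℂ 2 μ) (k : X → X → ℂ) : Prop :=
  H.IsStandardKernel k ∧ ∃ δ : ℝ, H.IsHolderExponent δ ∧ H.IsAssociated δ T k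

end HomogeneousStructure

section Commutator

variable {X : Type*} [MeasurableSpace X] {μ : Measure X}

/-- The functions `f ∈ L^p ∩ L²` with `b f ∈ L²`, on which `[M_b, T]` is defined directly. -/
def commutatorDomain (μ : Measure X) (b : X → ℂ) (p : ℝ≥0∞) : Set (Lp ℂ p μ) :=
  {f | MemLp f 2 μ ∧ MemLp (fun x => b x * f x) 2 μ}

/-- `[M_b, T] f = b · T f - T (b f)`. -/
def commutatorFun (T : Lp ℂ 2 μ →L[ℂ] Lp ℂ 2 μ) (b f : X → ℂ) (hf : MemLp f 2 μ)
    (hbf : MemLp (fun x => b x * f x) 2 μ) : X → ℂ :=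
  fun x => b x * T (hf.toLp f) x - T (hbf.toLp fun x => b x * f x) x

end Commutator

end

/-!
# Commutators of Calderón–Zygmund operators with `BMO` functions

A power `d ^ δ` of the quasi-distance is comparable to a metric; this metric induces the topology
of `X` (`exists_metricSpace`), and `μ` is doubling on its balls (`IsSnowflake.isDoubling`). The
hypotheses on `k` and `b` carry over to this metric (`IsSnowflake.kernel_bounds`,
`IsSnowflake.bmoWith`, `IsSnowflake.weakKernel`), so the whole argument takes place in a metric
space with a doubling measure.

The commutator is controlled through its mean oscillations. Let `B` be a ball and `m` the mean of
`b` on `B` (or a constant near it). Since `[b, T] = [b - m, T]`,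
`[b, T] f = (b - m) T f - T ((b - m) f)`.
By Hölder's inequality and the John–Nirenberg inequality, the mean of the first term over `B` is at
most a multiple of `‖b‖_BMO (M |T f| ^ q) ^ (1 / q)` at any point of `B`, for any `q > 1`, where `M`
is the maximal operator. In the second term the part of `(b - m) f` near `B` is treated by an
`L^s` bound for `T`. The part far from `B` changes `T` on `B` by a constant up to an error which is
a sum over the dilates `2 ^ j B`, with coefficients decaying geometrically in `j` by the regularity
of the kernel; `b - m` grows only linearly in `j` on these dilates, so the sum converges and is at
most a multiple of `‖b‖_BMO (M |f| ^ q) ^ (1 / q)`. Choosing `q < p`, the `L^p` bound follows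
from the Fefferman–Stein inequality, the maximal theorem and the boundedness of `T` on `L^p`
(`IsDoubling.commutator_bound_of_bounded`).

The ingredients are the following.

* The Fefferman–Stein inequality (`IsDoubling.fefferman_stein`), by the good-`λ` method. It is
  stated for functions `G` dominating mean oscillations rather than for the sharp maximal function,
  which avoids all measurability questions about the latter. In a space of finite measure the whole
  space is a ball, and there `G` has to control the function itself, not only its oscillation;
  without this requirement constants would be counterexamples.
* The John–Nirenberg inequality in `L^q` form (`IsDoubling.john_nirenberg`), which is the
  Fefferman–Stein inequality for the product of `b - m` and a Lipschitz cutoff of the ball.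
* The boundedness of `T` on `L^p` (`IsDoubling.boundedOn`). For `p > 2` it comes from the same
  estimate of mean oscillations, with `s = 2`, and for `p < 2` by duality.
* The representation of `T f` by the kernel off the support of `f`, for bounded `f`
  (`WeakKernel.hasKernel`), from the weak association on Hölder test functions.

The Fefferman–Stein inequality needs some a priori integrability, so the estimate is first proved
for bounded `b` and bounded `f` with bounded support, with constants depending on `b` only through
its mean oscillation. The general case follows by truncation and Fatou's lemma
(`IsDoubling.commutator_bound`), and the commutator is then extended from its dense domain by
continuity (`dense_commutatorDomain`, `exists_extension_commutatorFun`).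
-/

open Metric

set_option linter.unusedSectionVars false

/-! ### Doubling measures -/

/-- A Borel measure on a metric space all of whose open balls have positive finite measure and
which is doubling with constant `D`. -/
structure IsDoubling {X : Type*} [PseudoMetricSpace X] [MeasurableSpace X] (μ : Measure X)
    (D : ℝ≥0) : Prop where
  pos : ∀ x r, 0 < r → 0 < μ (ball x r)
  lt_top : ∀ x r, μ (ball x r) < ∞
  two : ∀ x r, 0 < r → μ (ball x (2 * r)) ≤ D * μ (ball x r)

/-- The uncentred Hardy–Littlewood maximal function, over open balls, of an `ℝ≥0∞`-valued
function. -/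
noncomputable def maxFn {X : Type*} [PseudoMetricSpace X] [MeasurableSpace X] (μ : Measure X)
    (u : X → ℝ≥0∞) (x : X) : ℝ≥0∞ :=
  ⨆ (y : X) (r : ℝ) (_ : x ∈ ball y r), (∫⁻ z in ball y r, u z ∂μ) / μ (ball y r)

section Doubling

variable {X : Type*} [MetricSpace X] [MeasurableSpace X] [BorelSpace X] {μ : Measure X} {D : ℝ≥0}

namespace IsDoubling

theorem pow (hμ : IsDoubling μ D) (x : X) {r : ℝ} (hr : 0 < r) (n : ℕ) :
    μ (ball x (2 ^ n * r)) ≤ D ^ n * μ (ball x r) := by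
  induction n with
  | zero => simp
  | succ n ih =>
    calc μ (ball x (2 ^ (n + 1) * r)) = μ (ball x (2 * (2 ^ n * r))) := by ring_nf
      _ ≤ D * μ (ball x (2 ^ n * r)) := hμ.two _ _ (by positivity)
      _ ≤ D * (D ^ n * μ (ball x r)) := by gcongr
      _ = D ^ (n + 1) * μ (ball x r) := by ring

theorem measure_le (hμ : IsDoubling μ D) {s : Set X} (y : X) {r : ℝ} (hr : 0 < r) (n : ℕ)
    (h : s ⊆ ball y (2 ^ n * r)) : μ s ≤ D ^ n * μ (ball y r) :=
  (measure_mono h).trans (hμ.pow y hr n)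

theorem ne_zero (hμ : IsDoubling μ D) {x y : X} {r : ℝ} (h : x ∈ ball y r) :
    μ (ball y r) ≠ 0 := (hμ.pos y r (pos_of_mem_ball h)).ne'

theorem ne_top (hμ : IsDoubling μ D) (y : X) (r : ℝ) : μ (ball y r) ≠ ∞ := (hμ.lt_top y r).ne

theorem isLocallyFiniteMeasure (hμ : IsDoubling μ D) : IsLocallyFiniteMeasure μ :=
  ⟨fun x => ⟨ball x 1, ball_mem_nhds x one_pos, hμ.lt_top x 1⟩⟩

theorem one_le (hμ : IsDoubling μ D) (x : X) : 1 ≤ D := by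
  have h : 1 * μ (ball x 1) ≤ D * μ (ball x 1) := by
    rw [one_mul]
    exact (measure_mono (ball_subset_ball (by norm_num))).trans (hμ.two x 1 one_pos)
  have := (ENNReal.mul_le_mul_iff_left (hμ.pos x 1 one_pos).ne' (hμ.ne_top x 1)).1 h
  exact_mod_cast this

theorem sigmaFinite (hμ : IsDoubling μ D) : SigmaFinite μ := by
  rcases isEmpty_or_nonempty X with h | ⟨⟨x⟩⟩
  · rw [Measure.eq_zero_of_isEmpty μ]; infer_instance
  · exact ⟨⟨⟨fun n => ball x n, fun _ => trivial, fun n => hμ.lt_top x n,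
      iUnion_ball_nat x⟩⟩⟩

/-- A family of disjoint balls of positive measure in a `σ`-finite space is countable, so a maximal
family of disjoint balls of radius `ε` has a countable set of centres, which is `4ε`-dense. -/
theorem secondCountable (hμ : IsDoubling μ D) : SecondCountableTopology X := by
  have := hμ.sigmaFinite
  refine Metric.secondCountable_of_almost_dense_set fun ε hε => ?_
  obtain ⟨u, -, hu, hcov⟩ := Vitali.exists_disjoint_subfamily_covering_enlargement_ball
    (univ : Set X) id (fun _ => ε / 4) (ε / 4) (fun _ _ => le_rfl) 4 (by norm_num)
  have hc : u.Countable := by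
    have := Measure.countable_meas_pos_of_disjoint_iUnion (μ := μ)
      (As := fun i : u => ball (i : X) (ε / 4)) (fun _ => measurableSet_ball)
      (fun i j hij => hu i.2 j.2 (fun h => hij (Subtype.ext h)))
    have h2 : {i : u | 0 < μ (ball (i : X) (ε / 4))} = univ :=
      eq_univ_of_forall fun i => hμ.pos _ _ (by positivity)
    rw [h2, countable_univ_iff] at this
    exact this
  refine ⟨u, hc, fun x => ?_⟩
  obtain ⟨b, hb, hsub⟩ := hcov x (mem_univ x)
  have := hsub (mem_ball_self (by positivity))
  rw [mem_ball] at this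
  exact ⟨b, hb, by simpa using (this.le.trans (by linarith : _ ≤ ε))⟩

theorem isUnifLocDoublingMeasure (hμ : IsDoubling μ D) : IsUnifLocDoublingMeasure μ := by
  refine ⟨⟨D ^ 2, ?_⟩⟩
  filter_upwards [self_mem_nhdsWithin] with ε hε x
  have hε : 0 < ε := hε
  refine (hμ.measure_le x hε 2 (closedBall_subset_ball (by linarith))).trans ?_
  push_cast
  gcongr
  exact ball_subset_closedBall

/-- A doubling space of finite measure is bounded: each ball that is not the whole space has a
disjoint ball of comparable measure, so its measure is at most a fixed fraction of the total. -/
theorem isBounded_of_measure_lt_top (hμ : IsDoubling μ D) (h : μ univ ≠ ∞) (x : X) :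
    ∃ R, 0 < R ∧ ball x R = univ := by
  by_contra! hne
  have step : ∀ R : ℝ, 0 < R → (1 + ((D : ℝ≥0∞) ^ 3)⁻¹) * μ (ball x R) ≤ μ univ := by
    intro R hR
    obtain ⟨y, hy⟩ : ∃ y, y ∉ ball x (2 * R) := by
      by_contra! hall
      exact hne (2 * R) (by positivity) (eq_univ_of_forall hall)
    rw [mem_ball, not_lt] at hy
    -- the ball of radius `dist y x / 2` around `y` is disjoint from `ball x R`, and its measure
    -- is comparable to that of `ball x R`
    have hd : Disjoint (ball x R) (ball y (dist y x / 2)) := by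
      refine ball_disjoint_ball ?_
      rw [dist_comm x y]; linarith
    have h1 : μ (ball x R) ≤ D ^ 3 * μ (ball y (dist y x / 2)) := by
      refine hμ.measure_le y (by linarith) 3 ?_
      refine ball_subset_ball' ?_
      rw [dist_comm x y]; linarith
    have hD : (D : ℝ≥0∞) ^ 3 ≠ 0 := by
      have := hμ.one_le x
      exact pow_ne_zero _ (by exact_mod_cast (by positivity : (0 : ℝ≥0) < D).ne')
    rw [add_mul, one_mul]
    calc μ (ball x R) + ((D : ℝ≥0∞) ^ 3)⁻¹ * μ (ball x R)
        ≤ μ (ball x R) + μ (ball y (dist y x / 2)) := by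
          gcongr
          rw [mul_comm, ← div_eq_mul_inv]
          exact ENNReal.div_le_of_le_mul' h1
      _ = μ (ball x R ∪ ball y (dist y x / 2)) := (measure_union hd measurableSet_ball).symm
      _ ≤ μ univ := measure_mono (subset_univ _)
  have hlim : Tendsto (fun n : ℕ => (1 + ((D : ℝ≥0∞) ^ 3)⁻¹) * μ (ball x n)) atTop
      (𝓝 ((1 + ((D : ℝ≥0∞) ^ 3)⁻¹) * μ univ)) := by
    refine ENNReal.Tendsto.const_mul ?_ (Or.inr ?_)
    · rw [← iUnion_ball_nat x]
      exact tendsto_measure_iUnion_atTop fun m n hmn => ball_subset_ball (by exact_mod_cast hmn)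
    · have := hμ.one_le x
      simp only [ne_eq, ENNReal.add_eq_top, ENNReal.one_ne_top, ENNReal.inv_eq_top, false_or]
      exact pow_ne_zero _ (by exact_mod_cast (by positivity : (0 : ℝ≥0) < D).ne')
  have hle := le_of_tendsto hlim (by
    filter_upwards [eventually_gt_atTop 0] with n hn
    exact step n (by exact_mod_cast hn))
  have hpos : 0 < μ univ := (hμ.pos x 1 one_pos).trans_le (measure_mono (subset_univ _))
  rw [add_mul, one_mul] at hle
  have h0 : ((D : ℝ≥0∞) ^ 3)⁻¹ * μ univ = 0 := by
    by_contra h0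
    exact absurd hle (not_le.2 (ENNReal.lt_add_right h h0))
  rw [mul_eq_zero] at h0
  rcases h0 with h0 | h0
  · rw [ENNReal.inv_eq_zero] at h0
    exact ENNReal.pow_ne_top ENNReal.coe_ne_top h0
  · exact hpos.ne' h0

end IsDoubling

/-! ### The Hardy–Littlewood maximal function -/

theorem lt_maxFn_iff {u : X → ℝ≥0∞} {x : X} {t : ℝ≥0∞} : t < maxFn μ u x ↔
    ∃ y r, x ∈ ball y r ∧ t < (∫⁻ z in ball y r, u z ∂μ) / μ (ball y r) := by
  simp only [maxFn, lt_iSup_iff, exists_prop]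

theorem isOpen_lt_maxFn (u : X → ℝ≥0∞) (t : ℝ≥0∞) : IsOpen {x | t < maxFn μ u x} := by
  have : {x | t < maxFn μ u x} = ⋃ (y : X) (r : ℝ)
      (_ : t < (∫⁻ z in ball y r, u z ∂μ) / μ (ball y r)), ball y r := by
    ext x
    simp only [mem_ofPred_eq, lt_maxFn_iff, mem_iUnion, exists_prop]
    tauto
  rw [this]
  exact isOpen_iUnion fun y => isOpen_iUnion fun r => isOpen_iUnion fun _ => isOpen_ball

theorem measurable_maxFn (u : X → ℝ≥0∞) : Measurable (maxFn μ u) :=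
  measurable_of_Ioi fun t => (isOpen_lt_maxFn u t).measurableSet

theorem laverage_le_maxFn (u : X → ℝ≥0∞) {x y : X} {r : ℝ} (h : x ∈ ball y r) :
    (∫⁻ z in ball y r, u z ∂μ) / μ (ball y r) ≤ maxFn μ u x :=
  le_iSup_of_le y (le_iSup_of_le r (le_iSup_of_le h le_rfl))

theorem IsDoubling.lintegral_le_maxFn (hμ : IsDoubling μ D) (u : X → ℝ≥0∞) {x y : X} {r : ℝ}
    (h : x ∈ ball y r) : ∫⁻ z in ball y r, u z ∂μ ≤ maxFn μ u x * μ (ball y r) :=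
  (ENNReal.div_le_iff (hμ.ne_zero h) (hμ.ne_top y r)).1 (laverage_le_maxFn u h)

theorem maxFn_mono {u v : X → ℝ≥0∞} (h : u ≤ᵐ[μ] v) (x : X) : maxFn μ u x ≤ maxFn μ v x := by
  refine iSup_mono fun y => iSup_mono fun r => iSup_mono fun _ => ?_
  gcongr ?_ / _
  exact lintegral_mono_ae (ae_restrict_of_ae h)

theorem maxFn_congr {u v : X → ℝ≥0∞} (h : u =ᵐ[μ] v) : maxFn μ u = maxFn μ v :=
  funext fun x => le_antisymm (maxFn_mono h.le x) (maxFn_mono h.symm.le x)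

theorem maxFn_le_const {u : X → ℝ≥0∞} {c : ℝ≥0∞} (h : ∀ x, u x ≤ c) (x : X) :
    maxFn μ u x ≤ c := by
  refine iSup_le fun y => iSup_le fun r => iSup_le fun _ => ?_
  refine ENNReal.div_le_of_le_mul ?_
  calc ∫⁻ z in ball y r, u z ∂μ ≤ ∫⁻ _ in ball y r, c ∂μ := lintegral_mono fun z => h z
    _ = c * μ (ball y r) := by simp

theorem maxFn_add_le {u v : X → ℝ≥0∞} (hu : AEMeasurable u μ) (x : X) :
    maxFn μ (fun z => u z + v z) x ≤ maxFn μ u x + maxFn μ v x := by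
  refine iSup_le fun y => iSup_le fun r => iSup_le fun h => ?_
  rw [lintegral_add_left' hu.restrict, ENNReal.add_div]
  exact add_le_add (laverage_le_maxFn u h) (laverage_le_maxFn v h)

/-- The weak type `(1, 1)` inequality for the maximal function. The Vitali covering theorem needs
bounded radii, so the set is exhausted by the unions of its balls of radius at most `n`. -/
theorem IsDoubling.weak_type (hμ : IsDoubling μ D) (u : X → ℝ≥0∞) (t : ℝ≥0∞) :
    t * μ {x | t < maxFn μ u x} ≤ D ^ 2 * ∫⁻ x, u x ∂μ := by
  have := hμ.secondCountable
  let T : ℕ → Set (X × ℝ) := fun n =>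
    {q | q.2 ≤ n ∧ 0 < q.2 ∧ t < (∫⁻ z in ball q.1 q.2, u z ∂μ) / μ (ball q.1 q.2)}
  let Ω : ℕ → Set X := fun n => ⋃ q ∈ T n, ball q.1 q.2
  have hΩ : {x | t < maxFn μ u x} = ⋃ n, Ω n := by
    ext x
    simp only [mem_ofPred_eq, lt_maxFn_iff, mem_iUnion, Ω, T]
    constructor
    · rintro ⟨y, r, hx, h⟩
      obtain ⟨n, hn⟩ := exists_nat_ge r
      exact ⟨n, (y, r), ⟨hn, pos_of_mem_ball hx, h⟩, hx⟩
    · rintro ⟨n, q, ⟨-, -, h⟩, hx⟩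
      exact ⟨q.1, q.2, hx, h⟩
  have hmono : Monotone Ω := by
    intro m n hmn
    refine biUnion_subset_biUnion_left ?_
    rintro q ⟨h1, h2⟩
    exact ⟨h1.trans (by exact_mod_cast hmn), h2⟩
  rw [hΩ, hmono.measure_iUnion, ENNReal.mul_iSup]
  refine iSup_le fun n => ?_
  obtain ⟨s, hsT, hdisj, hcov⟩ := Vitali.exists_disjoint_subfamily_covering_enlargement_ball
    (T n) (fun q => q.1) (fun q => q.2) n (fun q hq => hq.1) 4 (by norm_num)
  have hcount : s.Countable := hdisj.countable_of_isOpen (fun _ _ => isOpen_ball)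
    (fun q hq => ⟨q.1, mem_ball_self (hsT hq).2.1⟩)
  have hsub : Ω n ⊆ ⋃ q ∈ s, ball q.1 (4 * q.2) := by
    refine iUnion₂_subset fun q hq => ?_
    obtain ⟨q', hq', h⟩ := hcov q hq
    exact h.trans (subset_biUnion_of_mem (u := fun q : X × ℝ => ball q.1 (4 * q.2)) hq')
  have := hcount.to_subtype
  calc t * μ (Ω n) ≤ t * ∑' q : s, μ (ball q.1.1 (4 * q.1.2)) := by
        gcongr
        refine (measure_mono hsub).trans ?_
        exact measure_biUnion_le μ hcount _
    _ = ∑' q : s, t * μ (ball q.1.1 (4 * q.1.2)) := ENNReal.tsum_mul_left.symm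
    _ ≤ ∑' q : s, D ^ 2 * ∫⁻ z in ball q.1.1 q.1.2, u z ∂μ := by
        refine ENNReal.tsum_le_tsum fun q => ?_
        have h := (hsT q.2)
        calc t * μ (ball q.1.1 (4 * q.1.2))
            ≤ t * (D ^ 2 * μ (ball q.1.1 q.1.2)) := by
              gcongr
              exact hμ.measure_le _ h.2.1 2 (ball_subset_ball (by linarith))
          _ = D ^ 2 * (t * μ (ball q.1.1 q.1.2)) := by ring
          _ ≤ D ^ 2 * ∫⁻ z in ball q.1.1 q.1.2, u z ∂μ := by
              gcongr
              exact ENNReal.mul_le_of_le_div h.2.2.le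
    _ = D ^ 2 * ∑' q : s, ∫⁻ z in ball q.1.1 q.1.2, u z ∂μ := ENNReal.tsum_mul_left
    _ = D ^ 2 * ∫⁻ z in ⋃ q ∈ s, ball q.1 q.2, u z ∂μ := by
        rw [lintegral_biUnion hcount (fun _ _ => measurableSet_ball) hdisj]
    _ ≤ D ^ 2 * ∫⁻ z, u z ∂μ := by
        gcongr
        exact Measure.restrict_le_self

/-- Up to the doubling constant, a locally integrable function is dominated a.e. by its maximal
function. The constant comes from comparing closed balls with open ones. -/
theorem IsDoubling.ae_le_maxFn (hμ : IsDoubling μ D) {u : X → ℝ≥0∞} (hu : AEMeasurable u μ)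
    (hfin : ∀ x r, ∫⁻ z in ball x r, u z ∂μ ≠ ∞) : ∀ᵐ x ∂μ, u x ≤ D * maxFn μ u x := by
  rcases isEmpty_or_nonempty X with h | ⟨⟨x₀⟩⟩
  · exact Eventually.of_forall fun x => (h.false x).elim
  have := hμ.secondCountable
  have := hμ.isUnifLocDoublingMeasure
  have := hμ.isLocallyFiniteMeasure
  have key : ∀ n : ℕ, ∀ᵐ x ∂μ, (ball x₀ n).indicator u x ≤ D * maxFn μ u x := by
    intro n
    have hint : ∫⁻ x, (ball x₀ n).indicator u x ∂μ ≠ ∞ := by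
      rw [lintegral_indicator measurableSet_ball]
      exact hfin x₀ n
    filter_upwards [(IsUnifLocDoublingMeasure.vitaliFamily μ 1).ae_tendsto_lintegral_div
      (hu.indicator measurableSet_ball) hint] with x hx
    have hδ : Tendsto (fun j : ℕ => 1 / ((j : ℝ) + 1)) atTop (𝓝[>] 0) :=
      tendsto_nhdsWithin_iff.2 ⟨tendsto_one_div_add_atTop_nhds_zero_nat,
        Eventually.of_forall fun j => by simp only [mem_Ioi]; positivity⟩
    have h2 := hx.comp (IsUnifLocDoublingMeasure.tendsto_closedBall_filterAt μ (K := 1)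
      (fun _ : ℕ => x) (fun j : ℕ => 1 / ((j : ℝ) + 1)) hδ
      (Eventually.of_forall fun j => mem_closedBall_self (by positivity)))
    refine le_of_tendsto h2 (Eventually.of_forall fun j => ?_)
    have hj : (0 : ℝ) < 1 / ((j : ℝ) + 1) := by positivity
    simp only [Function.comp_apply]
    set δ : ℝ := 1 / ((j : ℝ) + 1)
    calc (∫⁻ y in closedBall x δ, (ball x₀ n).indicator u y ∂μ) / μ (closedBall x δ)
        ≤ (∫⁻ y in ball x (2 * δ), u y ∂μ) / μ (ball x δ) := by
          gcongr
          · exact closedBall_subset_ball (by linarith)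
          · exact indicator_le_self _ _ _
          · exact ball_subset_closedBall
      _ ≤ D * maxFn μ u x := by
          refine ENNReal.div_le_of_le_mul ?_
          calc ∫⁻ y in ball x (2 * δ), u y ∂μ ≤ maxFn μ u x * μ (ball x (2 * δ)) :=
                hμ.lintegral_le_maxFn u (mem_ball_self (by positivity))
            _ ≤ maxFn μ u x * (D * μ (ball x δ)) := by gcongr; exact hμ.two _ _ hj
            _ = D * maxFn μ u x * μ (ball x δ) := by ring
  filter_upwards [ae_all_iff.2 key] with x hx
  obtain ⟨n, hn⟩ := exists_nat_gt (dist x x₀)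
  simpa [indicator_of_mem (mem_ball.2 hn)] using hx n

end Doubling

/-! ### Distribution functions and the strong type inequality -/

section LayerCake

variable {X : Type*} [MeasurableSpace X] {μ : Measure X}

/-- Layer cake formula for an `ℝ≥0∞`-valued function with finite values. -/
theorem lintegral_rpow_eq_lintegral_meas_lt {v : X → ℝ≥0∞} (hv : AEMeasurable v μ)
    (hfin : ∀ x, v x ≠ ∞) {p : ℝ} (hp : 0 < p) :
    ∫⁻ x, v x ^ p ∂μ = ENNReal.ofReal p *
      ∫⁻ t in Ioi (0 : ℝ), μ {x | ENNReal.ofReal t < v x} * ENNReal.ofReal (t ^ (p - 1)) := by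
  have h := lintegral_rpow_eq_lintegral_meas_lt_mul μ (f := fun x => (v x).toReal)
    (Eventually.of_forall fun x => ENNReal.toReal_nonneg) hv.ennreal_toReal hp
  have h1 : ∀ x, ENNReal.ofReal ((v x).toReal ^ p) = v x ^ p := fun x => by
    rw [← ENNReal.ofReal_rpow_of_nonneg ENNReal.toReal_nonneg hp.le, ENNReal.ofReal_toReal (hfin x)]
  simp_rw [h1] at h
  rw [h]
  congr 1
  refine setLIntegral_congr_fun measurableSet_Ioi fun t ht => ?_
  have ht : (0 : ℝ) ≤ t := (mem_Ioi.1 ht).le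
  simp only [ENNReal.ofReal_lt_iff_lt_toReal ht (hfin _)]

/-- `∫_0^c t ^ (p - 1) dt ≤ c ^ p / p`, for `c` in `ℝ≥0∞`. -/
theorem lintegral_Ioi_rpow_le {p : ℝ} (hp : 0 < p) (c : ℝ≥0∞) :
    ∫⁻ t in Ioi (0 : ℝ), {t : ℝ | ENNReal.ofReal t < c}.indicator
      (fun t => ENNReal.ofReal (t ^ (p - 1))) t ≤ c ^ p / ENNReal.ofReal p := by
  rcases eq_or_ne c ∞ with rfl | hc
  · rw [ENNReal.top_rpow_of_pos hp, ENNReal.top_div_of_ne_top ENNReal.ofReal_ne_top]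
    exact le_top
  -- the formula is the layer cake formula for a constant function on a one-point space
  have h := lintegral_rpow_eq_lintegral_meas_lt (μ := Measure.dirac ()) (v := fun _ => c)
    aemeasurable_const (fun _ => hc) hp
  simp only [lintegral_const, measure_univ, mul_one] at h
  rw [h, ENNReal.div_eq_inv_mul, ← mul_assoc, ENNReal.inv_mul_cancel
    (ENNReal.ofReal_pos.2 hp).ne' ENNReal.ofReal_ne_top, one_mul]
  refine lintegral_mono fun t => ?_
  by_cases ht : ENNReal.ofReal t < c
  · simp [indicator, ht]
  · simp [indicator, ht]

/-- A bound for all truncations is a bound for the function. -/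
theorem lintegral_rpow_le_of_min {v : X → ℝ≥0∞} (hv : AEMeasurable v μ) {p : ℝ} (hp : 0 < p)
    {A : ℝ≥0∞} (h : ∀ N : ℕ, ∫⁻ x, min (v x) N ^ p ∂μ ≤ A) : ∫⁻ x, v x ^ p ∂μ ≤ A := by
  have hsup : ∀ x, v x ^ p = ⨆ N : ℕ, min (v x) N ^ p := fun x => by
    refine le_antisymm ?_ (iSup_le fun N => ENNReal.rpow_le_rpow (min_le_left _ _) hp.le)
    rcases eq_or_ne (v x) ∞ with hx | hx
    · rw [hx, ENNReal.top_rpow_of_pos hp, top_le_iff]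
      refine ENNReal.eq_top_of_forall_nnreal_le fun r => ?_
      obtain ⟨N, hN⟩ := exists_nat_ge (max 1 r ^ (1 / p : ℝ))
      refine le_iSup_of_le N ?_
      rw [min_eq_right le_top]
      have h1 : max 1 r ≤ (N : ℝ≥0) ^ p := by
        have := NNReal.rpow_le_rpow hN hp.le
        rwa [← NNReal.rpow_mul, one_div, inv_mul_cancel₀ hp.ne', NNReal.rpow_one] at this
      have h2 : r ≤ (N : ℝ≥0) ^ p := (le_max_right _ _).trans h1
      have h3 : ((N : ℝ≥0) : ℝ≥0∞) ^ p = (((N : ℝ≥0) ^ p : ℝ≥0) : ℝ≥0∞) :=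
        (ENNReal.coe_rpow_of_nonneg _ hp.le).symm
      rw [← ENNReal.coe_natCast, h3]
      exact_mod_cast h2
    · obtain ⟨N, hN⟩ := ENNReal.exists_nat_gt hx
      refine le_iSup_of_le N ?_
      rw [min_eq_left hN.le]
  simp_rw [hsup]
  rw [lintegral_iSup' (fun N => (hv.min aemeasurable_const).pow_const p)]
  · exact iSup_le h
  · refine Eventually.of_forall fun x m n hmn => ENNReal.rpow_le_rpow ?_ hp.le
    exact min_le_min_left _ (by exact_mod_cast hmn)

theorem ENNReal.mul_rpow_sub_one {p : ℝ} (hp : 1 < p) (a : ℝ≥0∞) : a * a ^ (p - 1) = a ^ p := by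
  conv_lhs => rw [← ENNReal.rpow_one a, ← ENNReal.rpow_mul, one_mul]
  rw [← ENNReal.rpow_add_of_nonneg _ _ zero_le_one (by linarith)]
  congr 1; ring

theorem ENNReal.le_one_add_rpow {p : ℝ} (hp : 1 ≤ p) (a : ℝ≥0∞) : a ≤ 1 + a ^ p := by
  rcases le_total a 1 with h | h
  · exact h.trans le_self_add
  · refine le_trans ?_ le_add_self
    conv_lhs => rw [← ENNReal.rpow_one a]
    exact ENNReal.rpow_le_rpow_of_exponent_le h hp

end LayerCake

section MaximalInequalities

variable {X : Type*} [MetricSpace X] [MeasurableSpace X] [BorelSpace X] {μ : Measure X} {D : ℝ≥0}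

/-- The weak type inequality applied to the part of `u` above height `t / 2`. -/
theorem IsDoubling.mul_measure_lt_maxFn_le (hμ : IsDoubling μ D) {u : X → ℝ≥0∞}
    (hu : Measurable u) (t : ℝ≥0∞) :
    t * μ {x | t < maxFn μ u x} ≤ 2 * D ^ 2 * ∫⁻ x, {x | t < 2 * u x}.indicator u x ∂μ := by
  have hsub : {x | t < maxFn μ u x} ⊆
      {x | t / 2 < maxFn μ ({x | t < 2 * u x}.indicator u) x} := by
    intro x hx
    have hmeas : MeasurableSet {x | t < 2 * u x} := measurableSet_lt measurable_const
      (hu.const_mul 2)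
    have h1 : maxFn μ u x ≤ maxFn μ ({x | t < 2 * u x}.indicator u) x + t / 2 := by
      refine (maxFn_mono (v := fun z => {x | t < 2 * u x}.indicator u z + t / 2)
        (Eventually.of_forall fun z => ?_) x).trans
        ((maxFn_add_le (hu.indicator hmeas).aemeasurable x).trans ?_)
      · by_cases hz : t < 2 * u z
        · simp [indicator, hz]
        · simp only [indicator, mem_ofPred_eq, hz, if_false, zero_add]
          rw [ENNReal.le_div_iff_mul_le (Or.inl two_ne_zero) (Or.inl ENNReal.ofNat_ne_top), mul_comm]
          exact not_lt.1 hz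
      · gcongr
        exact maxFn_le_const (fun _ => le_rfl) x
    by_contra hcon
    simp only [mem_ofPred_eq, not_lt] at hcon hx
    have := hx.trans_le (h1.trans (add_le_add_left hcon _))
    rw [ENNReal.add_halves] at this
    exact lt_irrefl _ this
  calc t * μ {x | t < maxFn μ u x}
      ≤ t * μ {x | t / 2 < maxFn μ ({x | t < 2 * u x}.indicator u) x} := by gcongr
    _ = 2 * (t / 2 * μ {x | t / 2 < maxFn μ ({x | t < 2 * u x}.indicator u) x}) := by
        rw [← mul_assoc, ENNReal.mul_div_cancel two_ne_zero ENNReal.ofNat_ne_top]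
    _ ≤ 2 * (D ^ 2 * ∫⁻ x, {x | t < 2 * u x}.indicator u x ∂μ) := by
        exact mul_le_mul' le_rfl (hμ.weak_type _ _)
    _ = _ := by ring

/-- The maximal function is bounded on `L^p` for `1 < p < ∞`. The layer cake formula is applied to
truncations because it requires finite values. -/
theorem IsDoubling.strong_type (hμ : IsDoubling μ D) {p : ℝ} (hp : 1 < p) :
    ∃ C : ℝ≥0∞, C ≠ ∞ ∧ ∀ u : X → ℝ≥0∞, AEMeasurable u μ →
      ∫⁻ x, maxFn μ u x ^ p ∂μ ≤ C * ∫⁻ x, u x ^ p ∂μ := by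
  have := hμ.sigmaFinite
  have hp0 : 0 < p := by linarith
  refine ⟨ENNReal.ofReal p * (2 * D ^ 2 * (2 ^ (p - 1) / ENNReal.ofReal (p - 1))), ?_, ?_⟩
  · have h1 : ENNReal.ofReal (p - 1) ≠ 0 := (ENNReal.ofReal_pos.2 (by linarith)).ne'
    have h2 : (2 : ℝ≥0∞) ^ (p - 1) ≠ ∞ :=
      ENNReal.rpow_ne_top_of_nonneg (by linarith) ENNReal.ofNat_ne_top
    exact ENNReal.mul_ne_top ENNReal.ofReal_ne_top (ENNReal.mul_ne_top
      (ENNReal.mul_ne_top ENNReal.ofNat_ne_top (ENNReal.pow_ne_top ENNReal.coe_ne_top))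
      (ENNReal.div_ne_top h2 h1))
  intro u₀ hu₀
  obtain ⟨u, hu, huu⟩ := hu₀
  have hpow : ∫⁻ x, u₀ x ^ p ∂μ = ∫⁻ x, u x ^ p ∂μ :=
    lintegral_congr_ae (huu.mono fun x hx => by simp only [hx])
  rw [maxFn_congr huu, hpow]
  refine lintegral_rpow_le_of_min (measurable_maxFn u).aemeasurable hp0 fun N => ?_
  rw [lintegral_rpow_eq_lintegral_meas_lt ((measurable_maxFn u).min measurable_const).aemeasurable
    (fun x => ((min_le_right _ _).trans_lt (ENNReal.natCast_lt_top N)).ne) hp0, mul_assoc]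
  gcongr
  -- the integrand to which Tonelli's theorem is applied; the weak type inequality has used up one
  -- factor `t`, whence the exponent `p - 2`
  set W : ℝ → X → ℝ≥0∞ := fun t x => {t : ℝ | ENNReal.ofReal t < 2 * u x}.indicator
    (fun t => ENNReal.ofReal (t ^ (p - 1 - 1))) t * u x with hW
  have hWm : Measurable (Function.uncurry W) := by
    refine Measurable.mul ?_ (hu.comp measurable_snd)
    have : (fun a : ℝ × X => {t : ℝ | ENNReal.ofReal t < 2 * u a.2}.indicator
        (fun t => ENNReal.ofReal (t ^ (p - 1 - 1))) a.1) =
        {a : ℝ × X | ENNReal.ofReal a.1 < 2 * u a.2}.indicator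
          (fun a => ENNReal.ofReal (a.1 ^ (p - 1 - 1))) := by
      ext a; simp [indicator]
    rw [this]
    refine Measurable.indicator (by fun_prop) (measurableSet_lt (by fun_prop) ?_)
    exact (hu.comp measurable_snd).const_mul 2
  calc ∫⁻ t in Ioi (0 : ℝ), μ {x | ENNReal.ofReal t < min (maxFn μ u x) N} *
        ENNReal.ofReal (t ^ (p - 1))
      ≤ ∫⁻ t in Ioi (0 : ℝ), 2 * D ^ 2 * ∫⁻ x, W t x ∂μ := by
        refine setLIntegral_mono' measurableSet_Ioi fun t ht => ?_
        have ht : 0 < t := ht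
        have hpow : ENNReal.ofReal (t ^ (p - 1)) =
            ENNReal.ofReal t * ENNReal.ofReal (t ^ (p - 1 - 1)) := by
          rw [← ENNReal.ofReal_mul ht.le]
          congr 1
          rw [Real.rpow_sub_one ht.ne' (p - 1)]
          field_simp
        calc μ {x | ENNReal.ofReal t < min (maxFn μ u x) N} * ENNReal.ofReal (t ^ (p - 1))
            ≤ μ {x | ENNReal.ofReal t < maxFn μ u x} * ENNReal.ofReal (t ^ (p - 1)) := by
              gcongr with x
              exact min_le_left _ _
          _ = ENNReal.ofReal (t ^ (p - 1 - 1)) *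
              (ENNReal.ofReal t * μ {x | ENNReal.ofReal t < maxFn μ u x}) := by rw [hpow]; ring
          _ ≤ ENNReal.ofReal (t ^ (p - 1 - 1)) * (2 * D ^ 2 *
              ∫⁻ x, {x | ENNReal.ofReal t < 2 * u x}.indicator u x ∂μ) := by
              exact mul_le_mul' le_rfl (hμ.mul_measure_lt_maxFn_le hu _)
          _ = 2 * D ^ 2 * ∫⁻ x, W t x ∂μ := by
              rw [mul_left_comm]
              congr 1
              rw [← lintegral_const_mul']
              · refine lintegral_congr fun x => ?_
                simp only [hW, indicator, mem_ofPred_eq]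
                split_ifs <;> simp
              · exact ENNReal.ofReal_ne_top
    _ = 2 * D ^ 2 * ∫⁻ x, (∫⁻ t in Ioi (0 : ℝ), W t x) ∂μ := by
        rw [lintegral_const_mul', lintegral_lintegral_swap hWm.aemeasurable]
        exact ENNReal.mul_ne_top ENNReal.ofNat_ne_top (ENNReal.pow_ne_top ENNReal.coe_ne_top)
    _ ≤ 2 * D ^ 2 * ∫⁻ x, 2 ^ (p - 1) / ENNReal.ofReal (p - 1) * u x ^ p ∂μ := by
        refine mul_le_mul' le_rfl (lintegral_mono fun x => ?_)
        calc ∫⁻ t in Ioi (0 : ℝ), W t x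
            = (∫⁻ t in Ioi (0 : ℝ), {t : ℝ | ENNReal.ofReal t < 2 * u x}.indicator
              (fun t => ENNReal.ofReal (t ^ (p - 1 - 1))) t) * u x := by
              refine lintegral_mul_const _ ?_
              refine Measurable.indicator (by fun_prop) ?_
              exact measurableSet_lt (by fun_prop) measurable_const
          _ ≤ (2 * u x) ^ (p - 1) / ENNReal.ofReal (p - 1) * u x := by
              gcongr
              exact lintegral_Ioi_rpow_le (by linarith) _
          _ = 2 ^ (p - 1) / ENNReal.ofReal (p - 1) * u x ^ p := by
              rw [ENNReal.mul_rpow_of_nonneg _ _ (by linarith), ← ENNReal.mul_rpow_sub_one hp (u x)]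
              simp only [div_eq_mul_inv]
              ring
    _ = _ := by
        rw [lintegral_const_mul _ (hu.pow_const p), mul_assoc, mul_assoc, mul_assoc]

/-! ### The Fefferman–Stein inequality -/

/-- `G` dominates the mean oscillations of `F`: on each ball `B` there is a constant `a` such that
the mean of `|F - a|` over `B` is at most `G x` for every `x ∈ B`. If `B` is the whole space, then
`a = 0` is required, so that constants have to be controlled by `G` in a bounded space. -/
def OscDominated (μ : Measure X) (F : X → ℂ) (G : X → ℝ≥0∞) : Prop :=
  ∀ y r, 0 < r → ∃ a : ℂ, (ball y r = univ → a = 0) ∧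
    ∀ x ∈ ball y r, ∫⁻ z in ball y r, ‖F z - a‖ₑ ∂μ ≤ G x * μ (ball y r)

/-- The local step of the good-`λ` inequality: near a point `z` where the maximal function is at
most `t`, its large values at comparable distances come from `F - a` near `x`. -/
theorem IsDoubling.good_lambda_local (hμ : IsDoubling μ D) {F : X → ℂ}
    (hF : AEStronglyMeasurable F μ) {G : X → ℝ≥0∞} (hG : OscDominated μ F G) {t γ : ℝ≥0∞}
    (ht0 : t ≠ 0) (ht : t ≠ ∞) (hγ : γ ≤ 1) {x z : X} {r : ℝ} (hr : 0 < r)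
    (hxz : dist z x < 2 * r) (hz : maxFn μ (fun y => ‖F y‖ₑ) z ≤ t) (hx : G x ≤ γ * t) :
    μ ({y | (D ^ 4 + 3) * t < maxFn μ (fun y => ‖F y‖ₑ) y} ∩ ball x (4 * r)) ≤
      D ^ 5 * γ * μ (ball x r) := by
  obtain ⟨a, -, ha⟩ := hG x (8 * r) (by positivity)
  set B := ball x (8 * r) with hB
  have hxB : x ∈ B := mem_ball_self (by positivity)
  have hzB : z ∈ B := mem_ball.2 (by linarith)
  set v : X → ℝ≥0∞ := B.indicator fun y => ‖F y - a‖ₑ with hv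
  have hv_int : ∫⁻ y, v y ∂μ ≤ γ * t * μ B := by
    rw [hv, lintegral_indicator measurableSet_ball]
    exact (ha x hxB).trans (by gcongr)
  -- the means of `|F - a|` and of `|F|` over `B` are both at most `t`, the latter because `z ∈ B`
  have ha2 : ‖a‖ₑ ≤ 2 * t := by
    have h1 : ‖a‖ₑ * μ B ≤ 2 * t * μ B := by
      calc ‖a‖ₑ * μ B = ∫⁻ _ in B, ‖a‖ₑ ∂μ := by simp
        _ ≤ ∫⁻ y in B, (‖F y - a‖ₑ + ‖F y‖ₑ) ∂μ := by
            refine lintegral_mono fun y => ?_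
            have : a = -(F y - a) + F y := by ring
            calc ‖a‖ₑ = ‖-(F y - a) + F y‖ₑ := by rw [← this]
              _ ≤ ‖-(F y - a)‖ₑ + ‖F y‖ₑ := enorm_add_le _ _
              _ = ‖F y - a‖ₑ + ‖F y‖ₑ := by rw [enorm_neg]
        _ = ∫⁻ y in B, ‖F y - a‖ₑ ∂μ + ∫⁻ y in B, ‖F y‖ₑ ∂μ :=
            lintegral_add_right' _ hF.enorm.restrict
        _ ≤ γ * t * μ B + t * μ B := by
            gcongr
            · exact (ha x hxB).trans (by gcongr)
            · exact (hμ.lintegral_le_maxFn _ hzB).trans (by gcongr)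
        _ ≤ 1 * t * μ B + t * μ B := by gcongr
        _ = 2 * t * μ B := by ring
    exact (ENNReal.mul_le_mul_iff_left (hμ.pos _ _ (by positivity)).ne' (hμ.ne_top _ _)).1 h1
  -- a ball with a large mean of `|F|` is small, since otherwise its dilate contains `z`; hence it
  -- lies in `B`, where `|F| ≤ v + 2 t`
  have hsub : {y | (D ^ 4 + 3) * t < maxFn μ (fun y => ‖F y‖ₑ) y} ∩ ball x (4 * r) ⊆
      {y | t < maxFn μ v y} := by
    rintro y ⟨hy, hyx⟩
    obtain ⟨w, s, hyw, hws⟩ := lt_maxFn_iff.1 hy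
    have hs : 0 < s := pos_of_mem_ball hyw
    rw [mem_ball] at hyw hyx
    have hsr : s < r := by
      by_contra! hsr
      refine absurd hws (not_lt.2 ?_)
      have hzw : z ∈ ball w (2 ^ 4 * s) := by
        rw [mem_ball]
        have := dist_triangle4 z x y w
        rw [dist_comm x y] at this
        linarith
      refine ENNReal.div_le_of_le_mul ?_
      calc ∫⁻ y in ball w s, ‖F y‖ₑ ∂μ ≤ ∫⁻ y in ball w (2 ^ 4 * s), ‖F y‖ₑ ∂μ :=
            lintegral_mono_set (ball_subset_ball (by linarith))
        _ ≤ t * μ (ball w (2 ^ 4 * s)) := (hμ.lintegral_le_maxFn _ hzw).trans (by gcongr)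
        _ ≤ t * (D ^ 4 * μ (ball w s)) := by gcongr; exact hμ.pow _ hs 4
        _ = D ^ 4 * t * μ (ball w s) := by ring
        _ ≤ (D ^ 4 + 3) * t * μ (ball w s) := by gcongr; exact le_self_add
    have hwB : ball w s ⊆ B := by
      refine ball_subset_ball' ?_
      have := dist_triangle w y x
      rw [dist_comm w y] at this
      linarith
    by_contra hcon
    simp only [mem_ofPred_eq, not_lt] at hcon
    refine absurd hws (not_lt.2 (ENNReal.div_le_of_le_mul ?_))
    calc ∫⁻ y in ball w s, ‖F y‖ₑ ∂μ ≤ ∫⁻ y in ball w s, (v y + ‖a‖ₑ) ∂μ := by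
          refine setLIntegral_mono' measurableSet_ball fun y hy => ?_
          rw [hv, indicator_of_mem (hwB hy)]
          calc ‖F y‖ₑ = ‖(F y - a) + a‖ₑ := by rw [sub_add_cancel]
            _ ≤ _ := enorm_add_le _ _
      _ = ∫⁻ y in ball w s, v y ∂μ + ‖a‖ₑ * μ (ball w s) := by
          rw [lintegral_add_right _ measurable_const]; simp
      _ ≤ t * μ (ball w s) + 2 * t * μ (ball w s) := by
          gcongr
          exact (hμ.lintegral_le_maxFn v (mem_ball.2 hyw)).trans (by gcongr)
      _ = 3 * t * μ (ball w s) := by ring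
      _ ≤ (D ^ 4 + 3) * t * μ (ball w s) := by gcongr; exact le_add_self
  have h2 : t * μ {y | t < maxFn μ v y} ≤ t * (D ^ 5 * γ * μ (ball x r)) := by
    calc t * μ {y | t < maxFn μ v y} ≤ D ^ 2 * ∫⁻ y, v y ∂μ := hμ.weak_type v t
      _ ≤ D ^ 2 * (γ * t * (D ^ 3 * μ (ball x r))) := by
          gcongr
          refine hv_int.trans ?_
          gcongr
          exact hμ.measure_le x hr 3 (ball_subset_ball (by linarith))
      _ = t * (D ^ 5 * γ * μ (ball x r)) := by ring
  exact (measure_mono hsub).trans ((ENNReal.mul_le_mul_iff_right ht0 ht).1 h2)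

/-- The good-`λ` inequality relating the maximal function of `F` to its mean oscillations. The local
estimate is summed over a Vitali covering of the set on the left by balls `ball x (ρ x)`, where
`ρ x` is the distance of `x` to the complement of `{t < maxFn F}`. -/
theorem IsDoubling.good_lambda (hμ : IsDoubling μ D) {F : X → ℂ}
    (hF : AEStronglyMeasurable F μ) {G : X → ℝ≥0∞} (hG : OscDominated μ F G) {t γ : ℝ≥0∞}
    (ht0 : t ≠ 0) (ht : t ≠ ∞) (hγ0 : γ ≠ 0) (hγ : γ ≤ 1) :
    μ ({y | (D ^ 4 + 3) * t < maxFn μ (fun y => ‖F y‖ₑ) y} ∩ {y | G y ≤ γ * t}) ≤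
      D ^ 5 * γ * μ {y | t < maxFn μ (fun y => ‖F y‖ₑ) y} := by
  have := hμ.secondCountable
  set K : ℝ≥0∞ := D ^ 4 + 3
  have hK1 : 1 ≤ K := le_add_left (by norm_num)
  set u : X → ℝ≥0∞ := fun y => ‖F y‖ₑ
  set Ω := {y | t < maxFn μ u y} with hΩ
  set E := {y | K * t < maxFn μ u y} ∩ {y | G y ≤ γ * t} with hE
  rcases E.eq_empty_or_nonempty with hE0 | ⟨x₀, hx₀⟩
  · simp [hE0]
  have hD : (1 : ℝ≥0∞) ≤ D := by exact_mod_cast hμ.one_le x₀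
  have hEΩ : E ⊆ Ω := fun y hy => by
    have h1 : K * t < maxFn μ u y := hy.1
    exact lt_of_le_of_lt (le_mul_of_one_le_left zero_le hK1) h1
  by_cases hΩu : Ω = univ
  · by_cases hfin : μ univ = ∞
    · rw [hΩu, hfin, ENNReal.mul_top (mul_ne_zero (pow_ne_zero _ (zero_lt_one.trans_le hD).ne') hγ0)]
      exact le_top
    -- a bounded space is itself a ball, and there the means of `|F|` are dominated by `G`
    obtain ⟨R, hR, hball⟩ := hμ.isBounded_of_measure_lt_top hfin x₀
    obtain ⟨a, ha0, ha⟩ := hG x₀ R hR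
    have ha := ha x₀ (mem_ball_self hR)
    rw [ha0 hball, hball, Measure.restrict_univ] at ha
    simp only [sub_zero] at ha
    rw [hΩu]
    have h2 : t * μ E ≤ t * (D ^ 5 * γ * μ univ) := by
      calc t * μ E ≤ t * μ Ω := by gcongr
        _ ≤ D ^ 2 * ∫⁻ y, u y ∂μ := hμ.weak_type u t
        _ ≤ D ^ 2 * (γ * t * μ univ) := by
            gcongr
            exact ha.trans (by gcongr; exact hx₀.2)
        _ = t * (D ^ 2 * γ * μ univ) := by ring
        _ ≤ t * (D ^ 5 * γ * μ univ) := by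
            gcongr t * (?_ * γ * μ univ)
            exact pow_le_pow_right₀ hD (by norm_num)
    exact (ENNReal.mul_le_mul_iff_right ht0 ht).1 h2
  have hΩo : IsOpen Ω := isOpen_lt_maxFn u t
  obtain ⟨z₀, hz₀⟩ : (Ωᶜ).Nonempty := nonempty_compl.2 hΩu
  set ρ : X → ℝ := fun x => infDist x Ωᶜ with hρ
  have hρpos : ∀ x ∈ Ω, 0 < ρ x := fun x hx =>
    (hΩo.isClosed_compl.notMem_iff_infDist_pos ⟨z₀, hz₀⟩).1 (fun h => h hx)
  -- on bounded sets the radii `ρ x` are bounded, as the covering theorem requires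
  have key : ∀ N : ℕ, μ (E ∩ ball x₀ N) ≤ D ^ 5 * γ * μ Ω := by
    intro N
    obtain ⟨s, hsE, hdisj, hcov⟩ := Vitali.exists_disjoint_subfamily_covering_enlargement_ball
      (E ∩ ball x₀ N) id ρ (N + dist x₀ z₀) (fun x hx => by
        refine (infDist_le_dist_of_mem hz₀).trans ?_
        have h1 := dist_triangle x x₀ z₀
        have h2 := mem_ball.1 hx.2
        linarith) 4 (by norm_num)
    have hsΩ : ∀ x ∈ s, x ∈ Ω := fun x hx => hEΩ (hsE hx).1
    have hcount : s.Countable := hdisj.countable_of_isOpen (fun _ _ => isOpen_ball)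
      (fun q hq => ⟨q, mem_ball_self (hρpos q (hsΩ q hq))⟩)
    have hsub : E ∩ ball x₀ N ⊆ ⋃ x ∈ s, (E ∩ ball x (4 * ρ x)) := by
      intro x hx
      obtain ⟨b, hb, h⟩ := hcov x hx
      exact mem_biUnion hb ⟨hx.1, h (mem_ball_self (hρpos x (hEΩ hx.1)))⟩
    have := hcount.to_subtype
    calc μ (E ∩ ball x₀ N) ≤ ∑' x : s, μ (E ∩ ball x (4 * ρ x)) :=
          (measure_mono hsub).trans (measure_biUnion_le μ hcount _)
      _ ≤ ∑' x : s, D ^ 5 * γ * μ (ball x (ρ x)) := by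
          refine ENNReal.tsum_le_tsum fun x => ?_
          have hx := hsE x.2
          have hpos := hρpos x (hsΩ x x.2)
          obtain ⟨z, hz, hzx⟩ := (infDist_lt_iff (x := (x : X)) ⟨z₀, hz₀⟩).1
            (show ρ x < 2 * ρ x by linarith)
          refine (measure_mono ?_).trans (hμ.good_lambda_local hF hG ht0 ht hγ hpos
            (by rwa [dist_comm]) (not_lt.1 hz) hx.1.2)
          exact inter_subset_inter_left _ inter_subset_left
      _ = D ^ 5 * γ * ∑' x : s, μ (ball x (ρ x)) := ENNReal.tsum_mul_left
      _ = D ^ 5 * γ * μ (⋃ x ∈ s, ball x (ρ x)) := by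
          rw [measure_biUnion (f := fun x => ball x (ρ x)) hcount hdisj fun _ _ => measurableSet_ball]
      _ ≤ D ^ 5 * γ * μ Ω := by
          gcongr
          refine iUnion₂_subset fun x hx => ?_
          intro y hy
          by_contra hyΩ
          have : ρ x ≤ dist x y := infDist_le_dist_of_mem hyΩ
          rw [mem_ball, dist_comm] at hy
          linarith
  have hEu : E = ⋃ N : ℕ, E ∩ ball x₀ N := by
    rw [← inter_iUnion, iUnion_ball_nat, inter_univ]
  rw [hEu, Monotone.measure_iUnion]
  · exact iSup_le key
  · exact fun m n hmn => inter_subset_inter_right _ (ball_subset_ball (by exact_mod_cast hmn))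

/-- The Fefferman–Stein inequality: a function which is a priori in some `L^{p₀}`, `1 < p₀ ≤ p`, is
bounded in `L^p` by any function dominating its mean oscillations. -/
theorem IsDoubling.fefferman_stein (hμ : IsDoubling μ D) {p : ℝ} (hp : 1 < p) :
    ∃ C : ℝ≥0∞, C ≠ ∞ ∧ ∀ (F : X → ℂ) (G : X → ℝ≥0∞) (p₀ : ℝ), AEStronglyMeasurable F μ →
      AEMeasurable G μ → OscDominated μ F G → 1 < p₀ → p₀ ≤ p → ∫⁻ x, ‖F x‖ₑ ^ p₀ ∂μ ≠ ∞ →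
      ∫⁻ x, ‖F x‖ₑ ^ p ∂μ ≤ C * ∫⁻ x, G x ^ p ∂μ := by
  have hp0 : 0 < p := by linarith
  set K : ℝ≥0 := D ^ 4 + 3 with hK
  have hKpos : 0 < K := by positivity
  set γ : ℝ≥0 := (2 * (D + 1) ^ 5 * (K + 1) ^ p)⁻¹ with hγdef
  have hγ0 : γ ≠ 0 := by positivity
  have hγ1 : γ ≤ 1 := by
    refine inv_le_one_of_one_le₀ ?_
    have h1 : (1 : ℝ≥0) ≤ (D + 1) ^ 5 := one_le_pow₀ (by simp)
    have h2 : (1 : ℝ≥0) ≤ (K + 1) ^ p := NNReal.one_le_rpow (by simp) hp0.le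
    calc (1 : ℝ≥0) ≤ 2 * 1 * 1 := by norm_num
      _ ≤ 2 * (D + 1) ^ 5 * (K + 1) ^ p := by gcongr
  -- the choice of `γ` makes the good-`λ` term absorbable
  have hγK : K ^ p * (D ^ 5 * γ) ≤ 2⁻¹ := by
    have h0 : (D + 1) ^ 5 * (K + 1) ^ p * γ = 2⁻¹ := by
      rw [hγdef]
      have : (K + 1) ^ p ≠ 0 := by positivity
      field_simp
    calc K ^ p * (D ^ 5 * γ) ≤ (K + 1) ^ p * ((D + 1) ^ 5 * γ) := by
          gcongr <;> simp
      _ = (D + 1) ^ 5 * (K + 1) ^ p * γ := by ring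
      _ ≤ 2⁻¹ := h0.le
  refine ⟨D ^ p * (2 * ((K ^ p : ℝ≥0) * ((γ⁻¹ : ℝ≥0) : ℝ≥0∞) ^ p)), ?_, ?_⟩
  · refine ENNReal.mul_ne_top (ENNReal.rpow_ne_top_of_nonneg hp0.le ENNReal.coe_ne_top) ?_
    refine ENNReal.mul_ne_top ENNReal.ofNat_ne_top (ENNReal.mul_ne_top ENNReal.coe_ne_top ?_)
    exact ENNReal.rpow_ne_top_of_nonneg hp0.le ENNReal.coe_ne_top
  intro F G p₀ hF hGm hG hp₀ hp₀p hfin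
  set u : X → ℝ≥0∞ := fun y => ‖F y‖ₑ with hu
  have hum : AEMeasurable u μ := hF.enorm
  have hMu := measurable_maxFn (μ := μ) u
  -- the main estimate, for truncations of the maximal function; `G` is truncated as well, so that
  -- the layer cake formula applies to it
  have main : ∫⁻ x, maxFn μ u x ^ p ∂μ ≤
      2 * ((K ^ p : ℝ≥0) * ((γ⁻¹ : ℝ≥0) : ℝ≥0∞) ^ p) * ∫⁻ x, G x ^ p ∂μ := by
    refine lintegral_rpow_le_of_min hMu.aemeasurable hp0 fun N => ?_
    set φ : X → ℝ≥0∞ := fun x => min (maxFn μ u x) N with hφ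
    have hφm : Measurable φ := hMu.min measurable_const
    have hφN : ∀ x, φ x ≤ N := fun x => min_le_right _ _
    have hφtop : ∀ x, φ x ≠ ∞ := fun x => ((hφN x).trans_lt (ENNReal.natCast_lt_top N)).ne
    set g : X → ℝ≥0∞ := fun x => min ((γ⁻¹ : ℝ≥0) * G x) N with hg
    have hgm : AEMeasurable g μ := (hGm.const_mul _).min aemeasurable_const
    have hgtop : ∀ x, g x ≠ ∞ := fun x =>
      ((min_le_right _ _).trans_lt (ENNReal.natCast_lt_top N)).ne
    -- the a priori integrability makes it legitimate to absorb half of this integral below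
    have hI : ∫⁻ x, φ x ^ p ∂μ ≠ ∞ := by
      obtain ⟨C, hC, hCu⟩ := hμ.strong_type hp₀
      have hle : ∫⁻ x, φ x ^ p ∂μ ≤ (N : ℝ≥0∞) ^ (p - p₀) * (C * ∫⁻ x, u x ^ p₀ ∂μ) := by
        calc ∫⁻ x, φ x ^ p ∂μ ≤ ∫⁻ x, (N : ℝ≥0∞) ^ (p - p₀) * maxFn μ u x ^ p₀ ∂μ := by
              refine lintegral_mono fun x => ?_
              calc φ x ^ p = φ x ^ (p - p₀) * φ x ^ p₀ := by
                    rw [← ENNReal.rpow_add_of_nonneg _ _ (by linarith) (by linarith)]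
                    congr 1; ring
                _ ≤ _ := by
                    exact mul_le_mul' (ENNReal.rpow_le_rpow (hφN x) (by linarith))
                      (ENNReal.rpow_le_rpow (min_le_left _ _) (by linarith))
          _ = (N : ℝ≥0∞) ^ (p - p₀) * ∫⁻ x, maxFn μ u x ^ p₀ ∂μ :=
              lintegral_const_mul _ (hMu.pow_const _)
          _ ≤ _ := by gcongr; exact hCu u hum
      refine ne_top_of_le_ne_top ?_ hle
      exact ENNReal.mul_ne_top (ENNReal.rpow_ne_top_of_nonneg (by linarith)
        (ENNReal.natCast_ne_top N)) (ENNReal.mul_ne_top hC hfin)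
    -- the good-`λ` inequality integrated against `p t ^ (p - 1) dt`
    have hscale : ∫⁻ x, ((K⁻¹ : ℝ≥0) * φ x) ^ p ∂μ ≤
        D ^ 5 * γ * ∫⁻ x, φ x ^ p ∂μ + ∫⁻ x, g x ^ p ∂μ := by
      rw [lintegral_rpow_eq_lintegral_meas_lt (hφm.const_mul _).aemeasurable
        (fun x => ENNReal.mul_ne_top ENNReal.coe_ne_top (hφtop x)) hp0,
        lintegral_rpow_eq_lintegral_meas_lt hφm.aemeasurable hφtop hp0,
        lintegral_rpow_eq_lintegral_meas_lt hgm hgtop hp0, mul_left_comm, ← mul_add,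
        ← lintegral_const_mul' (D ^ 5 * γ : ℝ≥0∞) _
          (ENNReal.mul_ne_top (ENNReal.pow_ne_top ENNReal.coe_ne_top) ENNReal.coe_ne_top)]
      gcongr
      rw [← lintegral_add_left']
      swap
      · refine (AEMeasurable.mul ?_ (by fun_prop)).const_mul _
        refine (Antitone.measurable fun a b hab => measure_mono fun x hx => ?_).aemeasurable
        exact (ENNReal.ofReal_le_ofReal hab).trans_lt hx
      refine setLIntegral_mono' measurableSet_Ioi fun t ht => ?_
      have ht : 0 < t := ht
      have ht0 : ENNReal.ofReal t ≠ 0 := (ENNReal.ofReal_pos.2 ht).ne'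
      rw [← mul_assoc, ← add_mul]
      gcongr
      by_cases htN : ENNReal.ofReal t < N
      · have hsub : {x | ENNReal.ofReal t < (K⁻¹ : ℝ≥0) * φ x} ⊆
            ({y | (D ^ 4 + 3) * ENNReal.ofReal t < maxFn μ u y} ∩
              {y | G y ≤ γ * ENNReal.ofReal t}) ∪ {x | ENNReal.ofReal t < g x} := by
          intro x hx
          simp only [mem_ofPred_eq, mem_union, mem_inter_iff] at hx ⊢
          by_cases hGx : G x ≤ γ * ENNReal.ofReal t
          · left
            refine ⟨lt_of_lt_of_le ?_ (min_le_left (maxFn μ u x) N), hGx⟩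
            have h1 : ((D : ℝ≥0∞) ^ 4 + 3) = (K : ℝ≥0∞) := by simp [hK]
            rw [h1]
            calc (K : ℝ≥0∞) * ENNReal.ofReal t < K * ((K⁻¹ : ℝ≥0) * φ x) :=
                  (ENNReal.mul_lt_mul_iff_right (by exact_mod_cast hKpos.ne')
                    ENNReal.coe_ne_top).2 hx
              _ = φ x := by
                  rw [← mul_assoc, ← ENNReal.coe_mul, mul_inv_cancel₀ hKpos.ne']; simp
          · right
            refine lt_min ?_ htN
            calc ENNReal.ofReal t = (γ⁻¹ : ℝ≥0) * (γ * ENNReal.ofReal t) := by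
                  rw [← mul_assoc, ← ENNReal.coe_mul, inv_mul_cancel₀ hγ0]; simp
              _ < (γ⁻¹ : ℝ≥0) * G x :=
                  (ENNReal.mul_lt_mul_iff_right (by exact_mod_cast inv_ne_zero hγ0)
                    ENNReal.coe_ne_top).2 (not_le.1 hGx)
        refine (measure_mono hsub).trans ((measure_union_le _ _).trans ?_)
        gcongr
        refine (hμ.good_lambda hF hG ht0 ENNReal.ofReal_ne_top (by exact_mod_cast hγ0)
          (by exact_mod_cast hγ1)).trans ?_
        refine mul_le_mul' le_rfl (measure_mono fun x hx => ?_)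
        exact lt_min hx htN
      · have h0 : {x | ENNReal.ofReal t < (K⁻¹ : ℝ≥0) * φ x} = ∅ := by
          refine eq_empty_of_forall_notMem fun x hx => htN (lt_of_lt_of_le hx ?_)
          have hK1 : K⁻¹ ≤ 1 := inv_le_one_of_one_le₀ (le_add_left (by norm_num))
          calc ((K⁻¹ : ℝ≥0) : ℝ≥0∞) * φ x ≤ 1 * N := by
                gcongr
                · exact_mod_cast hK1
                · exact hφN x
            _ = N := one_mul _
        rw [h0]; simp
    have hKφ : ∫⁻ x, φ x ^ p ∂μ = (K ^ p : ℝ≥0) * ∫⁻ x, ((K⁻¹ : ℝ≥0) * φ x) ^ p ∂μ := by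
      rw [← lintegral_const_mul' _ _ ENNReal.coe_ne_top]
      refine lintegral_congr fun x => ?_
      rw [ENNReal.mul_rpow_of_nonneg _ _ hp0.le, ← mul_assoc, ← ENNReal.coe_rpow_of_nonneg _ hp0.le,
        ← ENNReal.coe_mul, ← NNReal.mul_rpow, mul_inv_cancel₀ hKpos.ne']
      simp
    have hgG : ∫⁻ x, g x ^ p ∂μ ≤ ((γ⁻¹ : ℝ≥0) : ℝ≥0∞) ^ p * ∫⁻ x, G x ^ p ∂μ := by
      rw [← lintegral_const_mul' _ _ (ENNReal.rpow_ne_top_of_nonneg hp0.le ENNReal.coe_ne_top)]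
      refine lintegral_mono fun x => ?_
      rw [← ENNReal.mul_rpow_of_nonneg _ _ hp0.le]
      exact ENNReal.rpow_le_rpow (min_le_left _ _) hp0.le
    set I := ∫⁻ x, φ x ^ p ∂μ with hIdef
    set J := ∫⁻ x, G x ^ p ∂μ
    have h1 : I ≤ I / 2 + (K ^ p : ℝ≥0) * (((γ⁻¹ : ℝ≥0) : ℝ≥0∞) ^ p * J) := by
      calc I = (K ^ p : ℝ≥0) * ∫⁻ x, ((K⁻¹ : ℝ≥0) * φ x) ^ p ∂μ := hKφ
        _ ≤ (K ^ p : ℝ≥0) * (D ^ 5 * γ * I + ((γ⁻¹ : ℝ≥0) : ℝ≥0∞) ^ p * J) := by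
            gcongr
            exact hscale.trans (by gcongr)
        _ = ((K ^ p * (D ^ 5 * γ) : ℝ≥0) : ℝ≥0∞) * I +
            (K ^ p : ℝ≥0) * (((γ⁻¹ : ℝ≥0) : ℝ≥0∞) ^ p * J) := by push_cast; ring
        _ ≤ ((2⁻¹ : ℝ≥0) : ℝ≥0∞) * I + (K ^ p : ℝ≥0) * (((γ⁻¹ : ℝ≥0) : ℝ≥0∞) ^ p * J) := by
            gcongr
        _ = _ := by
            rw [ENNReal.coe_inv two_ne_zero, ENNReal.div_eq_inv_mul]; simp
    have h2 : I / 2 ≤ (K ^ p : ℝ≥0) * (((γ⁻¹ : ℝ≥0) : ℝ≥0∞) ^ p * J) := by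
      have h3 : I / 2 ≠ ∞ := (ENNReal.div_lt_top hI two_ne_zero).ne
      refine (ENNReal.add_le_add_iff_left h3).1 ?_
      rwa [ENNReal.add_halves]
    calc I = 2 * (I / 2) := (ENNReal.mul_div_cancel two_ne_zero ENNReal.ofNat_ne_top).symm
      _ ≤ 2 * ((K ^ p : ℝ≥0) * (((γ⁻¹ : ℝ≥0) : ℝ≥0∞) ^ p * J)) := by gcongr
      _ = _ := by ring
  -- local integrability, needed for the differentiation theorem
  have hloc : ∀ x r, ∫⁻ z in ball x r, u z ∂μ ≠ ∞ := by
    intro x r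
    have hle : ∫⁻ z in ball x r, u z ∂μ ≤ μ (ball x r) + ∫⁻ z, u z ^ p₀ ∂μ := by
      calc ∫⁻ z in ball x r, u z ∂μ ≤ ∫⁻ z in ball x r, (1 + u z ^ p₀) ∂μ :=
            lintegral_mono fun z => ENNReal.le_one_add_rpow hp₀.le _
        _ = μ (ball x r) + ∫⁻ z in ball x r, u z ^ p₀ ∂μ := by
            rw [lintegral_add_left measurable_const]; simp
        _ ≤ _ := by gcongr; exact Measure.restrict_le_self
    exact ne_top_of_le_ne_top (ENNReal.add_ne_top.2 ⟨hμ.ne_top x r, hfin⟩) hle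
  calc ∫⁻ x, u x ^ p ∂μ ≤ ∫⁻ x, D ^ p * maxFn μ u x ^ p ∂μ := by
        refine lintegral_mono_ae ?_
        filter_upwards [hμ.ae_le_maxFn hum hloc] with x hx
        rw [← ENNReal.mul_rpow_of_nonneg _ _ hp0.le]
        exact ENNReal.rpow_le_rpow hx hp0.le
    _ = D ^ p * ∫⁻ x, maxFn μ u x ^ p ∂μ := lintegral_const_mul _ (hMu.pow_const p)
    _ ≤ _ := by rw [mul_assoc]; gcongr

end MaximalInequalities

/-! ### Bounded mean oscillation and the John–Nirenberg inequality -/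

section JohnNirenberg

variable {X : Type*} [MetricSpace X] [MeasurableSpace X] [BorelSpace X] {μ : Measure X} {D : ℝ≥0}

/-- `b` has mean oscillation at most `M` on every ball, measured against the constants `a x r`.
The constants need not be the means of `b`; this makes the condition stable under composition of
`b` with a `1`-Lipschitz function. -/
def BMOWith (μ : Measure X) (b : X → ℂ) (a : X → ℝ → ℂ) (M : ℝ≥0∞) : Prop :=
  ∀ x r, 0 < r → ∫⁻ z in ball x r, ‖b z - a x r‖ₑ ∂μ ≤ M * μ (ball x r)

namespace BMOWith

variable {b : X → ℂ} {a : X → ℝ → ℂ} {M : ℝ≥0∞}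

/-- The constants belonging to two nested balls of comparable size differ by at most a multiple of
the mean oscillation. -/
theorem enorm_sub_le (h : BMOWith μ b a M) (hμ : IsDoubling μ D) (hb : AEStronglyMeasurable b μ)
    {x y : X} {r s : ℝ} (hr : 0 < r) (hs : 0 < s) (n : ℕ) (h1 : ball x r ⊆ ball y s)
    (h2 : ball y s ⊆ ball x (2 ^ n * r)) : ‖a x r - a y s‖ₑ ≤ (1 + D ^ n) * M := by
  have hle : ‖a x r - a y s‖ₑ * μ (ball x r) ≤ (1 + D ^ n) * M * μ (ball x r) := by
    calc ‖a x r - a y s‖ₑ * μ (ball x r) = ∫⁻ _ in ball x r, ‖a x r - a y s‖ₑ ∂μ := by simp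
      _ ≤ ∫⁻ z in ball x r, (‖b z - a x r‖ₑ + ‖b z - a y s‖ₑ) ∂μ := by
          refine lintegral_mono fun z => ?_
          have : a x r - a y s = -(b z - a x r) + (b z - a y s) := by ring
          rw [this]
          refine (enorm_add_le _ _).trans ?_
          rw [enorm_neg]
      _ = ∫⁻ z in ball x r, ‖b z - a x r‖ₑ ∂μ + ∫⁻ z in ball x r, ‖b z - a y s‖ₑ ∂μ :=
          lintegral_add_left' (hb.sub aestronglyMeasurable_const).enorm.restrict _
      _ ≤ M * μ (ball x r) + M * (D ^ n * μ (ball x r)) := by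
          gcongr
          · exact h x r hr
          · refine (lintegral_mono_set h1).trans ((h y s hs).trans ?_)
            gcongr
            exact hμ.measure_le x hr n h2
      _ = _ := by ring
  exact (ENNReal.mul_le_mul_iff_left (hμ.pos _ _ hr).ne' (hμ.ne_top _ _)).1 hle

theorem enorm_sub_dilate_le (h : BMOWith μ b a M) (hμ : IsDoubling μ D)
    (hb : AEStronglyMeasurable b μ) (x : X) {r : ℝ} (hr : 0 < r) (n : ℕ) :
    ‖a x r - a x (2 ^ n * r)‖ₑ ≤ n * ((1 + D) * M) := by
  induction n with
  | zero => simp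
  | succ n ih =>
    have hstep : ‖a x (2 ^ n * r) - a x (2 ^ (n + 1) * r)‖ₑ ≤ (1 + D ^ 1) * M := by
      refine h.enorm_sub_le hμ hb (by positivity) (by positivity) 1 ?_ ?_
      · refine ball_subset_ball ?_
        gcongr <;> simp
      · exact ball_subset_ball (le_of_eq (by ring))
    calc ‖a x r - a x (2 ^ (n + 1) * r)‖ₑ
        = ‖(a x r - a x (2 ^ n * r)) + (a x (2 ^ n * r) - a x (2 ^ (n + 1) * r))‖ₑ := by
          rw [sub_add_sub_cancel]
      _ ≤ ‖a x r - a x (2 ^ n * r)‖ₑ + ‖a x (2 ^ n * r) - a x (2 ^ (n + 1) * r)‖ₑ :=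
          enorm_add_le _ _
      _ ≤ n * ((1 + D) * M) + (1 + D ^ 1) * M := add_le_add ih hstep
      _ = _ := by push_cast; ring

/-- The means over concentric balls grow at most logarithmically, hence slower than the ratio of
the radii. -/
theorem enorm_sub_mul_ratio_le (h : BMOWith μ b a M) (hμ : IsDoubling μ D)
    (hb : AEStronglyMeasurable b μ) (x : X) {s r : ℝ} (hs : 0 < s) (hsr : s ≤ r) :
    ‖a x s - a x r‖ₑ * ENNReal.ofReal (s / r) ≤ 2 * (1 + D) * M := by
  have hr : 0 < r := hs.trans_le hsr
  -- halving `s` halves the previous contribution, which leaves room for the step from `s` to `2 s`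
  have key : ∀ n : ℕ, ∀ s, 0 < s → s ≤ r → r ≤ 2 ^ n * s →
      ‖a x s - a x r‖ₑ * ENNReal.ofReal (s / r) ≤ 2 * (1 + D) * M := by
    intro n
    induction n with
    | zero =>
      intro s hs hsr hn
      have : s = r := le_antisymm hsr (by simpa using hn)
      simp [this]
    | succ n ih =>
      intro s hs hsr hn
      rcases le_total r (2 * s) with h2 | h2
      · have h3 := h.enorm_sub_le hμ hb (x := x) (y := x) hs hr 1 (ball_subset_ball hsr)
          (ball_subset_ball (by simpa using h2))
        calc ‖a x s - a x r‖ₑ * ENNReal.ofReal (s / r) ≤ (1 + D ^ 1) * M * 1 := by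
              gcongr
              rw [ENNReal.ofReal_le_one]
              exact (div_le_one hr).2 hsr
          _ = 1 * (1 + D) * M := by ring
          _ ≤ 2 * (1 + D) * M := by gcongr; norm_num
      · have h3 := h.enorm_sub_le hμ hb (x := x) (y := x) (r := s) (s := 2 * s) hs (by positivity) 1
          (ball_subset_ball (by linarith)) (ball_subset_ball (le_of_eq (by ring)))
        have h4 := ih (2 * s) (by positivity) h2 (hn.trans_eq (by ring))
        have h5 : ENNReal.ofReal (2 * s / r) = 2 * ENNReal.ofReal (s / r) := by
          rw [mul_div_assoc, ENNReal.ofReal_mul zero_le_two, ENNReal.ofReal_ofNat]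
        rw [h5] at h4
        have h6 : ‖a x (2 * s) - a x r‖ₑ * ENNReal.ofReal (s / r) ≤ (1 + D) * M := by
          refine (ENNReal.mul_le_mul_iff_right two_ne_zero ENNReal.ofNat_ne_top).1 ?_
          calc _ = ‖a x (2 * s) - a x r‖ₑ * (2 * ENNReal.ofReal (s / r)) := by ring
            _ ≤ _ := h4.trans_eq (by ring)
        calc ‖a x s - a x r‖ₑ * ENNReal.ofReal (s / r)
            = ‖(a x s - a x (2 * s)) + (a x (2 * s) - a x r)‖ₑ * ENNReal.ofReal (s / r) := by
              rw [sub_add_sub_cancel]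
          _ ≤ (‖a x s - a x (2 * s)‖ₑ + ‖a x (2 * s) - a x r‖ₑ) * ENNReal.ofReal (s / r) := by
              gcongr
              exact enorm_add_le _ _
          _ = ‖a x s - a x (2 * s)‖ₑ * ENNReal.ofReal (s / r) +
              ‖a x (2 * s) - a x r‖ₑ * ENNReal.ofReal (s / r) := add_mul _ _ _
          _ ≤ (1 + D ^ 1) * M * 1 + (1 + D) * M := by
              gcongr
              rw [ENNReal.ofReal_le_one]
              exact (div_le_one hr).2 hsr
          _ = _ := by ring
  obtain ⟨n, hn⟩ := pow_unbounded_of_one_lt (r / s) (one_lt_two : (1 : ℝ) < 2)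
  exact key n s hs hsr ((div_lt_iff₀ hs).1 hn).le

end BMOWith

/-- Lipschitz cutoff, equal to `1` on `ball x₀ r` and to `0` off `ball x₀ (2 * r)`. -/
noncomputable def ballCutoff (x₀ : X) (r : ℝ) (z : X) : ℝ := max 0 (min 1 (2 - dist z x₀ / r))

theorem ballCutoff_nonneg (x₀ : X) (r : ℝ) (z : X) : 0 ≤ ballCutoff x₀ r z := le_max_left _ _

theorem ballCutoff_le_one (x₀ : X) (r : ℝ) (z : X) : ballCutoff x₀ r z ≤ 1 :=
  max_le zero_le_one (min_le_left _ _)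

theorem ballCutoff_eq_one {x₀ z : X} {r : ℝ} (h : z ∈ ball x₀ r) : ballCutoff x₀ r z = 1 := by
  have hr := pos_of_mem_ball h
  have : dist z x₀ / r ≤ 1 := (div_le_one hr).2 (mem_ball.1 h).le
  rw [ballCutoff, min_eq_left (by linarith), max_eq_right zero_le_one]

theorem ballCutoff_eq_zero {x₀ z : X} {r : ℝ} (hr : 0 < r) (h : z ∉ ball x₀ (2 * r)) :
    ballCutoff x₀ r z = 0 := by
  have : 2 ≤ dist z x₀ / r := (le_div_iff₀ hr).2 (not_lt.1 h)
  rw [ballCutoff, max_eq_left]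
  exact (min_le_right _ _).trans (by linarith)

theorem abs_ballCutoff_sub_le {x₀ : X} {r : ℝ} (hr : 0 < r) (z y : X) :
    |ballCutoff x₀ r z - ballCutoff x₀ r y| ≤ dist z y / r := by
  have h1 : |ballCutoff x₀ r z - ballCutoff x₀ r y| ≤
      |(2 - dist z x₀ / r) - (2 - dist y x₀ / r)| := by
    refine (abs_max_sub_max_le_max _ _ _ _).trans (max_le (by simp) ?_)
    exact (abs_min_sub_min_le_max _ _ _ _).trans (max_le (by simp) le_rfl)
  refine h1.trans ?_
  rw [sub_sub_sub_cancel_left, ← sub_div, abs_div, abs_of_pos hr]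
  gcongr
  rw [abs_sub_comm]
  exact abs_dist_sub_le z y x₀

theorem measurable_ballCutoff (x₀ : X) (r : ℝ) : Measurable (ballCutoff x₀ r) := by
  have : Continuous (ballCutoff x₀ r) := by unfold ballCutoff; fun_prop
  exact this.measurable

namespace BMOWith

variable {b : X → ℂ} {a : X → ℝ → ℂ} {M : ℝ≥0∞}

/-- The mean oscillations of `(b - a x₀ r) η`, where `η` is a cutoff of `B = ball x₀ r`, are
dominated by the maximal function of the indicator of `B`. On balls which are small compared to `B`
this uses the product rule and the logarithmic growth of the means; on large balls the function
itself is small in the mean. -/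
theorem oscDominated_cutoff (h : BMOWith μ b a M) (hμ : IsDoubling μ D)
    (hb : AEStronglyMeasurable b μ) (x₀ : X) {r : ℝ} (hr : 0 < r) :
    OscDominated μ (fun z => (b z - a x₀ r) * ballCutoff x₀ r z)
      (fun x => ((2 + D) * D ^ 4 + (10 + 8 * D + D ^ 3) * D ^ 2) * M *
        maxFn μ ((ball x₀ r).indicator 1) x) := by
  intro y s hs
  set F : X → ℂ := fun z => (b z - a x₀ r) * ballCutoff x₀ r z with hF
  have hFle : ∀ z, ‖F z‖ₑ ≤ ‖b z - a x₀ r‖ₑ := fun z => by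
    rw [hF, enorm_mul]
    refine mul_le_of_le_one_right zero_le ?_
    rw [← ofReal_norm, Complex.norm_real, Real.norm_eq_abs, abs_of_nonneg (ballCutoff_nonneg _ _ _),
      ENNReal.ofReal_le_one]
    exact ballCutoff_le_one _ _ _
  have hF0 : ∀ z, z ∉ ball x₀ (2 * r) → F z = 0 := fun z hz => by
    simp [hF, ballCutoff_eq_zero hr hz]
  -- On a ball comparable to or larger than `B` the constant `0` will do. This covers the case where
  -- the ball is the whole space.
  by_cases hlarge : ball x₀ r ⊆ ball y (8 * s)
  · refine ⟨0, fun _ => rfl, fun x hx => ?_⟩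
    simp only [sub_zero]
    have h1 : ∫⁻ z in ball y s, ‖F z‖ₑ ∂μ ≤ (2 + D) * D * M * μ (ball x₀ r) := by
      calc ∫⁻ z in ball y s, ‖F z‖ₑ ∂μ ≤ ∫⁻ z, ‖F z‖ₑ ∂μ := setLIntegral_le_lintegral _ _
        _ = ∫⁻ z in ball x₀ (2 * r), ‖F z‖ₑ ∂μ := by
            rw [setLIntegral_eq_of_support_subset]
            intro z hz
            by_contra hcon
            exact hz (by simp [hF0 z hcon])
        _ ≤ ∫⁻ z in ball x₀ (2 * r), (‖b z - a x₀ (2 * r)‖ₑ + ‖a x₀ r - a x₀ (2 * r)‖ₑ) ∂μ := by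
            refine lintegral_mono fun z => (hFle z).trans ?_
            have : b z - a x₀ r = (b z - a x₀ (2 * r)) - (a x₀ r - a x₀ (2 * r)) := by ring
            rw [this]
            exact _root_.enorm_sub_le
        _ = ∫⁻ z in ball x₀ (2 * r), ‖b z - a x₀ (2 * r)‖ₑ ∂μ +
            ‖a x₀ r - a x₀ (2 * r)‖ₑ * μ (ball x₀ (2 * r)) := by
            rw [lintegral_add_right _ measurable_const]; simp
        _ ≤ M * (D * μ (ball x₀ r)) + (1 + D ^ 1) * M * (D * μ (ball x₀ r)) := by
            have h2 := hμ.two x₀ r hr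
            gcongr
            · exact (h _ _ (by positivity)).trans (by gcongr)
            · exact h.enorm_sub_le hμ hb hr (by positivity) 1 (ball_subset_ball (by linarith))
                (ball_subset_ball (by simp))
        _ = _ := by ring
    have h2 : μ (ball x₀ r) ≤ maxFn μ ((ball x₀ r).indicator 1) x * (D ^ 3 * μ (ball y s)) := by
      calc μ (ball x₀ r) = ∫⁻ z in ball y (8 * s), (ball x₀ r).indicator 1 z ∂μ := by
            rw [lintegral_indicator_one measurableSet_ball,
              Measure.restrict_apply measurableSet_ball, inter_eq_left.2 hlarge]
        _ ≤ maxFn μ ((ball x₀ r).indicator 1) x * μ (ball y (8 * s)) :=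
            hμ.lintegral_le_maxFn _ (ball_subset_ball (by linarith) hx)
        _ ≤ _ := by
            gcongr
            exact hμ.measure_le y hs 3 (ball_subset_ball (by linarith))
    calc ∫⁻ z in ball y s, ‖F z‖ₑ ∂μ ≤ (2 + D) * D * M * μ (ball x₀ r) := h1
      _ ≤ (2 + D) * D * M *
          (maxFn μ ((ball x₀ r).indicator 1) x * (D ^ 3 * μ (ball y s))) := by gcongr
      _ = (2 + D) * D ^ 4 * M * maxFn μ ((ball x₀ r).indicator 1) x * μ (ball y s) := by ring
      _ ≤ _ := by gcongr; exact le_self_add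
  have hns : ball y s ≠ univ := fun hu => hlarge fun z _ =>
    ball_subset_ball (by linarith : s ≤ 8 * s) (hu ▸ mem_univ z)
  rcases (ball y s ∩ ball x₀ (2 * r)).eq_empty_or_nonempty with hemp | ⟨w, hwy, hwx⟩
  · refine ⟨0, fun _ => rfl, fun x _ => ?_⟩
    have : ∫⁻ z in ball y s, ‖F z - 0‖ₑ ∂μ = 0 := by
      rw [setLIntegral_congr_fun (g := fun _ => 0) measurableSet_ball, lintegral_zero]
      intro z hz
      have : z ∉ ball x₀ (2 * r) := fun hz' => notMem_empty z (hemp ▸ mem_inter hz hz')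
      simp [hF0 z this]
    rw [this]
    exact zero_le
  rw [mem_ball] at hwy hwx
  have hyx : dist y x₀ < s + 2 * r := by
    have := dist_triangle y w x₀
    rw [dist_comm y w] at this
    linarith
  have hsr : s < r := by
    by_contra! hcon
    refine hlarge (ball_subset_ball' ?_)
    rw [dist_comm]; linarith
  refine ⟨(a y s - a x₀ r) * ballCutoff x₀ r y, fun hu => (hns hu).elim, fun x hx => ?_⟩
  rw [mem_ball] at hx
  -- the difference of the means may be large when `s` is small, but the cutoff varies by at most
  -- `s / r` on the ball, and the product of the two is bounded
  have hmean : ‖a y s - a x₀ r‖ₑ * ENNReal.ofReal (s / r) ≤ (9 + 8 * D + D ^ 3) * M := by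
    have h1 := h.enorm_sub_mul_ratio_le hμ hb y hs (by linarith : s ≤ 4 * r)
    have h2 : ENNReal.ofReal (s / r) = 4 * ENNReal.ofReal (s / (4 * r)) := by
      rw [← ENNReal.ofReal_ofNat 4, ← ENNReal.ofReal_mul (by norm_num)]
      congr 1
      field_simp
    have h3 : ‖a x₀ r - a y (4 * r)‖ₑ ≤ (1 + D ^ 3) * M := by
      refine h.enorm_sub_le hμ hb hr (by positivity) 3 (ball_subset_ball' ?_) (ball_subset_ball' ?_)
      · rw [dist_comm]; linarith
      · linarith
    calc ‖a y s - a x₀ r‖ₑ * ENNReal.ofReal (s / r)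
        = ‖(a y s - a y (4 * r)) - (a x₀ r - a y (4 * r))‖ₑ * ENNReal.ofReal (s / r) := by
          rw [sub_sub_sub_cancel_right]
      _ ≤ (‖a y s - a y (4 * r)‖ₑ + ‖a x₀ r - a y (4 * r)‖ₑ) * ENNReal.ofReal (s / r) := by
          gcongr
          exact _root_.enorm_sub_le
      _ = 4 * (‖a y s - a y (4 * r)‖ₑ * ENNReal.ofReal (s / (4 * r))) +
          ‖a x₀ r - a y (4 * r)‖ₑ * ENNReal.ofReal (s / r) := by rw [add_mul, h2]; ring
      _ ≤ 4 * (2 * (1 + D) * M) + (1 + D ^ 3) * M * 1 := by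
          gcongr
          rw [ENNReal.ofReal_le_one]
          exact (div_le_one hr).2 hsr.le
      _ = _ := by ring
  -- `x` is so close to `B` that the maximal function of the indicator is bounded below
  have hone : 1 ≤ D ^ 2 * maxFn μ ((ball x₀ r).indicator 1) x := by
    have h1 : 1 * μ (ball x₀ r) ≤
        D ^ 2 * maxFn μ ((ball x₀ r).indicator 1) x * μ (ball x₀ r) := by
      calc 1 * μ (ball x₀ r) = ∫⁻ z in ball x₀ (4 * r), (ball x₀ r).indicator 1 z ∂μ := by
            rw [lintegral_indicator_one measurableSet_ball, one_mul,
              Measure.restrict_apply measurableSet_ball,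
              inter_eq_left.2 (ball_subset_ball (by linarith))]
        _ ≤ maxFn μ ((ball x₀ r).indicator 1) x * μ (ball x₀ (4 * r)) := by
            refine hμ.lintegral_le_maxFn _ (mem_ball.2 ?_)
            have := dist_triangle x y x₀
            linarith
        _ ≤ maxFn μ ((ball x₀ r).indicator 1) x * (D ^ 2 * μ (ball x₀ r)) := by
            gcongr
            exact hμ.measure_le x₀ hr 2 (ball_subset_ball (by linarith))
        _ = _ := by ring
    exact (ENNReal.mul_le_mul_iff_left (hμ.pos _ _ hr).ne' (hμ.ne_top _ _)).1 h1
  calc ∫⁻ z in ball y s, ‖F z - (a y s - a x₀ r) * ballCutoff x₀ r y‖ₑ ∂μ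
      ≤ ∫⁻ z in ball y s, (‖b z - a y s‖ₑ + ‖a y s - a x₀ r‖ₑ * ENNReal.ofReal (s / r)) ∂μ := by
        refine setLIntegral_mono' measurableSet_ball fun z hz => ?_
        have : F z - (a y s - a x₀ r) * ballCutoff x₀ r y = (b z - a y s) * ballCutoff x₀ r z +
            (a y s - a x₀ r) * ((ballCutoff x₀ r z - ballCutoff x₀ r y : ℝ) : ℂ) := by
          simp only [hF]; push_cast; ring
        rw [this]
        refine (enorm_add_le _ _).trans ?_
        rw [enorm_mul, enorm_mul]
        gcongr
        · refine mul_le_of_le_one_right zero_le ?_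
          rw [← ofReal_norm, Complex.norm_real, Real.norm_eq_abs,
            abs_of_nonneg (ballCutoff_nonneg _ _ _), ENNReal.ofReal_le_one]
          exact ballCutoff_le_one _ _ _
        · rw [← ofReal_norm, Complex.norm_real, Real.norm_eq_abs]
          refine ENNReal.ofReal_le_ofReal ((abs_ballCutoff_sub_le hr z y).trans ?_)
          gcongr
          exact (mem_ball.1 hz).le
    _ = ∫⁻ z in ball y s, ‖b z - a y s‖ₑ ∂μ +
        ‖a y s - a x₀ r‖ₑ * ENNReal.ofReal (s / r) * μ (ball y s) := by
        rw [lintegral_add_right _ measurable_const]; simp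
    _ ≤ M * μ (ball y s) + (9 + 8 * D + D ^ 3) * M * μ (ball y s) := by
        gcongr
        exact h y s hs
    _ = (10 + 8 * D + D ^ 3) * M * 1 * μ (ball y s) := by ring
    _ ≤ (10 + 8 * D + D ^ 3) * M * (D ^ 2 * maxFn μ ((ball x₀ r).indicator 1) x) *
        μ (ball y s) := by gcongr
    _ = (10 + 8 * D + D ^ 3) * D ^ 2 * M * maxFn μ ((ball x₀ r).indicator 1) x *
        μ (ball y s) := by ring
    _ ≤ _ := by
        simp only
        gcongr
        exact le_add_self

end BMOWith

/-- The John–Nirenberg inequality in `L^q` form, for bounded functions, with a constant that does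
not depend on the bound: the Fefferman–Stein inequality for `(b - a x₀ r) η`, where `η` is a cutoff
of the ball. -/
theorem IsDoubling.john_nirenberg (hμ : IsDoubling μ D) {q : ℝ} (hq : 1 < q) :
    ∃ C : ℝ≥0∞, C ≠ ∞ ∧ ∀ (b : X → ℂ) (a : X → ℝ → ℂ) (M : ℝ≥0∞), AEStronglyMeasurable b μ →
      (∃ N : ℝ≥0, ∀ x, ‖b x‖ₑ ≤ N) → BMOWith μ b a M → ∀ x₀ r, 0 < r →
      ∫⁻ z in ball x₀ r, ‖b z - a x₀ r‖ₑ ^ q ∂μ ≤ C * M ^ q * μ (ball x₀ r) := by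
  have hq0 : 0 < q := by linarith
  obtain ⟨C₁, hC₁, hFS⟩ := hμ.fefferman_stein hq
  obtain ⟨C₂, hC₂, hM⟩ := hμ.strong_type hq
  set A : ℝ≥0 := (2 + D) * D ^ 4 + (10 + 8 * D + D ^ 3) * D ^ 2 with hA
  refine ⟨C₁ * (A ^ q * C₂), ENNReal.mul_ne_top hC₁ (ENNReal.mul_ne_top
    (ENNReal.rpow_ne_top_of_nonneg hq0.le ENNReal.coe_ne_top) hC₂), ?_⟩
  rintro b a M hb ⟨N, hN⟩ h x₀ r hr
  set F : X → ℂ := fun z => (b z - a x₀ r) * ballCutoff x₀ r z with hF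
  have hη : ∀ z, ‖(ballCutoff x₀ r z : ℂ)‖ₑ ≤ (ball x₀ (2 * r)).indicator 1 z := fun z => by
    by_cases hz : z ∈ ball x₀ (2 * r)
    · rw [indicator_of_mem hz, ← ofReal_norm, Complex.norm_real, Real.norm_eq_abs,
        abs_of_nonneg (ballCutoff_nonneg _ _ _), Pi.one_apply, ENNReal.ofReal_le_one]
      exact ballCutoff_le_one _ _ _
    · simp [ballCutoff_eq_zero hr hz]
  have hFm : AEStronglyMeasurable F μ := (hb.sub aestronglyMeasurable_const).mul
    (Complex.measurable_ofReal.comp (measurable_ballCutoff x₀ r)).aestronglyMeasurable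
  have hfin : ∫⁻ x, ‖F x‖ₑ ^ q ∂μ ≠ ∞ := by
    have hle : ∫⁻ x, ‖F x‖ₑ ^ q ∂μ ≤ (N + ‖a x₀ r‖ₑ) ^ q * μ (ball x₀ (2 * r)) := by
      calc ∫⁻ x, ‖F x‖ₑ ^ q ∂μ
          ≤ ∫⁻ x, (ball x₀ (2 * r)).indicator (fun _ => (N + ‖a x₀ r‖ₑ) ^ q) x ∂μ := by
            refine lintegral_mono fun x => ?_
            have h1 : ‖F x‖ₑ ≤ (N + ‖a x₀ r‖ₑ) * (ball x₀ (2 * r)).indicator 1 x := by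
              rw [hF, enorm_mul]
              exact mul_le_mul' (_root_.enorm_sub_le.trans (add_le_add (hN x) le_rfl)) (hη x)
            refine (ENNReal.rpow_le_rpow h1 hq0.le).trans ?_
            by_cases hx : x ∈ ball x₀ (2 * r)
            · simp [hx]
            · simp [hx, hq0]
        _ = _ := by rw [lintegral_indicator measurableSet_ball]; simp
    refine ne_top_of_le_ne_top ?_ hle
    exact ENNReal.mul_ne_top (ENNReal.rpow_ne_top_of_nonneg hq0.le
      (ENNReal.add_ne_top.2 ⟨ENNReal.coe_ne_top, enorm_ne_top⟩)) (hμ.ne_top _ _)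
  have hmain := hFS F _ q hFm ((measurable_maxFn _).const_mul _).aemeasurable
    (h.oscDominated_cutoff hμ hb x₀ hr) hq le_rfl hfin
  calc ∫⁻ z in ball x₀ r, ‖b z - a x₀ r‖ₑ ^ q ∂μ = ∫⁻ z in ball x₀ r, ‖F z‖ₑ ^ q ∂μ := by
        refine setLIntegral_congr_fun measurableSet_ball fun z hz => ?_
        simp [hF, ballCutoff_eq_one hz]
    _ ≤ ∫⁻ z, ‖F z‖ₑ ^ q ∂μ := setLIntegral_le_lintegral _ _
    _ ≤ _ := hmain
    _ = C₁ * ∫⁻ x, (A ^ q * M ^ q) * maxFn μ ((ball x₀ r).indicator 1) x ^ q ∂μ := by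
        congr 1
        refine lintegral_congr fun x => ?_
        rw [ENNReal.mul_rpow_of_nonneg _ _ hq0.le, ENNReal.mul_rpow_of_nonneg _ _ hq0.le]
        congr 3
    _ = C₁ * (A ^ q * M ^ q * ∫⁻ x, maxFn μ ((ball x₀ r).indicator 1) x ^ q ∂μ) := by
        rw [lintegral_const_mul _ ((measurable_maxFn _).pow_const _)]
    _ ≤ C₁ * (A ^ q * M ^ q * (C₂ * μ (ball x₀ r))) := by
        gcongr
        refine (hM _ (measurable_one.indicator measurableSet_ball).aemeasurable).trans ?_
        gcongr
        rw [← lintegral_indicator_one measurableSet_ball]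
        refine lintegral_mono fun z => ?_
        by_cases hz : z ∈ ball x₀ r
        · simp [hz]
        · simp [hz, hq0]
    _ = _ := by ring

/-- The John–Nirenberg inequality on the dilates of a ball, with a fixed constant subtracted. The
constant loses only a factor linear in `n`. -/
theorem IsDoubling.john_nirenberg_dilate (hμ : IsDoubling μ D) {q : ℝ} (hq : 1 < q) :
    ∃ C : ℝ≥0∞, C ≠ ∞ ∧ ∀ (b : X → ℂ) (a : X → ℝ → ℂ) (M : ℝ≥0∞), AEStronglyMeasurable b μ →
      (∃ N : ℝ≥0, ∀ x, ‖b x‖ₑ ≤ N) → BMOWith μ b a M → ∀ x₀ r, 0 < r → ∀ n : ℕ,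
      ∫⁻ z in ball x₀ (2 ^ n * r), ‖b z - a x₀ r‖ₑ ^ q ∂μ ≤
        (C * (n + 1) * M) ^ q * μ (ball x₀ (2 ^ n * r)) := by
  have hq0 : 0 < q := by linarith
  obtain ⟨C, hC, hJN⟩ := hμ.john_nirenberg hq
  refine ⟨(2 ^ (q - 1) * (C + (1 + D) ^ q)) ^ (1 / q), ?_, ?_⟩
  · refine ENNReal.rpow_ne_top_of_nonneg (by positivity) (ENNReal.mul_ne_top
      (ENNReal.rpow_ne_top_of_nonneg (by linarith) ENNReal.ofNat_ne_top)
      (ENNReal.add_ne_top.2 ⟨hC, ENNReal.rpow_ne_top_of_nonneg hq0.le (by finiteness)⟩))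
  intro b a M hb hN h x₀ r hr n
  have hr' : 0 < 2 ^ n * r := by positivity
  set B := ball x₀ (2 ^ n * r)
  calc ∫⁻ z in B, ‖b z - a x₀ r‖ₑ ^ q ∂μ
      ≤ ∫⁻ z in B, 2 ^ (q - 1) *
          (‖b z - a x₀ (2 ^ n * r)‖ₑ ^ q + (n * ((1 + D) * M)) ^ q) ∂μ := by
        refine lintegral_mono fun z => ?_
        refine le_trans ?_ (ENNReal.rpow_add_le_mul_rpow_add_rpow _ _ hq.le)
        refine ENNReal.rpow_le_rpow ?_ hq0.le
        have : b z - a x₀ r = (b z - a x₀ (2 ^ n * r)) - (a x₀ r - a x₀ (2 ^ n * r)) := by ring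
        rw [this]
        exact enorm_sub_le.trans (add_le_add le_rfl (h.enorm_sub_dilate_le hμ hb x₀ hr n))
    _ = 2 ^ (q - 1) * (∫⁻ z in B, ‖b z - a x₀ (2 ^ n * r)‖ₑ ^ q ∂μ +
          (n * ((1 + D) * M)) ^ q * μ B) := by
        rw [lintegral_const_mul', lintegral_add_right _ measurable_const]
        · simp
        · exact ENNReal.rpow_ne_top_of_nonneg (by linarith) ENNReal.ofNat_ne_top
    _ ≤ 2 ^ (q - 1) * (C * ((n + 1) * M) ^ q * μ B + ((n + 1) * ((1 + D) * M)) ^ q * μ B) := by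
        gcongr
        · refine (hJN b a M hb hN h x₀ _ hr').trans ?_
          gcongr
          exact le_mul_of_one_le_left zero_le le_add_self
        · exact le_self_add
    _ = (2 ^ (q - 1) * (C + (1 + D) ^ q)) * ((n + 1) * M) ^ q * μ B := by
        have : ((n : ℝ≥0∞) + 1) * ((1 + D) * M) = (1 + D) * ((n + 1) * M) := by ring
        rw [this, ENNReal.mul_rpow_of_nonneg (1 + D : ℝ≥0∞) _ hq0.le]
        ring
    _ = _ := by
        rw [mul_assoc (_ ^ (1 / q)), ENNReal.mul_rpow_of_nonneg (_ ^ (1 / q)) _ hq0.le,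
          ← ENNReal.rpow_mul, one_div, inv_mul_cancel₀ hq0.ne', ENNReal.rpow_one]

end JohnNirenberg

/-! ### Normalized `L^s` means and Hölder's inequality -/

section AvgNorm

variable {X : Type*} [MeasurableSpace X] {μ : Measure X}

/-- The normalized `L^s` norm `(μ(B)⁻¹ ∫_B u ^ s dμ) ^ (1 / s)`. -/
noncomputable def avgNorm (μ : Measure X) (s : ℝ) (u : X → ℝ≥0∞) (B : Set X) : ℝ≥0∞ :=
  ((∫⁻ z in B, u z ^ s ∂μ) / μ B) ^ (1 / s)

theorem setLIntegral_div_measure (u : X → ℝ≥0∞) (B : Set X) :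
    (∫⁻ z in B, u z ∂μ) / μ B = ∫⁻ z, u z ∂((μ B)⁻¹ • μ.restrict B) := by
  rw [lintegral_smul_measure, smul_eq_mul, ENNReal.div_eq_inv_mul]

/-- Hölder's inequality for normalized norms. -/
theorem avgNorm_mul_le {s t t' : ℝ} (hs : 0 < s) (ht : t'.HolderConjugate t) {u v : X → ℝ≥0∞}
    (hu : AEMeasurable u μ) (hv : AEMeasurable v μ) (B : Set X) :
    avgNorm μ s (fun z => u z * v z) B ≤ avgNorm μ (s * t') u B * avgNorm μ (s * t) v B := by
  simp only [avgNorm, setLIntegral_div_measure]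
  set ν := (μ B)⁻¹ • μ.restrict B
  have hac : ν ≪ μ := (Measure.smul_absolutelyContinuous).trans
    Measure.restrict_le_self.absolutelyContinuous
  have h := ENNReal.lintegral_mul_le_Lp_mul_Lq ν ht ((hu.mono_ac hac).pow_const s)
    ((hv.mono_ac hac).pow_const s)
  calc (∫⁻ z, (u z * v z) ^ s ∂ν) ^ (1 / s)
      = (∫⁻ z, ((fun z => u z ^ s) * fun z => v z ^ s) z ∂ν) ^ (1 / s) := by
        simp only [Pi.mul_apply, ENNReal.mul_rpow_of_nonneg _ _ hs.le]
    _ ≤ ((∫⁻ z, (u z ^ s) ^ t' ∂ν) ^ (1 / t') * (∫⁻ z, (v z ^ s) ^ t ∂ν) ^ (1 / t)) ^ (1 / s) := by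
        gcongr
    _ = _ := by
        rw [ENNReal.mul_rpow_of_nonneg _ _ (by positivity), ← ENNReal.rpow_mul, ← ENNReal.rpow_mul]
        simp only [← ENNReal.rpow_mul, one_div, ← mul_inv, mul_comm t', mul_comm t]

theorem setLIntegral_le_avgNorm {s : ℝ} (hs : 1 < s) {u : X → ℝ≥0∞} (hu : AEMeasurable u μ)
    {B : Set X} (hB : μ B ≠ 0) (hB' : μ B ≠ ∞) :
    ∫⁻ z in B, u z ∂μ ≤ avgNorm μ s u B * μ B := by
  rw [← ENNReal.div_le_iff hB hB', avgNorm, setLIntegral_div_measure, setLIntegral_div_measure]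
  set ν := (μ B)⁻¹ • μ.restrict B with hν
  have hac : ν ≪ μ := (Measure.smul_absolutelyContinuous).trans
    Measure.restrict_le_self.absolutelyContinuous
  have h := ENNReal.lintegral_mul_le_Lp_mul_Lq ν (Real.HolderConjugate.conjExponent hs)
    (hu.mono_ac hac) (g := fun _ => 1) aemeasurable_const
  have hν1 : ν univ = 1 := by
    rw [hν, Measure.smul_apply, Measure.restrict_apply_univ, smul_eq_mul,
      ENNReal.inv_mul_cancel hB hB']
  simpa [hν1] using h

end AvgNorm

section Operators

variable {X : Type*} [MetricSpace X] [MeasurableSpace X] [BorelSpace X] {μ : Measure X} {D : ℝ≥0}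

theorem avgNorm_le_maxFn {q : ℝ} (hq : 0 < q) (u : X → ℝ≥0∞)
    {x y : X} {r : ℝ} (h : x ∈ ball y r) :
    avgNorm μ q u (ball y r) ≤ maxFn μ (fun z => u z ^ q) x ^ (1 / q) :=
  ENNReal.rpow_le_rpow (laverage_le_maxFn _ h) (by positivity)

/-! ### Operators on `L²` acting on bounded functions with bounded support -/

/-- Bounded measurable functions vanishing off some ball. -/
structure BddSupp (μ : Measure X) (f : X → ℂ) : Prop where
  aesm : AEStronglyMeasurable f μ
  bdd : ∃ N : ℝ≥0, ∀ x, ‖f x‖ₑ ≤ N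
  supp : ∃ x₀ R, ∀ x, x ∉ ball x₀ R → f x = 0

namespace BddSupp

variable {f g : X → ℂ}

theorem lintegral_ne_top (hf : BddSupp μ f) (hμ : IsDoubling μ D) {s : ℝ} (hs : 0 < s) :
    ∫⁻ x, ‖f x‖ₑ ^ s ∂μ ≠ ∞ := by
  obtain ⟨N, hN⟩ := hf.bdd
  obtain ⟨x₀, R, hR⟩ := hf.supp
  have hle : ∫⁻ x, ‖f x‖ₑ ^ s ∂μ ≤ (N : ℝ≥0∞) ^ s * μ (ball x₀ R) := by
    calc ∫⁻ x, ‖f x‖ₑ ^ s ∂μ ≤ ∫⁻ x, (ball x₀ R).indicator (fun _ => (N : ℝ≥0∞) ^ s) x ∂μ := by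
          refine lintegral_mono fun x => ?_
          by_cases hx : x ∈ ball x₀ R
          · rw [indicator_of_mem hx]
            exact ENNReal.rpow_le_rpow (hN x) hs.le
          · simp [hR x hx, hs]
      _ = _ := by rw [lintegral_indicator measurableSet_ball]; simp
  exact ne_top_of_le_ne_top (ENNReal.mul_ne_top
    (ENNReal.rpow_ne_top_of_nonneg hs.le ENNReal.coe_ne_top) (hμ.ne_top _ _)) hle

theorem memLp (hf : BddSupp μ f) (hμ : IsDoubling μ D) : MemLp f 2 μ := by
  refine ⟨hf.aesm, ?_⟩
  rw [eLpNorm_lt_top_iff_lintegral_rpow_enorm_lt_top two_ne_zero ENNReal.ofNat_ne_top]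
  exact (hf.lintegral_ne_top hμ (by norm_num)).lt_top

theorem integrable (hf : BddSupp μ f) (hμ : IsDoubling μ D) : Integrable f μ := by
  refine ⟨hf.aesm, ?_⟩
  have := hf.lintegral_ne_top hμ one_pos
  simp only [ENNReal.rpow_one] at this
  exact this.lt_top

theorem bdd_mul (hf : BddSupp μ f) {b : X → ℂ} (hb : AEStronglyMeasurable b μ)
    (hN : ∃ N : ℝ≥0, ∀ x, ‖b x‖ₑ ≤ N) : BddSupp μ (fun x => b x * f x) := by
  obtain ⟨N, hN⟩ := hN
  obtain ⟨N', hN'⟩ := hf.bdd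
  obtain ⟨x₀, R, hR⟩ := hf.supp
  refine ⟨hb.mul hf.aesm, ⟨N * N', fun x => ?_⟩, x₀, R, fun x hx => by simp [hR x hx]⟩
  rw [enorm_mul, ENNReal.coe_mul]
  exact mul_le_mul' (hN x) (hN' x)

theorem indicator (hf : BddSupp μ f) {s : Set X} (hs : MeasurableSet s) :
    BddSupp μ (s.indicator f) := by
  obtain ⟨N, hN⟩ := hf.bdd
  obtain ⟨x₀, R, hR⟩ := hf.supp
  refine ⟨hf.aesm.indicator hs, ⟨N, fun x => (enorm_indicator_le_enorm_self f x).trans (hN x)⟩,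
    x₀, R, fun x hx => ?_⟩
  exact indicator_apply_eq_zero.2 fun _ => hR x hx

end BddSupp

/-- A bounded operator on `L²` as a map on functions; the value is `0` off `L²`. This spares the
membership proofs in statements about `T (b * f)` and the like. -/
noncomputable def opFn (T : Lp ℂ 2 μ →L[ℂ] Lp ℂ 2 μ) (f : X → ℂ) : X → ℂ :=
  open scoped Classical in if h : MemLp f 2 μ then T (h.toLp f) else 0

theorem opFn_eq (T : Lp ℂ 2 μ →L[ℂ] Lp ℂ 2 μ) {f : X → ℂ} (h : MemLp f 2 μ) :
    opFn T f = T (h.toLp f) := dif_pos h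

theorem stronglyMeasurable_opFn (T : Lp ℂ 2 μ →L[ℂ] Lp ℂ 2 μ) (f : X → ℂ) :
    StronglyMeasurable (opFn T f) := by
  by_cases h : MemLp f 2 μ
  · rw [opFn_eq T h]; exact Lp.stronglyMeasurable _
  · rw [opFn, dif_neg h]; exact stronglyMeasurable_zero

theorem memLp_opFn (T : Lp ℂ 2 μ →L[ℂ] Lp ℂ 2 μ) (f : X → ℂ) : MemLp (opFn T f) 2 μ := by
  by_cases h : MemLp f 2 μ
  · rw [opFn_eq T h]; exact Lp.memLp _
  · rw [opFn, dif_neg h]; exact MemLp.zero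

theorem opFn_sub (T : Lp ℂ 2 μ →L[ℂ] Lp ℂ 2 μ) {f g : X → ℂ} (hf : MemLp f 2 μ)
    (hg : MemLp g 2 μ) : opFn T (f - g) =ᵐ[μ] opFn T f - opFn T g := by
  rw [opFn_eq T hf, opFn_eq T hg, opFn_eq T (hf.sub hg), MemLp.toLp_sub hf hg, map_sub]
  exact Lp.coeFn_sub _ _

theorem opFn_const_mul (T : Lp ℂ 2 μ →L[ℂ] Lp ℂ 2 μ) {f : X → ℂ} (hf : MemLp f 2 μ) (c : ℂ) :
    opFn T (fun x => c * f x) =ᵐ[μ] fun x => c * opFn T f x := by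
  have h : opFn T (c • f) = T (c • hf.toLp f) := by
    rw [opFn_eq T (hf.const_smul c), MemLp.toLp_const_smul]
  have h2 : (fun x => c * f x) = c • f := by ext; simp
  rw [h2, h, map_smul, opFn_eq T hf]
  filter_upwards [Lp.coeFn_smul c (T (hf.toLp f))] with x hx
  rw [hx]; simp

theorem lintegral_opFn_sq_le (T : Lp ℂ 2 μ →L[ℂ] Lp ℂ 2 μ) {f : X → ℂ} (hf : MemLp f 2 μ) :
    ∫⁻ x, ‖opFn T f x‖ₑ ^ (2 : ℝ) ∂μ ≤ ‖T‖ₑ ^ (2 : ℝ) * ∫⁻ x, ‖f x‖ₑ ^ (2 : ℝ) ∂μ := by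
  have h := T.le_opENorm (hf.toLp f)
  rw [Lp.enorm_def, ← opFn_eq T hf, Lp.enorm_toLp, eLpNorm_eq_lintegral_rpow_enorm_toReal
    two_ne_zero ENNReal.ofNat_ne_top, eLpNorm_eq_lintegral_rpow_enorm_toReal
    two_ne_zero ENNReal.ofNat_ne_top] at h
  have h2 := ENNReal.rpow_le_rpow h (zero_le_two (α := ℝ))
  rw [ENNReal.mul_rpow_of_nonneg _ _ zero_le_two] at h2
  simpa only [← ENNReal.rpow_mul, ENNReal.toReal_ofNat, one_div,
    inv_mul_cancel₀ (two_ne_zero (α := ℝ)), ENNReal.rpow_one] using h2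

/-- `T` is bounded on `L^p`, tested on bounded functions with bounded support. -/
def BoundedOn (μ : Measure X) (T : Lp ℂ 2 μ →L[ℂ] Lp ℂ 2 μ) (p : ℝ) : Prop :=
  ∃ C : ℝ≥0∞, C ≠ ∞ ∧ ∀ f, BddSupp μ f →
    ∫⁻ x, ‖opFn T f x‖ₑ ^ p ∂μ ≤ C * ∫⁻ x, ‖f x‖ₑ ^ p ∂μ

/-- Off-diagonal smoothness of `T`: if `h` vanishes near the ball `ball x₀ r`, then on this ball
`T h` differs from a constant by at most a geometrically weighted sum of the means of `|h|` over
the dilates of the ball. This is how the regularity of a standard kernel is used. -/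
def OffDiag (μ : Measure X) (T : Lp ℂ 2 μ →L[ℂ] Lp ℂ 2 μ) (n₀ : ℕ) (θ C : ℝ≥0∞) : Prop :=
  ∀ h, BddSupp μ h → ∀ x₀ r, 0 < r → (∀ x ∈ ball x₀ (2 ^ n₀ * r), h x = 0) →
    ∃ a : ℂ, ∀ᵐ x ∂μ.restrict (ball x₀ r), ‖opFn T h x - a‖ₑ ≤
      C * ∑' j : ℕ, θ ^ j * ((∫⁻ z in ball x₀ (2 ^ j * r), ‖h z‖ₑ ∂μ) / μ (ball x₀ (2 ^ j * r)))

/-- The mean oscillation of `T g` over a ball is controlled by the `L^s` means of `g` over its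
dilates: the part of `g` near the ball is treated by the `L^s` bound, the rest by `OffDiag`. If the
ball is the whole space there is no far part, and the constant is `0`. -/
theorem IsDoubling.setLIntegral_opFn_sub_le (hμ : IsDoubling μ D)
    {T : Lp ℂ 2 μ →L[ℂ] Lp ℂ 2 μ} {n₀ : ℕ} {θ C : ℝ≥0∞} (hθ0 : θ ≠ 0) (hθ : θ ≤ 1) (hC : C ≠ ∞)
    (hT : OffDiag μ T n₀ θ C) {s : ℝ} (hs : 1 < s) (hTs : BoundedOn μ T s) :
    ∃ A : ℝ≥0∞, A ≠ ∞ ∧ ∀ g, BddSupp μ g → ∀ y r, 0 < r → ∃ a : ℂ, (ball y r = univ → a = 0) ∧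
      ∫⁻ z in ball y r, ‖opFn T g z - a‖ₑ ∂μ ≤
        A * (∑' j : ℕ, θ ^ j * avgNorm μ s (fun z => ‖g z‖ₑ) (ball y (2 ^ j * r))) *
          μ (ball y r) := by
  obtain ⟨Cs, hCs, hTs⟩ := hTs
  have hs0 : 0 < s := by linarith
  have hθ0' : θ ^ n₀ ≠ 0 := pow_ne_zero _ hθ0
  have hθt : θ ^ n₀ ≠ ∞ := ENNReal.pow_ne_top (ne_top_of_le_ne_top ENNReal.one_ne_top hθ)
  refine ⟨(Cs * D ^ n₀) ^ (1 / s) * (θ ^ n₀)⁻¹ + C, ?_, ?_⟩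
  · refine ENNReal.add_ne_top.2 ⟨ENNReal.mul_ne_top ?_ (ENNReal.inv_ne_top.2 hθ0'), hC⟩
    exact ENNReal.rpow_ne_top_of_nonneg (by positivity)
      (ENNReal.mul_ne_top hCs (ENNReal.pow_ne_top ENNReal.coe_ne_top))
  intro g hg y r hr
  set S := ∑' j : ℕ, θ ^ j * avgNorm μ s (fun z => ‖g z‖ₑ) (ball y (2 ^ j * r)) with hS
  set B := ball y r with hB
  set B' := ball y (2 ^ n₀ * r) with hB'
  have hBB' : B ⊆ B' := ball_subset_ball (le_mul_of_one_le_left hr.le (one_le_pow₀ one_le_two))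
  have hB0 : μ B ≠ 0 := (hμ.pos y r hr).ne'
  have hBt : μ B ≠ ∞ := hμ.ne_top y r
  set g₁ := B'.indicator g with hg₁
  set g₂ := B'ᶜ.indicator g with hg₂
  have hg₁s : BddSupp μ g₁ := hg.indicator measurableSet_ball
  have hg₂s : BddSupp μ g₂ := hg.indicator measurableSet_ball.compl
  have hsplit : opFn T g₁ =ᵐ[μ] opFn T g - opFn T g₂ := by
    have : g₁ = g - g₂ := by
      rw [hg₁, hg₂, ← indicator_self_add_compl B' g, add_sub_assoc]
      simp
    rw [this]
    exact opFn_sub T (hg.memLp hμ) (hg₂s.memLp hμ)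
  have hnear : ∫⁻ z in B, ‖opFn T g₁ z‖ₑ ∂μ ≤ (Cs * D ^ n₀) ^ (1 / s) * (θ ^ n₀)⁻¹ * S * μ B := by
    have h1 : avgNorm μ s (fun z => ‖opFn T g₁ z‖ₑ) B ≤
        (Cs * D ^ n₀) ^ (1 / s) * avgNorm μ s (fun z => ‖g z‖ₑ) B' := by
      unfold avgNorm
      rw [← ENNReal.mul_rpow_of_nonneg _ _ (by positivity)]
      refine ENNReal.rpow_le_rpow ?_ (by positivity)
      refine ENNReal.div_le_of_le_mul ?_
      calc ∫⁻ z in B, ‖opFn T g₁ z‖ₑ ^ s ∂μ ≤ ∫⁻ z, ‖opFn T g₁ z‖ₑ ^ s ∂μ :=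
            setLIntegral_le_lintegral _ _
        _ ≤ Cs * ∫⁻ z, ‖g₁ z‖ₑ ^ s ∂μ := hTs g₁ hg₁s
        _ = Cs * ∫⁻ z in B', ‖g z‖ₑ ^ s ∂μ := by
            rw [← lintegral_indicator (s := B') measurableSet_ball]
            congr 1
            refine lintegral_congr fun z => ?_
            by_cases hz : z ∈ B'
            · simp [hg₁, hz]
            · simp [hg₁, hz, hs0]
        _ = Cs * ((∫⁻ z in B', ‖g z‖ₑ ^ s ∂μ) / μ B' * μ B') := by
            rw [ENNReal.div_mul_cancel (hμ.pos y _ (by positivity)).ne' (hμ.ne_top y _)]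
        _ ≤ Cs * ((∫⁻ z in B', ‖g z‖ₑ ^ s ∂μ) / μ B' * (D ^ n₀ * μ B)) := by
            gcongr
            exact hμ.pow y hr n₀
        _ = _ := by ring
    have h2 : avgNorm μ s (fun z => ‖g z‖ₑ) B' ≤ (θ ^ n₀)⁻¹ * S := by
      calc avgNorm μ s (fun z => ‖g z‖ₑ) B'
          = (θ ^ n₀)⁻¹ * (θ ^ n₀ * avgNorm μ s (fun z => ‖g z‖ₑ) B') := by
            rw [← mul_assoc, ENNReal.inv_mul_cancel hθ0' hθt, one_mul]
        _ ≤ (θ ^ n₀)⁻¹ * S := by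
            gcongr
            exact ENNReal.le_tsum (f := fun j : ℕ =>
              θ ^ j * avgNorm μ s (fun z => ‖g z‖ₑ) (ball y (2 ^ j * r))) n₀
    calc ∫⁻ z in B, ‖opFn T g₁ z‖ₑ ∂μ ≤ avgNorm μ s (fun z => ‖opFn T g₁ z‖ₑ) B * μ B :=
          setLIntegral_le_avgNorm hs (stronglyMeasurable_opFn T _).enorm.aemeasurable hB0 hBt
      _ ≤ (Cs * D ^ n₀) ^ (1 / s) * ((θ ^ n₀)⁻¹ * S) * μ B := by
          gcongr
          exact h1.trans (by gcongr)
      _ = _ := by ring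
  have hg₂0 : ∀ x ∈ B', g₂ x = 0 := fun x hx => by simp [hg₂, hx]
  obtain ⟨a, hau, ha⟩ : ∃ a : ℂ, (B = univ → a = 0) ∧
      ∀ᵐ x ∂μ.restrict B, ‖opFn T g₂ x - a‖ₑ ≤ C * S := by
    by_cases hu : B = univ
    · refine ⟨0, fun _ => rfl, ?_⟩
      have h0 : g₂ = fun x => 0 * g x := by
        ext x
        rw [hg₂0 x (hBB' (hu ▸ mem_univ x)), zero_mul]
      have h1 := opFn_const_mul T (hg.memLp hμ) 0
      rw [← h0] at h1
      filter_upwards [ae_restrict_of_ae h1] with x hx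
      simp [hx]
    · obtain ⟨a, ha⟩ := hT g₂ hg₂s y r hr hg₂0
      refine ⟨a, fun h => (hu h).elim, ?_⟩
      filter_upwards [ha] with x hx
      refine hx.trans ?_
      refine mul_le_mul' le_rfl (ENNReal.tsum_le_tsum fun j => mul_le_mul' le_rfl ?_)
      rw [ENNReal.div_le_iff (hμ.pos y _ (by positivity)).ne' (hμ.ne_top y _)]
      refine le_trans ?_ (setLIntegral_le_avgNorm hs hg.aesm.enorm
        (hμ.pos y _ (by positivity)).ne' (hμ.ne_top y _))
      refine lintegral_mono fun z => ?_
      exact enorm_indicator_le_enorm_self g z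
  refine ⟨a, hau, ?_⟩
  calc ∫⁻ z in B, ‖opFn T g z - a‖ₑ ∂μ
      ≤ ∫⁻ z in B, (‖opFn T g₁ z‖ₑ + C * S) ∂μ := by
        refine lintegral_mono_ae ?_
        filter_upwards [ha, ae_restrict_of_ae hsplit] with z hz hz'
        have : opFn T g z - a = opFn T g₁ z + (opFn T g₂ z - a) := by
          rw [hz', Pi.sub_apply]; ring
        rw [this]
        exact (enorm_add_le _ _).trans (by gcongr)
    _ = ∫⁻ z in B, ‖opFn T g₁ z‖ₑ ∂μ + C * S * μ B := by
        rw [lintegral_add_right _ measurable_const]; simp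
    _ ≤ (Cs * D ^ n₀) ^ (1 / s) * (θ ^ n₀)⁻¹ * S * μ B + C * S * μ B := by gcongr
    _ = _ := by ring

/-! ### `L^p` bounds -/

theorem boundedOn_two (hμ : IsDoubling μ D) (T : Lp ℂ 2 μ →L[ℂ] Lp ℂ 2 μ) : BoundedOn μ T 2 :=
  ⟨‖T‖ₑ ^ (2 : ℝ), ENNReal.rpow_ne_top_of_nonneg zero_le_two enorm_ne_top,
    fun _ hf => lintegral_opFn_sq_le T (hf.memLp hμ)⟩

/-- The maximal theorem for the `L^q` maximal function `(M |u| ^ q) ^ (1 / q)`, `q < p`. -/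
theorem IsDoubling.lintegral_maxFn_rpow_le (hμ : IsDoubling μ D) {q p : ℝ} (hq : 0 < q)
    (hqp : q < p) : ∃ C : ℝ≥0∞, C ≠ ∞ ∧ ∀ u : X → ℝ≥0∞, AEMeasurable u μ →
      ∫⁻ x, (maxFn μ (fun z => u z ^ q) x ^ (1 / q)) ^ p ∂μ ≤ C * ∫⁻ x, u x ^ p ∂μ := by
  obtain ⟨C, hC, h⟩ := hμ.strong_type (p := p / q) ((one_lt_div hq).2 hqp)
  refine ⟨C, hC, fun u hu => ?_⟩
  have := h (fun z => u z ^ q) (hu.pow_const q)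
  simp only [← ENNReal.rpow_mul, mul_div_cancel₀ p hq.ne'] at this ⊢
  rwa [one_div, inv_mul_eq_div]

/-- The mean oscillations of `T f` are dominated by the `L²` maximal function of `f`, and `T f` is
a priori in `L²`, so the Fefferman–Stein inequality applies. -/
theorem IsDoubling.boundedOn_of_two_lt (hμ : IsDoubling μ D) {T : Lp ℂ 2 μ →L[ℂ] Lp ℂ 2 μ}
    {n₀ : ℕ} {θ C : ℝ≥0∞} (hθ0 : θ ≠ 0) (hθ : θ < 1) (hC : C ≠ ∞) (hT : OffDiag μ T n₀ θ C) {p : ℝ}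
    (hp : 2 < p) : BoundedOn μ T p := by
  have hp0 : 0 < p := by linarith
  obtain ⟨A, hA, hosc⟩ := hμ.setLIntegral_opFn_sub_le hθ0 hθ.le hC hT one_lt_two
    (boundedOn_two hμ T)
  obtain ⟨C₁, hC₁, hFS⟩ := hμ.fefferman_stein (by linarith : 1 < p)
  obtain ⟨C₂, hC₂, hM⟩ := hμ.lintegral_maxFn_rpow_le two_pos hp
  have hgeom : (∑' j : ℕ, θ ^ j) ≠ ∞ := by
    rw [ENNReal.tsum_geometric, ENNReal.inv_ne_top]
    exact (tsub_pos_of_lt hθ).ne'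
  have hAg : (A * ∑' j : ℕ, θ ^ j) ^ p ≠ ∞ :=
    ENNReal.rpow_ne_top_of_nonneg hp0.le (ENNReal.mul_ne_top hA hgeom)
  refine ⟨C₁ * ((A * ∑' j : ℕ, θ ^ j) ^ p * C₂),
    ENNReal.mul_ne_top hC₁ (ENNReal.mul_ne_top hAg hC₂), fun f hf => ?_⟩
  set m : X → ℝ≥0∞ := fun x => maxFn μ (fun z => ‖f z‖ₑ ^ (2 : ℝ)) x ^ (1 / (2 : ℝ)) with hm
  have hmm : Measurable m := (measurable_maxFn _).pow_const _
  have hosc' : OscDominated μ (opFn T f) (fun x => A * (∑' j : ℕ, θ ^ j) * m x) := by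
    intro y r hr
    obtain ⟨a, hau, ha⟩ := hosc f hf y r hr
    refine ⟨a, hau, fun x hx => ha.trans ?_⟩
    refine mul_le_mul' ?_ le_rfl
    simp only
    rw [mul_assoc A, ← ENNReal.tsum_mul_right]
    refine mul_le_mul' le_rfl (ENNReal.tsum_le_tsum fun j => mul_le_mul' le_rfl ?_)
    refine avgNorm_le_maxFn two_pos _ (ball_subset_ball ?_ hx)
    exact le_mul_of_one_le_left hr.le (one_le_pow₀ one_le_two)
  have hfin : ∫⁻ x, ‖opFn T f x‖ₑ ^ (2 : ℝ) ∂μ ≠ ∞ :=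
    ne_top_of_le_ne_top (ENNReal.mul_ne_top
      (ENNReal.rpow_ne_top_of_nonneg zero_le_two enorm_ne_top)
      (hf.lintegral_ne_top hμ two_pos)) (lintegral_opFn_sq_le T (hf.memLp hμ))
  calc ∫⁻ x, ‖opFn T f x‖ₑ ^ p ∂μ ≤ C₁ * ∫⁻ x, (A * (∑' j : ℕ, θ ^ j) * m x) ^ p ∂μ :=
        hFS _ _ 2 (stronglyMeasurable_opFn T f).aestronglyMeasurable
          (hmm.const_mul _).aemeasurable hosc' one_lt_two hp.le hfin
    _ = C₁ * ((A * ∑' j : ℕ, θ ^ j) ^ p * ∫⁻ x, m x ^ p ∂μ) := by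
        rw [← lintegral_const_mul' _ _ hAg]
        simp only [ENNReal.mul_rpow_of_nonneg _ _ hp0.le]
    _ ≤ C₁ * ((A * ∑' j : ℕ, θ ^ j) ^ p * (C₂ * ∫⁻ x, ‖f x‖ₑ ^ p ∂μ)) := by
        gcongr
        exact hM _ hf.aesm.enorm
    _ = _ := by ring

/-- The bilinear transpose of an operator, tested on bounded functions with bounded support. -/
def IsTransposeOf (μ : Measure X) (T T' : Lp ℂ 2 μ →L[ℂ] Lp ℂ 2 μ) : Prop :=
  ∀ f g, BddSupp μ f → BddSupp μ g → ∫ x, opFn T f x * g x ∂μ = ∫ x, f x * opFn T' g x ∂μ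

/-- Boundedness on `L^p` by duality. The `L^p` norm of `T f` is not known to be finite, so it is
computed on sets where `T f` is bounded. -/
theorem IsDoubling.boundedOn_of_transpose (hμ : IsDoubling μ D) {T T' : Lp ℂ 2 μ →L[ℂ] Lp ℂ 2 μ}
    (hTT' : IsTransposeOf μ T T') {p p' : ℝ} (hp : p.HolderConjugate p')
    (hT' : BoundedOn μ T' p') : BoundedOn μ T p := by
  obtain ⟨C, hC, hT'⟩ := hT'
  have hp0 := hp.pos
  have hp'0 := hp.symm.pos
  refine ⟨C ^ (p / p'), ENNReal.rpow_ne_top_of_nonneg (by positivity) hC, fun f hf => ?_⟩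
  obtain ⟨x₀, -⟩ := hf.supp
  set F := opFn T f with hF
  have hFm : Measurable F := (stronglyMeasurable_opFn T f).measurable
  set S : ℕ → Set X := fun n => ball x₀ n ∩ {x | ‖F x‖ ≤ n} with hS
  have hSm : ∀ n, MeasurableSet (S n) := fun n =>
    measurableSet_ball.inter (measurableSet_le hFm.norm measurable_const)
  -- truncations of `conj F * |F| ^ (p - 2)` are the test functions which are extremal for `F`
  have key : ∀ n, ∫⁻ x in S n, ‖F x‖ₑ ^ p ∂μ ≤ C ^ (p / p') * ∫⁻ x, ‖f x‖ₑ ^ p ∂μ := by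
    intro n
    set g : X → ℂ := (S n).indicator
      (fun x => (starRingEnd ℂ) (F x) * ((‖F x‖ ^ (p - 2) : ℝ) : ℂ)) with hg
    have hgnorm : ∀ x, ‖g x‖ₑ = (S n).indicator (fun x => ‖F x‖ₑ ^ (p - 1)) x := fun x => by
      by_cases hx : x ∈ S n
      · rw [hg, indicator_of_mem hx, indicator_of_mem hx, ← ofReal_norm, ← ofReal_norm,
          ENNReal.ofReal_rpow_of_nonneg (norm_nonneg _) hp.sub_one_pos.le, norm_mul,
          Complex.norm_real, RCLike.norm_conj, Real.norm_eq_abs,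
          abs_of_nonneg (Real.rpow_nonneg (norm_nonneg _) _)]
        congr 1
        rcases eq_or_ne (F x) 0 with h0 | h0
        · rw [h0, norm_zero, zero_mul, Real.zero_rpow hp.sub_one_pos.ne']
        · have : 0 < ‖F x‖ := norm_pos_iff.2 h0
          rw [← Real.rpow_one_add' this.le (by linarith [hp.lt])]
          congr 1; ring
      · simp [hg, hx]
    have hgm : Measurable g := Measurable.indicator
      ((Complex.continuous_conj.measurable.comp hFm).mul
        (Complex.measurable_ofReal.comp (hFm.norm.pow_const _))) (hSm n)
    have hgs : BddSupp μ g := by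
      refine ⟨hgm.aestronglyMeasurable, ⟨(n : ℝ≥0) ^ (p - 1), fun x => ?_⟩, x₀, n, fun x hx => ?_⟩
      · rw [hgnorm, ENNReal.coe_rpow_of_nonneg _ hp.sub_one_pos.le]
        by_cases hx : x ∈ S n
        · rw [indicator_of_mem hx]
          refine ENNReal.rpow_le_rpow ?_ hp.sub_one_pos.le
          rw [← ofReal_norm]
          refine ENNReal.ofReal_le_of_le_toReal ?_
          simpa using hx.2
        · simp [hx]
      · exact indicator_of_notMem (fun h => hx h.1) _
    set I := ∫⁻ x in S n, ‖F x‖ₑ ^ p ∂μ with hI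
    have hgI : ∫⁻ x, ‖g x‖ₑ ^ p' ∂μ = I := by
      rw [hI, ← lintegral_indicator (hSm n)]
      refine lintegral_congr fun x => ?_
      rw [hgnorm]
      by_cases hx : x ∈ S n
      · rw [indicator_of_mem hx, indicator_of_mem hx, ← ENNReal.rpow_mul, hp.sub_one_mul_conj]
      · simp [hx, hp'0]
    have hIt : I ≠ ∞ := by
      rw [← hgI]
      exact hgs.lintegral_ne_top hμ hp'0
    have hFg : ∀ x, F x * g x = ((‖F x‖ * ‖g x‖ : ℝ) : ℂ) := fun x => by
      by_cases hx : x ∈ S n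
      · rw [hg, indicator_of_mem hx, norm_mul, Complex.norm_real, RCLike.norm_conj,
          Real.norm_eq_abs, abs_of_nonneg (Real.rpow_nonneg (norm_nonneg _) _), ← mul_assoc,
          Complex.mul_conj, Complex.normSq_eq_norm_sq]
        push_cast; ring
      · simp [hg, hx]
    have hIeq : ‖∫ x, F x * g x ∂μ‖ₑ = I := by
      simp_rw [hFg]
      rw [integral_complex_ofReal, ← ofReal_norm, Complex.norm_real, Real.norm_eq_abs,
        abs_of_nonneg (integral_nonneg fun x => by positivity),
        ofReal_integral_eq_lintegral_ofReal, hI, ← lintegral_indicator (hSm n)]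
      · refine lintegral_congr fun x => ?_
        rw [ENNReal.ofReal_mul (norm_nonneg _), ofReal_norm, ofReal_norm, hgnorm]
        by_cases hx : x ∈ S n
        · rw [indicator_of_mem hx, indicator_of_mem hx, ENNReal.mul_rpow_sub_one hp.lt]
        · simp [hx]
      · have : Integrable (fun x => F x * g x) μ :=
          (memLp_opFn T f).integrable_mul (hgs.memLp hμ)
        simpa [norm_mul] using this.norm
      · exact Eventually.of_forall fun x => by positivity
    have hIle : I ≤ (∫⁻ x, ‖f x‖ₑ ^ p ∂μ) ^ (1 / p) * (C * I) ^ (1 / p') := by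
      calc I = ‖∫ x, f x * opFn T' g x ∂μ‖ₑ := by rw [← hIeq, hTT' f g hf hgs]
        _ ≤ ∫⁻ x, ‖f x * opFn T' g x‖ₑ ∂μ := enorm_integral_le_lintegral_enorm _
        _ = ∫⁻ x, ((fun x => ‖f x‖ₑ) * fun x => ‖opFn T' g x‖ₑ) x ∂μ := by
            simp only [enorm_mul, Pi.mul_apply]
        _ ≤ (∫⁻ x, ‖f x‖ₑ ^ p ∂μ) ^ (1 / p) * (∫⁻ x, ‖opFn T' g x‖ₑ ^ p' ∂μ) ^ (1 / p') :=
            ENNReal.lintegral_mul_le_Lp_mul_Lq μ hp hf.aesm.enorm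
              (stronglyMeasurable_opFn T' g).enorm.aemeasurable
        _ ≤ _ := by
            gcongr
            exact (hT' g hgs).trans_eq (by rw [hgI])
    rcases eq_or_ne I 0 with hI0 | hI0
    · rw [hI0]; exact zero_le
    have h1 : I ^ (1 / p) ≤ C ^ (1 / p') * (∫⁻ x, ‖f x‖ₑ ^ p ∂μ) ^ (1 / p) := by
      have hI0' : I ^ (1 / p') ≠ 0 := by
        simp [ENNReal.rpow_eq_zero_iff, hI0, hIt]
      have hIt' : I ^ (1 / p') ≠ ∞ := ENNReal.rpow_ne_top_of_nonneg (by positivity) hIt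
      refine (ENNReal.mul_le_mul_iff_left hI0' hIt').1 ?_
      calc I ^ (1 / p) * I ^ (1 / p') = I := by
            rw [← ENNReal.rpow_add _ _ hI0 hIt, one_div, one_div, hp.inv_add_inv_eq_one,
              ENNReal.rpow_one]
        _ ≤ _ := hIle
        _ = _ := by rw [ENNReal.mul_rpow_of_nonneg _ _ (by positivity)]; ring
    have h2 := ENNReal.rpow_le_rpow h1 hp0.le
    rw [ENNReal.mul_rpow_of_nonneg _ _ hp0.le] at h2
    simp only [← ENNReal.rpow_mul, one_div, inv_mul_cancel₀ hp0.ne', ENNReal.rpow_one,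
      inv_mul_eq_div] at h2
    exact h2
  have hmono : Monotone S := fun m n hmn => by
    have hmn' : (m : ℝ) ≤ n := by exact_mod_cast hmn
    exact inter_subset_inter (ball_subset_ball hmn') fun x hx => le_trans hx hmn'
  have hun : ⋃ n, S n = univ := eq_univ_of_forall fun x => by
    obtain ⟨n, hn⟩ := exists_nat_gt (max (dist x x₀) ‖F x‖)
    exact mem_iUnion.2 ⟨n, mem_ball.2 ((le_max_left _ _).trans_lt hn),
      ((le_max_right _ _).trans_lt hn).le⟩
  rw [← setLIntegral_univ, ← hun, setLIntegral_iUnion_of_directed _ hmono.directed_le]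
  exact iSup_le key

/-- A pair of mutually transposed operators with off-diagonal smoothness is bounded on all `L^p`,
`1 < p < ∞`. -/
theorem IsDoubling.boundedOn (hμ : IsDoubling μ D) {T T' : Lp ℂ 2 μ →L[ℂ] Lp ℂ 2 μ}
    (hTT' : IsTransposeOf μ T T') {n₀ : ℕ} {θ C : ℝ≥0∞} (hθ0 : θ ≠ 0) (hθ : θ < 1) (hC : C ≠ ∞)
    (hT : OffDiag μ T n₀ θ C) (hT' : OffDiag μ T' n₀ θ C) {p : ℝ} (hp : 1 < p) :
    BoundedOn μ T p := by
  rcases lt_trichotomy p 2 with h | h | h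
  · have hc := Real.HolderConjugate.conjExponent hp
    refine hμ.boundedOn_of_transpose hTT' hc (hμ.boundedOn_of_two_lt hθ0 hθ hC hT' ?_)
    rw [Real.conjExponent, lt_div_iff₀ (by linarith)]
    linarith
  · rw [h]; exact boundedOn_two hμ T
  · exact hμ.boundedOn_of_two_lt hθ0 hθ hC hT h

end Operators

/-! ### The commutator estimate -/

section Commutator

variable {X : Type*} [MetricSpace X] [MeasurableSpace X] [BorelSpace X] {μ : Measure X} {D : ℝ≥0}

theorem ENNReal.tsum_geometric_mul_ne_top {θ : ℝ≥0∞} (hθ : θ < 1) :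
    ∑' j : ℕ, θ ^ j * ((j : ℝ≥0∞) + 1) ≠ ∞ := by
  lift θ to ℝ≥0 using hθ.ne_top
  have hθ' : ‖(θ : ℝ)‖ < 1 := by
    rw [Real.norm_of_nonneg (NNReal.coe_nonneg θ)]
    exact_mod_cast hθ
  have h1 : Summable fun j : ℕ => (θ : ℝ) ^ j * ((j : ℝ) + 1) := by
    have h2 := (summable_pow_mul_geometric_of_norm_lt_one 1 hθ').add
      (summable_geometric_of_norm_lt_one hθ')
    refine h2.congr fun j => ?_
    ring
  have h3 : Summable fun j : ℕ => θ ^ j * ((j : ℝ≥0) + 1) := by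
    rw [← NNReal.summable_coe]
    exact_mod_cast h1
  have h4 := ENNReal.tsum_coe_ne_top_iff_summable.2 h3
  exact_mod_cast h4

/-- The commutator estimate for bounded symbols: the bound depends on the symbol only through its
mean oscillation. Boundedness of the symbol serves only to make the `L^p` norm of the commutator
finite a priori, as the Fefferman–Stein inequality requires. -/
theorem IsDoubling.commutator_bound_of_bounded (hμ : IsDoubling μ D)
    {T : Lp ℂ 2 μ →L[ℂ] Lp ℂ 2 μ} {n₀ : ℕ} {θ C : ℝ≥0∞} (hθ0 : θ ≠ 0) (hθ : θ < 1) (hC : C ≠ ∞)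
    (hT : OffDiag μ T n₀ θ C) (hTb : ∀ s, 1 < s → BoundedOn μ T s) {p : ℝ} (hp : 1 < p) :
    ∃ A : ℝ≥0∞, A ≠ ∞ ∧ ∀ (b : X → ℂ) (a : X → ℝ → ℂ) (M : ℝ≥0∞), AEStronglyMeasurable b μ →
      (∃ N : ℝ≥0, ∀ x, ‖b x‖ₑ ≤ N) → BMOWith μ b a M → ∀ f, BddSupp μ f →
      ∫⁻ x, ‖b x * opFn T f x - opFn T (fun z => b z * f z) x‖ₑ ^ p ∂μ ≤
        A * M ^ p * ∫⁻ x, ‖f x‖ₑ ^ p ∂μ := by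
  have hp0 : 0 < p := by linarith
  -- `s` is used twice: Hölder's inequality turns `L^s` means of products into `L^(s * s)` means, and
  -- the maximal theorem on `L^p` requires `s * s < p`
  obtain ⟨s, hs, hsp⟩ : ∃ s : ℝ, 1 < s ∧ s * s < p := by
    refine ⟨√((1 + p) / 2), Real.lt_sqrt_of_sq_lt (by linarith), ?_⟩
    rw [Real.mul_self_sqrt (by linarith)]
    linarith
  have hs0 : 0 < s := by linarith
  have hss : 0 < s * s := by positivity
  set t := s.conjExponent with ht
  have hst : t.HolderConjugate s := (Real.HolderConjugate.conjExponent hs).symm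
  have hst1 : 1 < s * t := by nlinarith [hst.lt]
  obtain ⟨CJ, hCJ, hJN⟩ := hμ.john_nirenberg_dilate hst1
  obtain ⟨A, hA, hosc⟩ := hμ.setLIntegral_opFn_sub_le hθ0 hθ.le hC hT hs (hTb s hs)
  obtain ⟨C₁, hC₁, hFS⟩ := hμ.fefferman_stein hp
  obtain ⟨C₂, hC₂, hM⟩ := hμ.lintegral_maxFn_rpow_le hss hsp
  obtain ⟨Cp, hCp, hTp⟩ := hTb p hp
  set S := ∑' j : ℕ, θ ^ j * ((j : ℝ≥0∞) + 1) with hS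
  have hSt : S ≠ ∞ := ENNReal.tsum_geometric_mul_ne_top hθ
  set A' := CJ + A * CJ * S with hA'
  have hA't : A' ^ p ≠ ∞ := ENNReal.rpow_ne_top_of_nonneg hp0.le
    (ENNReal.add_ne_top.2 ⟨hCJ, ENNReal.mul_ne_top (ENNReal.mul_ne_top hA hCJ) hSt⟩)
  have h2t : (2 : ℝ≥0∞) ^ (p - 1) ≠ ∞ :=
    ENNReal.rpow_ne_top_of_nonneg (by linarith) ENNReal.ofNat_ne_top
  refine ⟨C₁ * (A' ^ p * (2 ^ (p - 1) * (C₂ * Cp + C₂))), ?_, ?_⟩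
  · exact ENNReal.mul_ne_top hC₁ (ENNReal.mul_ne_top hA't (ENNReal.mul_ne_top h2t
      (ENNReal.add_ne_top.2 ⟨ENNReal.mul_ne_top hC₂ hCp, hC₂⟩)))
  intro b a M hb hN hBMO f hf
  have hbf : BddSupp μ (fun z => b z * f z) := hf.bdd_mul hb hN
  set F : X → ℂ := fun x => b x * opFn T f x - opFn T (fun z => b z * f z) x with hF
  have hTfm := (stronglyMeasurable_opFn T f).aestronglyMeasurable (μ := μ)
  have hTbfm := (stronglyMeasurable_opFn T (fun z => b z * f z)).aestronglyMeasurable (μ := μ)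
  have hFm : AEStronglyMeasurable F μ := (hb.mul hTfm).sub hTbfm
  set m₁ : X → ℝ≥0∞ := fun x => maxFn μ (fun z => ‖opFn T f z‖ₑ ^ (s * s)) x ^ (1 / (s * s))
  set m₂ : X → ℝ≥0∞ := fun x => maxFn μ (fun z => ‖f z‖ₑ ^ (s * s)) x ^ (1 / (s * s))
  have hm₁ : Measurable m₁ := (measurable_maxFn _).pow_const _
  have hm₂ : Measurable m₂ := (measurable_maxFn _).pow_const _
  have hG : OscDominated μ F (fun x => M * (A' * (m₁ x + m₂ x))) := by
    intro y r hr
    set m := a y r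
    set g : X → ℂ := fun z => (b z - m) * f z with hg
    have hbm : AEStronglyMeasurable (fun z => b z - m) μ := hb.sub aestronglyMeasurable_const
    have hgs : BddSupp μ g := by
      obtain ⟨N, hN⟩ := hN
      exact hf.bdd_mul hbm ⟨N + ‖m‖₊, fun x => enorm_sub_le.trans
        (by rw [ENNReal.coe_add]; exact add_le_add (hN x) le_rfl)⟩
    have hJ : ∀ n : ℕ, avgNorm μ (s * t) (fun z => ‖b z - m‖ₑ) (ball y (2 ^ n * r)) ≤
        CJ * (n + 1) * M := by
      intro n
      have h1 := hJN b a M hb hN hBMO y r hr n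
      have h2 := ENNReal.rpow_le_rpow (ENNReal.div_le_of_le_mul h1)
        (by positivity : 0 ≤ 1 / (s * t))
      rwa [← ENNReal.rpow_mul, mul_one_div_cancel (by positivity), ENNReal.rpow_one] at h2
    obtain ⟨a', hau, ha'⟩ := hosc g hgs y r hr
    refine ⟨-a', fun hu => by rw [hau hu, neg_zero], fun x hx => ?_⟩
    have hxj : ∀ j : ℕ, x ∈ ball y (2 ^ j * r) := fun j =>
      ball_subset_ball (le_mul_of_one_le_left hr.le (one_le_pow₀ one_le_two)) hx
    -- the commutator does not change when a constant is subtracted from `b`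
    have hid : ∀ᵐ z ∂μ, F z - -a' = (b z - m) * opFn T f z - (opFn T g z - a') := by
      have h1 : g = (fun z => b z * f z) - fun z => m * f z := by
        ext z; simp only [hg, Pi.sub_apply]; ring
      have h2 := opFn_sub T (hbf.memLp hμ) ((hf.memLp hμ).const_mul m)
      rw [← h1] at h2
      filter_upwards [h2, opFn_const_mul T (hf.memLp hμ) m] with z hz hz'
      rw [hz, Pi.sub_apply, hz']
      simp only [hF]
      ring
    have hfirst : ∫⁻ z in ball y r, ‖b z - m‖ₑ * ‖opFn T f z‖ₑ ∂μ ≤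
        CJ * M * m₁ x * μ (ball y r) := by
      refine (setLIntegral_le_avgNorm hs (hbm.enorm.mul hTfm.enorm)
        (hμ.pos y r hr).ne' (hμ.ne_top y r)).trans ?_
      gcongr
      refine (avgNorm_mul_le hs0 hst hbm.enorm hTfm.enorm _).trans ?_
      refine mul_le_mul' ?_ (avgNorm_le_maxFn hss _ hx)
      have := hJ 0
      simpa using this
    have hsecond : ∑' j : ℕ, θ ^ j * avgNorm μ s (fun z => ‖g z‖ₑ) (ball y (2 ^ j * r)) ≤
        CJ * M * m₂ x * S := by
      rw [hS, ← ENNReal.tsum_mul_left]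
      refine ENNReal.tsum_le_tsum fun j => ?_
      calc θ ^ j * avgNorm μ s (fun z => ‖g z‖ₑ) (ball y (2 ^ j * r))
          ≤ θ ^ j * (CJ * (j + 1) * M * m₂ x) := by
            refine mul_le_mul' le_rfl ?_
            simp only [hg, enorm_mul]
            refine (avgNorm_mul_le hs0 hst hbm.enorm hf.aesm.enorm _).trans ?_
            exact mul_le_mul' (hJ j) (avgNorm_le_maxFn hss _ (hxj j))
        _ = _ := by ring
    calc ∫⁻ z in ball y r, ‖F z - -a'‖ₑ ∂μ
        ≤ ∫⁻ z in ball y r, (‖b z - m‖ₑ * ‖opFn T f z‖ₑ + ‖opFn T g z - a'‖ₑ) ∂μ := by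
          refine lintegral_mono_ae ?_
          filter_upwards [ae_restrict_of_ae hid] with z hz
          rw [hz, ← enorm_mul]
          exact enorm_sub_le
      _ = ∫⁻ z in ball y r, ‖b z - m‖ₑ * ‖opFn T f z‖ₑ ∂μ +
          ∫⁻ z in ball y r, ‖opFn T g z - a'‖ₑ ∂μ :=
          lintegral_add_left' (hbm.enorm.mul hTfm.enorm).restrict _
      _ ≤ CJ * M * m₁ x * μ (ball y r) + A * (CJ * M * m₂ x * S) * μ (ball y r) := by
          refine add_le_add hfirst (ha'.trans ?_)
          gcongr
      _ = M * (CJ * m₁ x + A * CJ * S * m₂ x) * μ (ball y r) := by ring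
      _ ≤ M * (A' * m₁ x + A' * m₂ x) * μ (ball y r) := by
          gcongr
          · exact le_self_add
          · exact le_add_self
      _ = _ := by ring
  have hfin : ∫⁻ x, ‖F x‖ₑ ^ p ∂μ ≠ ∞ := by
    obtain ⟨N, hN⟩ := hN
    have hle : ∫⁻ x, ‖F x‖ₑ ^ p ∂μ ≤ 2 ^ (p - 1) * (N ^ p * ∫⁻ x, ‖opFn T f x‖ₑ ^ p ∂μ +
        ∫⁻ x, ‖opFn T (fun z => b z * f z) x‖ₑ ^ p ∂μ) := by
      rw [← lintegral_const_mul' _ _ (ENNReal.rpow_ne_top_of_nonneg hp0.le ENNReal.coe_ne_top),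
        ← lintegral_add_right' _ (hTbfm.enorm.pow_const p), ← lintegral_const_mul' _ _ h2t]
      refine lintegral_mono fun x => ?_
      refine le_trans ?_ (mul_le_mul' le_rfl (add_le_add (mul_le_mul' (ENNReal.rpow_le_rpow (hN x)
        hp0.le) le_rfl) le_rfl))
      rw [← ENNReal.mul_rpow_of_nonneg _ _ hp0.le, ← enorm_mul]
      refine le_trans (ENNReal.rpow_le_rpow enorm_sub_le hp0.le) ?_
      exact ENNReal.rpow_add_le_mul_rpow_add_rpow _ _ hp.le
    refine ne_top_of_le_ne_top (ENNReal.mul_ne_top h2t (ENNReal.add_ne_top.2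
      ⟨ENNReal.mul_ne_top (ENNReal.rpow_ne_top_of_nonneg hp0.le ENNReal.coe_ne_top) ?_, ?_⟩)) hle
    · exact ne_top_of_le_ne_top (ENNReal.mul_ne_top hCp (hf.lintegral_ne_top hμ hp0)) (hTp f hf)
    · exact ne_top_of_le_ne_top (ENNReal.mul_ne_top hCp (hbf.lintegral_ne_top hμ hp0)) (hTp _ hbf)
  have hmax : ∫⁻ x, m₁ x ^ p ∂μ + ∫⁻ x, m₂ x ^ p ∂μ ≤
      (C₂ * Cp + C₂) * ∫⁻ x, ‖f x‖ₑ ^ p ∂μ := by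
    calc ∫⁻ x, m₁ x ^ p ∂μ + ∫⁻ x, m₂ x ^ p ∂μ
        ≤ C₂ * (Cp * ∫⁻ x, ‖f x‖ₑ ^ p ∂μ) + C₂ * ∫⁻ x, ‖f x‖ₑ ^ p ∂μ := by
          refine add_le_add ((hM _ hTfm.enorm).trans ?_) (hM _ hf.aesm.enorm)
          gcongr
          exact hTp f hf
      _ = _ := by ring
  calc ∫⁻ x, ‖F x‖ₑ ^ p ∂μ ≤ C₁ * ∫⁻ x, (M * (A' * (m₁ x + m₂ x))) ^ p ∂μ :=
        hFS F _ p hFm (((hm₁.add hm₂).const_mul _).const_mul _).aemeasurable hG hp le_rfl hfin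
    _ ≤ C₁ * ∫⁻ x, M ^ p * (A' ^ p * (2 ^ (p - 1) * (m₁ x ^ p + m₂ x ^ p))) ∂μ := by
        refine mul_le_mul' le_rfl (lintegral_mono fun x => ?_)
        rw [ENNReal.mul_rpow_of_nonneg _ _ hp0.le, ENNReal.mul_rpow_of_nonneg _ _ hp0.le]
        gcongr
        exact ENNReal.rpow_add_le_mul_rpow_add_rpow _ _ hp.le
    _ = C₁ * (M ^ p * (A' ^ p * (2 ^ (p - 1) * (∫⁻ x, m₁ x ^ p ∂μ + ∫⁻ x, m₂ x ^ p ∂μ)))) := by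
        have h1 := hm₁.pow_const p
        have h2 := hm₂.pow_const p
        have h12 : Measurable fun x => m₁ x ^ p + m₂ x ^ p := h1.add h2
        rw [lintegral_const_mul _ ((h12.const_mul _).const_mul _),
          lintegral_const_mul _ (h12.const_mul _), lintegral_const_mul _ h12,
          lintegral_add_left h1]
    _ ≤ C₁ * (M ^ p * (A' ^ p * (2 ^ (p - 1) * ((C₂ * Cp + C₂) * ∫⁻ x, ‖f x‖ₑ ^ p ∂μ)))) := by
        gcongr
    _ = _ := by ring

/-! ### Removing the boundedness assumptions -/

/-- The nearest point to `z` in the square `{|re| ≤ n, |im| ≤ n}`. Composition of a symbol with this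
`1`-Lipschitz retraction makes it bounded and does not increase its mean oscillation. -/
def clampC (n : ℕ) (z : ℂ) : ℂ := ⟨max (-n) (min n z.re), max (-n) (min n z.im)⟩

theorem abs_clamp_sub_clamp_le (c x y : ℝ) :
    |max (-c) (min c x) - max (-c) (min c y)| ≤ |x - y| := by
  refine (abs_max_sub_max_le_max _ _ _ _).trans (max_le (by simp) ?_)
  exact (abs_min_sub_min_le_max _ _ _ _).trans (max_le (by simp) le_rfl)

theorem norm_clampC_sub_le (n : ℕ) (z w : ℂ) : ‖clampC n z - clampC n w‖ ≤ ‖z - w‖ := by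
  rw [Complex.norm_eq_sqrt_sq_add_sq, Complex.norm_eq_sqrt_sq_add_sq]
  refine Real.sqrt_le_sqrt (add_le_add (sq_le_sq.2 ?_) (sq_le_sq.2 ?_))
  · simpa [clampC] using abs_clamp_sub_clamp_le n z.re w.re
  · simpa [clampC] using abs_clamp_sub_clamp_le n z.im w.im

theorem clampC_zero (n : ℕ) : clampC n 0 = 0 := by
  apply Complex.ext <;> simp [clampC]

theorem norm_clampC_le (n : ℕ) (z : ℂ) : ‖clampC n z‖ ≤ ‖z‖ := by
  simpa [clampC_zero] using norm_clampC_sub_le n z 0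

theorem norm_clampC_le_nat (n : ℕ) (z : ℂ) : ‖clampC n z‖ ≤ 2 * n := by
  have h : ∀ x : ℝ, |max (-(n : ℝ)) (min n x)| ≤ n := fun x =>
    abs_le.2 ⟨le_max_left _ _, max_le (by linarith [n.cast_nonneg (α := ℝ)]) (min_le_left _ _)⟩
  refine (Complex.norm_le_abs_re_add_abs_im _).trans ?_
  have h1 := h z.re
  have h2 := h z.im
  simp only [clampC]
  linarith

theorem clampC_eq_self {n : ℕ} {z : ℂ} (h : ‖z‖ ≤ n) : clampC n z = z := by
  have h1 := abs_le.1 ((Complex.abs_re_le_norm z).trans h)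
  have h2 := abs_le.1 ((Complex.abs_im_le_norm z).trans h)
  apply Complex.ext
  · simp only [clampC]
    rw [min_eq_right h1.2, max_eq_right h1.1]
  · simp only [clampC]
    rw [min_eq_right h2.2, max_eq_right h2.1]

theorem tendsto_clampC (z : ℂ) : Tendsto (fun n => clampC n z) atTop (𝓝 z) := by
  obtain ⟨N, hN⟩ := exists_nat_ge ‖z‖
  refine tendsto_const_nhds.congr' ?_
  filter_upwards [eventually_ge_atTop N] with n hn
  exact (clampC_eq_self (hN.trans (by exact_mod_cast hn))).symm

theorem continuous_clampC (n : ℕ) : Continuous (clampC n) := by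
  refine LipschitzWith.continuous (K := 1) (LipschitzWith.of_dist_le_mul fun z w => ?_)
  simpa [dist_eq_norm] using norm_clampC_sub_le n z w

theorem BMOWith.clampC {b : X → ℂ} {a : X → ℝ → ℂ} {M : ℝ≥0∞} (h : BMOWith μ b a M) (n : ℕ) :
    BMOWith μ (fun x => clampC n (b x)) (fun x r => clampC n (a x r)) M := fun x r hr =>
  (lintegral_mono fun z => by
    rw [enorm_le_iff_norm_le]
    exact norm_clampC_sub_le n _ _).trans (h x r hr)

/-- Dominated convergence in `L²`, carried over by a bounded operator. -/
theorem tendstoInMeasure_opFn (T : Lp ℂ 2 μ →L[ℂ] Lp ℂ 2 μ) {g : ℕ → X → ℂ} {h : X → ℂ}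
    (hg : ∀ n, AEStronglyMeasurable (g n) μ) (hh : MemLp h 2 μ) (hle : ∀ n x, ‖g n x‖ ≤ ‖h x‖)
    (hlim : ∀ x, Tendsto (fun n => g n x) atTop (𝓝 (h x))) :
    TendstoInMeasure μ (fun n => opFn T (g n)) atTop (opFn T h) := by
  have hgL : ∀ n, MemLp (g n) 2 μ := fun n => hh.mono (hg n) (Eventually.of_forall (hle n))
  have hsq : ∀ n, eLpNorm (g n - h) 2 μ = (∫⁻ x, ‖g n x - h x‖ₑ ^ (2 : ℝ) ∂μ) ^ (1 / (2 : ℝ)) :=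
    fun n => by
      rw [eLpNorm_eq_lintegral_rpow_enorm_toReal two_ne_zero ENNReal.ofNat_ne_top]; simp
  have hbound : ∫⁻ x, (2 * ‖h x‖ₑ) ^ (2 : ℝ) ∂μ ≠ ∞ := by
    have h1 := (eLpNorm_lt_top_iff_lintegral_rpow_enorm_lt_top two_ne_zero
      ENNReal.ofNat_ne_top).1 hh.2
    have h2t : (2 : ℝ≥0∞) ^ (2 : ℝ) ≠ ∞ :=
      ENNReal.rpow_ne_top_of_nonneg zero_le_two ENNReal.ofNat_ne_top
    simp only [ENNReal.mul_rpow_of_nonneg _ _ (zero_le_two (α := ℝ))]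
    rw [lintegral_const_mul' _ _ h2t]
    exact ENNReal.mul_ne_top h2t h1.ne
  have hdct : Tendsto (fun n => ∫⁻ x, ‖g n x - h x‖ₑ ^ (2 : ℝ) ∂μ) atTop (𝓝 (∫⁻ _, 0 ∂μ)) := by
    refine tendsto_lintegral_of_dominated_convergence' (fun x => (2 * ‖h x‖ₑ) ^ (2 : ℝ))
      (fun n => ((hg n).sub hh.1).enorm.pow_const _) (fun n => Eventually.of_forall fun x => ?_)
      hbound (Eventually.of_forall fun x => ?_)
    · refine ENNReal.rpow_le_rpow (enorm_sub_le.trans ?_) zero_le_two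
      rw [two_mul]
      refine add_le_add ?_ le_rfl
      rw [enorm_le_iff_norm_le]
      exact hle n x
    · have h1 : Tendsto (fun n => ‖g n x - h x‖ₑ) atTop (𝓝 0) := by
        have := ((hlim x).sub_const (h x)).enorm
        simpa using this
      simpa using h1.ennrpow_const 2
  have hL : Tendsto (fun n => (hgL n).toLp (g n)) atTop (𝓝 (hh.toLp h)) := by
    rw [Lp.tendsto_Lp_iff_tendsto_eLpNorm'' _ hgL _ hh]
    simp_rw [hsq]
    simpa using hdct.ennrpow_const (1 / 2)
  have h3 := tendstoInMeasure_of_tendsto_Lp ((T.continuous.tendsto _).comp hL)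
  simp only [Function.comp_apply, ← opFn_eq] at h3
  exact h3

/-- The commutator estimate for arbitrary symbols of bounded mean oscillation. The symbol and the
function are truncated simultaneously, and the bound passes to the limit by Fatou's lemma. -/
theorem IsDoubling.commutator_bound [Nonempty X] (hμ : IsDoubling μ D)
    {T : Lp ℂ 2 μ →L[ℂ] Lp ℂ 2 μ} {n₀ : ℕ} {θ C : ℝ≥0∞} (hθ0 : θ ≠ 0) (hθ : θ < 1) (hC : C ≠ ∞)
    (hT : OffDiag μ T n₀ θ C) (hTb : ∀ s, 1 < s → BoundedOn μ T s) {p : ℝ} (hp : 1 < p) :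
    ∃ A : ℝ≥0∞, A ≠ ∞ ∧ ∀ (b : X → ℂ) (a : X → ℝ → ℂ) (M : ℝ≥0∞), AEStronglyMeasurable b μ →
      BMOWith μ b a M → ∀ f, StronglyMeasurable f → MemLp f 2 μ → MemLp (fun x => b x * f x) 2 μ →
      ∫⁻ x, ‖b x * opFn T f x - opFn T (fun z => b z * f z) x‖ₑ ^ p ∂μ ≤
        A * M ^ p * ∫⁻ x, ‖f x‖ₑ ^ p ∂μ := by
  obtain ⟨A, hA, hmain⟩ := hμ.commutator_bound_of_bounded hθ0 hθ hC hT hTb hp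
  refine ⟨A, hA, fun b a M hb hBMO f hfm hf hbf => ?_⟩
  have hp0 : 0 < p := by linarith
  obtain ⟨x₀⟩ := ‹Nonempty X›
  set E : ℕ → Set X := fun n => ball x₀ n ∩ {x | ‖f x‖ ≤ n} with hE
  have hEm : ∀ n, MeasurableSet (E n) := fun n =>
    measurableSet_ball.inter (measurableSet_le hfm.measurable.norm measurable_const)
  have hEev : ∀ x, ∀ᶠ n in atTop, x ∈ E n := fun x => by
    obtain ⟨N, hN⟩ := exists_nat_gt (max (dist x x₀) ‖f x‖)
    filter_upwards [eventually_ge_atTop N] with n hn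
    have hn' : (N : ℝ) ≤ n := by exact_mod_cast hn
    exact ⟨mem_ball.2 (((le_max_left _ _).trans_lt hN).trans_le hn'),
      ((le_max_right _ _).trans hN.le).trans hn'⟩
  set fn : ℕ → X → ℂ := fun n => (E n).indicator f with hfn
  set bn : ℕ → X → ℂ := fun n x => clampC n (b x) with hbn
  have hfnle : ∀ n x, ‖fn n x‖ ≤ ‖f x‖ := fun n x => norm_indicator_le_norm_self _ _
  have hfnlim : ∀ x, Tendsto (fun n => fn n x) atTop (𝓝 (f x)) := fun x =>
    tendsto_const_nhds.congr' ((hEev x).mono fun n hn => (indicator_of_mem hn f).symm)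
  have hfns : ∀ n, BddSupp μ (fn n) := fun n =>
    ⟨(hfm.indicator (hEm n)).aestronglyMeasurable, ⟨n, fun x => by
      by_cases hx : x ∈ E n
      · simp only [hfn, indicator_of_mem hx]
        rw [← ofReal_norm]
        refine ENNReal.ofReal_le_of_le_toReal ?_
        simpa using hx.2
      · simp [hfn, hx]⟩, x₀, n, fun x hx => indicator_of_notMem (fun h => hx h.1) _⟩
  have hbnm : ∀ n, AEStronglyMeasurable (bn n) μ := fun n =>
    (continuous_clampC n).comp_aestronglyMeasurable hb
  have hbnb : ∀ n, ∃ N : ℝ≥0, ∀ x, ‖bn n x‖ₑ ≤ N := fun n => ⟨2 * n, fun x => by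
    rw [← ofReal_norm]
    refine ENNReal.ofReal_le_of_le_toReal ?_
    simpa using norm_clampC_le_nat n (b x)⟩
  have hconv₁ := tendstoInMeasure_opFn T (fun n => (hfns n).aesm) hf hfnle hfnlim
  -- two successive passages to subsequences give a.e. convergence of both terms
  obtain ⟨n₁, hn₁, hae₁⟩ := hconv₁.exists_seq_tendsto_ae
  have hconv₂ := tendstoInMeasure_opFn T (g := fun k x => bn (n₁ k) x * fn (n₁ k) x)
    (fun k => (hbnm _).mul (hfns _).aesm) hbf (fun k x => by
      rw [norm_mul, norm_mul]
      exact mul_le_mul (norm_clampC_le _ _) (hfnle _ _) (norm_nonneg _) (norm_nonneg _))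
    (fun x => (((tendsto_clampC (b x)).mul (hfnlim x)).comp hn₁.tendsto_atTop))
  obtain ⟨n₂, hn₂, hae₂⟩ := hconv₂.exists_seq_tendsto_ae
  set N : ℕ → ℕ := fun k => n₁ (n₂ k) with hN
  have hNt : Tendsto N atTop atTop := hn₁.tendsto_atTop.comp hn₂.tendsto_atTop
  set F : ℕ → X → ℂ := fun k x => bn (N k) x * opFn T (fn (N k)) x -
    opFn T (fun z => bn (N k) z * fn (N k) z) x with hF
  have hlim : ∀ᵐ x ∂μ, ‖b x * opFn T f x - opFn T (fun z => b z * f z) x‖ₑ ^ p =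
      liminf (fun k => ‖F k x‖ₑ ^ p) atTop := by
    filter_upwards [hae₁, hae₂] with x h1 h2
    have h3 : Tendsto (fun k => F k x) atTop
        (𝓝 (b x * opFn T f x - opFn T (fun z => b z * f z) x)) :=
      (((tendsto_clampC (b x)).comp hNt).mul (h1.comp hn₂.tendsto_atTop)).sub h2
    exact (h3.enorm.ennrpow_const p).liminf_eq.symm
  have hFm : ∀ k, AEMeasurable (fun x => ‖F k x‖ₑ ^ p) μ := fun k =>
    (((hbnm _).mul (stronglyMeasurable_opFn T _).aestronglyMeasurable).sub
      (stronglyMeasurable_opFn T _).aestronglyMeasurable).enorm.pow_const p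
  calc ∫⁻ x, ‖b x * opFn T f x - opFn T (fun z => b z * f z) x‖ₑ ^ p ∂μ
      = ∫⁻ x, liminf (fun k => ‖F k x‖ₑ ^ p) atTop ∂μ := lintegral_congr_ae hlim
    _ ≤ liminf (fun k => ∫⁻ x, ‖F k x‖ₑ ^ p ∂μ) atTop := lintegral_liminf_le' hFm
    _ ≤ liminf (fun _ : ℕ => A * M ^ p * ∫⁻ x, ‖f x‖ₑ ^ p ∂μ) atTop := by
        refine liminf_le_liminf (Eventually.of_forall fun k => ?_)
        refine (hmain _ _ M (hbnm (N k)) (hbnb (N k)) (hBMO.clampC (N k)) _ (hfns (N k))).trans ?_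
        refine mul_le_mul' le_rfl (lintegral_mono fun x => ENNReal.rpow_le_rpow ?_ hp0.le)
        rw [enorm_le_iff_norm_le]
        exact hfnle _ x
    _ = _ := liminf_const _

end Commutator

/-! ### Kernel representation off the diagonal -/

section Kernel

variable {X : Type*} [MetricSpace X] [MeasurableSpace X] [BorelSpace X] {μ : Measure X} {D : ℝ≥0}

/-- Compactly supported Lipschitz functions. -/
def LipTest (f : X → ℂ) : Prop :=
  HasCompactSupport f ∧ ∃ L : ℝ, ∀ x y, ‖f x - f y‖ ≤ L * dist x y

theorem LipTest.continuous {f : X → ℂ} (hf : LipTest f) : Continuous f := by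
  obtain ⟨L, hL⟩ := hf.2
  refine LipschitzWith.continuous (K := L.toNNReal) (LipschitzWith.of_dist_le_mul fun x y => ?_)
  rw [dist_eq_norm]
  refine (hL x y).trans ?_
  gcongr
  exact Real.le_coe_toNNReal L

theorem LipTest.bddSupp [Nonempty X] [SecondCountableTopology X] {f : X → ℂ} (hf : LipTest f) :
    BddSupp μ f := by
  obtain ⟨x₀⟩ := ‹Nonempty X›
  obtain ⟨C, hC⟩ := hf.1.exists_bound_of_continuous hf.continuous
  obtain ⟨R, hR⟩ := hf.1.isBounded.subset_ball x₀
  refine ⟨hf.continuous.aestronglyMeasurable, ⟨C.toNNReal, fun x => ?_⟩, x₀, R, fun x hx => ?_⟩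
  · rw [← ofReal_norm]
    exact ENNReal.ofReal_le_ofReal (hC x)
  · exact image_eq_zero_of_notMem_tsupport fun h => hx (hR h)

/-- A function on an open set which is orthogonal to all compactly supported Lipschitz functions
vanishes almost everywhere. -/
theorem ae_eq_zero_of_integral_lipTest [LocallyCompactSpace X] [SecondCountableTopology X]
    {U : Set X} (hU : IsOpen U) {u : X → ℂ} (hu : IntegrableOn u U μ)
    (h : ∀ φ, LipTest φ → tsupport φ ⊆ U → ∫ x, u x * φ x ∂μ = 0) :
    ∀ᵐ x ∂μ.restrict U, u x = 0 := by
  have hcompact : ∀ K : Set X, IsCompact K → K ⊆ U → ∫ x in K, u x ∂μ = 0 := by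
    intro K hK hKU
    obtain ⟨L, hL, hKL, hLU⟩ := exists_compact_between hK hU hKU
    obtain ⟨δ, hδ, hδL⟩ := hK.exists_cthickening_subset_open isOpen_interior hKL
    set δs : ℕ → ℝ := fun n => δ * (1 / ((n : ℝ) + 1)) with hδs
    have hδpos : ∀ n, 0 < δs n := fun n => by positivity
    have hδlim : Tendsto δs atTop (𝓝 0) := by
      have := (tendsto_one_div_add_atTop_nhds_zero_nat (𝕜 := ℝ)).const_mul δ
      rw [mul_zero] at this
      exact this
    have hδle : ∀ n, δs n ≤ δ := fun n => by
      refine mul_le_of_le_one_right hδ.le ?_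
      rw [div_le_one (by positivity)]
      linarith [n.cast_nonneg (α := ℝ)]
    set φ : ℕ → X → ℂ := fun n x => ((thickenedIndicator (hδpos n) K x : ℝ) : ℂ) with hφ
    have hφ0 : ∀ n x, x ∉ L → φ n x = 0 := fun n x hx => by
      have : x ∉ thickening (δs n) K := fun hx' => hx (interior_subset (hδL
        (cthickening_mono (hδle n) K (thickening_subset_cthickening _ _ hx'))))
      show ((thickenedIndicator (hδpos n) K x : ℝ) : ℂ) = 0
      rw [thickenedIndicator_zero (hδpos n) K this, NNReal.coe_zero, Complex.ofReal_zero]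
    have hφts : ∀ n, tsupport (φ n) ⊆ L := fun n =>
      closure_minimal (fun x hx => by
        by_contra hxL
        exact hx (hφ0 n x hxL)) hL.isClosed
    have hφtest : ∀ n, LipTest (φ n) := fun n => by
      refine ⟨HasCompactSupport.intro hL (hφ0 n), ((δs n).toNNReal⁻¹ : ℝ≥0), fun x y => ?_⟩
      have := (lipschitzWith_thickenedIndicator (hδpos n) K).dist_le_mul x y
      simp only [hφ]
      rw [← Complex.ofReal_sub, Complex.norm_real]
      exact this
    have hφle : ∀ n x, ‖φ n x‖ ≤ 1 := fun n x => by
      simp only [hφ]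
      rw [Complex.norm_real, Real.norm_of_nonneg (NNReal.coe_nonneg _)]
      exact_mod_cast thickenedIndicator_le_one (hδpos n) K x
    have hφlim : ∀ x, Tendsto (fun n => φ n x) atTop (𝓝 (K.indicator 1 x)) := fun x => by
      have h1 := tendsto_pi_nhds.1 (thickenedIndicator_tendsto_indicator_closure hδpos hδlim K) x
      rw [hK.isClosed.closure_eq] at h1
      have h2 : Continuous fun t : ℝ≥0 => ((t : ℝ) : ℂ) := by fun_prop
      have h3 := (h2.tendsto _).comp h1
      have h4 : K.indicator (1 : X → ℂ) x
          = (((K.indicator (fun _ => (1 : ℝ≥0)) x : ℝ≥0) : ℝ) : ℂ) := by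
        by_cases hx : x ∈ K <;> simp [hx]
      rw [h4]
      exact h3
    have hw : Integrable (U.indicator u) μ := hu.integrable_indicator hU.measurableSet
    have hprod : ∀ n x, u x * φ n x = U.indicator u x * φ n x := fun n x => by
      by_cases hx : x ∈ U
      · rw [indicator_of_mem hx]
      · rw [hφ0 n x (fun h => hx (hLU h)), mul_zero, mul_zero]
    have hlim : Tendsto (fun n => ∫ x, U.indicator u x * φ n x ∂μ) atTop
        (𝓝 (∫ x, U.indicator u x * K.indicator 1 x ∂μ)) := by
      refine tendsto_integral_of_dominated_convergence (fun x => ‖U.indicator u x‖)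
        (fun n => hw.1.mul (hφtest n).continuous.aestronglyMeasurable) hw.norm
        (fun n => Eventually.of_forall fun x => ?_)
        (Eventually.of_forall fun x => (hφlim x).const_mul _)
      rw [norm_mul]
      exact mul_le_of_le_one_right (norm_nonneg _) (hφle n x)
    have hzero : ∀ n, ∫ x, U.indicator u x * φ n x ∂μ = 0 := fun n => by
      simp_rw [← hprod]
      exact h _ (hφtest n) ((hφts n).trans hLU)
    simp_rw [hzero] at hlim
    rw [tendsto_nhds_unique tendsto_const_nhds hlim, ← integral_indicator hK.measurableSet]
    refine integral_congr_ae (Eventually.of_forall fun x => ?_)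
    by_cases hx : x ∈ K
    · simp [hx, hKU hx]
    · simp [hx]
  refine ae_eq_zero_of_forall_setIntegral_isCompact_eq_zero (μ := μ.restrict U) hu fun s hs => ?_
  obtain ⟨F, hFc, hFU, hFun, hFmono⟩ := hU.exists_iUnion_isClosed
  rw [Measure.restrict_restrict hs.measurableSet, ← hFun, inter_iUnion]
  have hlim := tendsto_setIntegral_of_monotone (μ := μ) (f := u) (s := fun n => s ∩ F n)
    (fun n => hs.measurableSet.inter (hFc n).measurableSet)
    (fun m n hmn => inter_subset_inter_right _ (hFmono hmn))
    (hu.mono_set (iUnion_subset fun n => inter_subset_right.trans (hFU n)))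
  refine tendsto_nhds_unique hlim ?_
  simp_rw [fun n => hcompact (s ∩ F n) (hs.inter_right (hFc n)) (inter_subset_right.trans (hFU n))]
  exact tendsto_const_nhds

/-- The operator `T` is given by the kernel `k` away from the support of the function: if `f` vanishes
off `U`, then `T f` is the absolutely convergent integral against `k` a.e. on any bounded open set
at positive distance from `U`. -/
def HasKernel (μ : Measure X) (T : Lp ℂ 2 μ →L[ℂ] Lp ℂ 2 μ) (k : X → X → ℂ) : Prop :=
  ∀ (U V : Set X) (ε : ℝ), IsOpen U → IsOpen V → Bornology.IsBounded U → Bornology.IsBounded V →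
    0 < ε → (∀ x ∈ V, ∀ y ∈ U, ε ≤ dist x y) → ∀ f, BddSupp μ f → (∀ x, x ∉ U → f x = 0) →
    ∀ᵐ x ∂μ.restrict V, Integrable (fun y => k x y * f y) μ ∧ opFn T f x = ∫ y, k x y * f y ∂μ

/-- The weak association of an operator with a kernel of the size of a standard kernel, tested on
Lipschitz functions with separated compact supports. -/
structure WeakKernel (μ : Measure X) (T : Lp ℂ 2 μ →L[ℂ] Lp ℂ 2 μ) (k : X → X → ℂ) : Prop where
  aesm : AEStronglyMeasurable (fun q : X × X => k q.1 q.2) ((μ.prod μ).restrict {q | q.1 ≠ q.2})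
  size : ∃ C : ℝ≥0, ∀ x y, x ≠ y → ‖k x y‖ₑ * μ (ball x (dist x y)) ≤ C
  pairing : ∀ f g, LipTest f → LipTest g →
    (∃ η : ℝ, 0 < η ∧ ∀ x ∈ tsupport f, ∀ y ∈ tsupport g, η ≤ dist x y) →
    ∫ x, opFn T f x * g x ∂μ = ∫ x, ∫ y, k x y * f y * g x ∂μ ∂μ

section BoundedKernel

/-! A bounded kernel `κ` with `κ x y = 0` for `x` outside a set of finite measure is harmless: the
integrals below converge absolutely and Fubini's theorem applies. -/

variable {κ : X → X → ℂ} {U V : Set X} {K₀ : ℝ}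

theorem integrable_kernel_mul [SFinite μ]
    (hκ : AEStronglyMeasurable (fun q : X × X => κ q.1 q.2) (μ.prod μ))
    (hb : ∀ x y, ‖κ x y‖ ≤ K₀) (hV : MeasurableSet V) (hVt : μ V ≠ ∞)
    (h0 : ∀ x y, x ∉ V → κ x y = 0) {f : X → ℂ} (hf : Integrable f μ) :
    Integrable (fun q : X × X => κ q.1 q.2 * f q.2) (μ.prod μ) := by
  have hdom : Integrable (fun q : X × X => V.indicator (fun _ => K₀) q.1 * ‖f q.2‖)
      (μ.prod μ) := by
    refine Integrable.mul_prod (f := V.indicator fun _ => K₀) (g := fun y => ‖f y‖) ?_ hf.norm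
    exact (integrableOn_const hVt).integrable_indicator hV
  refine hdom.mono (hκ.mul hf.1.comp_snd) (Eventually.of_forall fun q => ?_)
  have hK₀ : 0 ≤ K₀ := (norm_nonneg _).trans (hb q.1 q.2)
  by_cases hq : q.1 ∈ V
  · rw [norm_mul, norm_mul, norm_norm, indicator_of_mem hq, Real.norm_of_nonneg hK₀]
    exact mul_le_mul_of_nonneg_right (hb _ _) (norm_nonneg _)
  · rw [h0 _ _ hq, zero_mul, norm_zero]
    exact norm_nonneg _

theorem integral_kernel_swap [SFinite μ]
    (hκ : AEStronglyMeasurable (fun q : X × X => κ q.1 q.2) (μ.prod μ))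
    (hb : ∀ x y, ‖κ x y‖ ≤ K₀) (hV : MeasurableSet V) (hVt : μ V ≠ ∞)
    (h0 : ∀ x y, x ∉ V → κ x y = 0) {f g : X → ℂ} (hf : Integrable f μ) (hg : BddSupp μ g) :
    ∫ x, (∫ y, κ x y * f y ∂μ) * g x ∂μ = ∫ y, (∫ x, κ x y * g x ∂μ) * f y ∂μ := by
  obtain ⟨N, hN⟩ := hg.bdd
  have hint : Integrable (fun q : X × X => κ q.1 q.2 * f q.2 * g q.1) (μ.prod μ) := by
    refine (integrable_kernel_mul hκ hb hV hVt h0 hf).mul_bdd (c := N) hg.aesm.comp_fst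
      (Eventually.of_forall fun q => ?_)
    exact enorm_le_coe.1 (hN q.1)
  have h1 := integral_integral_swap (f := fun x y => κ x y * f y * g x) hint
  simp_rw [← integral_mul_const]
  rw [h1]
  refine integral_congr_ae (Eventually.of_forall fun y => ?_)
  simp only
  congr 1
  ext x
  ring

end BoundedKernel

/-- Weak association implies the pointwise kernel representation, for the operator and for its
transpose. The pairing determines `T' ψ` on `U` for test functions `ψ` supported in `V`. By
duality this determines `T f` on `V` for all bounded `f` vanishing off `U`, and by duality once more
`T' g` on `U` for all bounded `g` vanishing off `V`. -/
theorem WeakKernel.hasKernel [LocallyCompactSpace X] [Nonempty X] (hμ : IsDoubling μ D)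
    {T T' : Lp ℂ 2 μ →L[ℂ] Lp ℂ 2 μ} (hTT' : IsTransposeOf μ T T') {k : X → X → ℂ}
    (hk : WeakKernel μ T k) : HasKernel μ T k ∧ HasKernel μ T' fun x y => k y x := by
  have := hμ.secondCountable
  have := hμ.sigmaFinite
  have main : ∀ (U V : Set X) (ε : ℝ), IsOpen U → IsOpen V → Bornology.IsBounded U →
      Bornology.IsBounded V → 0 < ε → (∀ x ∈ V, ∀ y ∈ U, ε ≤ dist x y) →
      (∀ f, BddSupp μ f → (∀ x, x ∉ U → f x = 0) → ∀ᵐ x ∂μ.restrict V,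
        Integrable (fun y => k x y * f y) μ ∧ opFn T f x = ∫ y, k x y * f y ∂μ) ∧
      (∀ g, BddSupp μ g → (∀ x, x ∉ V → g x = 0) → ∀ᵐ y ∂μ.restrict U,
        Integrable (fun x => k x y * g x) μ ∧ opFn T' g y = ∫ x, k x y * g x ∂μ) := by
    intro U V ε hU hV hUb hVb hε hsep
    obtain ⟨x₁⟩ := ‹Nonempty X›
    obtain ⟨R₀, hR₀⟩ := hVb.subset_ball x₁
    obtain ⟨R₁, hR₁⟩ := hUb.subset_ball x₁
    have hVt : μ V ≠ ∞ := ne_top_of_le_ne_top (hμ.ne_top x₁ R₀) (measure_mono hR₀)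
    have hUt : μ U ≠ ∞ := ne_top_of_le_ne_top (hμ.ne_top x₁ R₁) (measure_mono hR₁)
    -- a uniform bound for the kernel on `V × U`
    obtain ⟨K₀, hK₀⟩ : ∃ K₀ : ℝ, ∀ x ∈ V, ∀ y ∈ U, ‖k x y‖ ≤ K₀ := by
      obtain ⟨C, hC⟩ := hk.size
      set R := max R₀ 1
      have hR : 0 < R := lt_max_of_lt_right one_pos
      obtain ⟨n, hn⟩ := pow_unbounded_of_one_lt (2 * R / ε) (one_lt_two : (1 : ℝ) < 2)
      rw [div_lt_iff₀ hε] at hn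
      have hB0 := (hμ.pos x₁ R hR).ne'
      have hBt := hμ.ne_top x₁ R
      have hKt : (C : ℝ≥0∞) * D ^ n / μ (ball x₁ R) ≠ ∞ := ENNReal.div_ne_top
        (ENNReal.mul_ne_top ENNReal.coe_ne_top (ENNReal.pow_ne_top ENNReal.coe_ne_top)) hB0
      refine ⟨((C : ℝ≥0∞) * D ^ n / μ (ball x₁ R)).toReal, fun x hx y hy => ?_⟩
      have hxy := hsep x hx y hy
      have hne : x ≠ y := dist_pos.1 (hε.trans_le hxy)
      have hle : ‖k x y‖ₑ ≤ C * D ^ n / μ (ball x₁ R) := by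
        rw [ENNReal.le_div_iff_mul_le (Or.inl hB0) (Or.inl hBt)]
        calc ‖k x y‖ₑ * μ (ball x₁ R) ≤ ‖k x y‖ₑ * (D ^ n * μ (ball x ε)) := by
              gcongr
              refine hμ.measure_le x hε n (ball_subset_ball' ?_)
              have h1 : dist x x₁ < R := (mem_ball.1 (hR₀ hx)).trans_le (le_max_left _ _)
              rw [dist_comm]; linarith
          _ = D ^ n * (‖k x y‖ₑ * μ (ball x ε)) := by ring
          _ ≤ D ^ n * (‖k x y‖ₑ * μ (ball x (dist x y))) := by
              gcongr
          _ ≤ D ^ n * C := by gcongr; exact hC x y hne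
          _ = C * D ^ n := mul_comm _ _
      rw [← toReal_enorm]
      exact ENNReal.toReal_mono hKt hle
    -- all integrals involve only the restriction `κ` of the kernel to `V × U`, which is bounded
    set κ : X → X → ℂ := fun x y => (V ×ˢ U).indicator (fun q => k q.1 q.2) (x, y) with hκ
    have hκeq : ∀ x ∈ V, ∀ y ∈ U, κ x y = k x y := fun x hx y hy =>
      indicator_of_mem (mk_mem_prod hx hy) _
    have hκV : ∀ x y, x ∉ V → κ x y = 0 := fun x y hx => indicator_of_notMem (fun h => hx h.1) _
    have hκU : ∀ y x, y ∉ U → κ x y = 0 := fun y x hy => indicator_of_notMem (fun h => hy h.2) _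
    have hκm : AEStronglyMeasurable (fun q : X × X => κ q.1 q.2) (μ.prod μ) := by
      have hsub : V ×ˢ U ⊆ {q : X × X | q.1 ≠ q.2} := fun q hq =>
        dist_pos.1 (hε.trans_le (hsep _ hq.1 _ hq.2))
      exact (aestronglyMeasurable_indicator_iff (hV.measurableSet.prod hU.measurableSet)).2
        (hk.aesm.mono_measure (Measure.restrict_mono hsub le_rfl))
    have hκb : ∀ x y, ‖κ x y‖ ≤ max K₀ 0 := fun x y => by
      by_cases hx : x ∈ V
      · by_cases hy : y ∈ U
        · rw [hκeq x hx y hy]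
          exact (hK₀ x hx y hy).trans (le_max_left _ _)
        · rw [hκU y x hy, norm_zero]; exact le_max_right _ _
      · rw [hκV x y hx, norm_zero]; exact le_max_right _ _
    have hκm' : AEStronglyMeasurable (fun q : X × X => κ q.2 q.1) (μ.prod μ) := hκm.prod_swap
    have hint : ∀ f, Integrable f μ →
        Integrable (fun q : X × X => κ q.1 q.2 * f q.2) (μ.prod μ) := fun f hf =>
      integrable_kernel_mul hκm hκb hV.measurableSet hVt hκV hf
    have hint' : ∀ g, Integrable g μ →
        Integrable (fun q : X × X => κ q.2 q.1 * g q.2) (μ.prod μ) := fun g hg =>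
      integrable_kernel_mul (κ := fun y x => κ x y) hκm' (fun y x => hκb x y) hU.measurableSet hUt
        hκU hg
    have hswap : ∀ f g, BddSupp μ f → BddSupp μ g →
        ∫ x, (∫ y, κ x y * f y ∂μ) * g x ∂μ = ∫ y, (∫ x, κ x y * g x ∂μ) * f y ∂μ :=
      fun f g hf hg => integral_kernel_swap hκm hκb hV.measurableSet hVt hκV (hf.integrable hμ) hg
    -- integrals against bounded functions split
    have hsplit : ∀ (v w φ : X → ℂ), MemLp v 2 μ → Integrable w μ → BddSupp μ φ →
        ∫ x, (v x - w x) * φ x ∂μ = ∫ x, v x * φ x ∂μ - ∫ x, w x * φ x ∂μ := by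
      intro v w φ hv hw hφ
      obtain ⟨N, hN⟩ := hφ.bdd
      simp_rw [sub_mul]
      exact integral_sub (hv.integrable_mul (hφ.memLp hμ)) (hw.mul_bdd (c := N) hφ.aesm
        (Eventually.of_forall fun x => enorm_le_coe.1 (hN x)))
    have hintOn : ∀ (v w : X → ℂ) (W : Set X), MemLp v 2 μ → Integrable w μ → μ W ≠ ∞ →
        IntegrableOn (fun x => v x - w x) W μ := fun v w W hv hw hW => by
      have : IsFiniteMeasure (μ.restrict W) := ⟨by simpa using hW.lt_top⟩
      exact ((hv.restrict W).integrable one_le_two).sub hw.integrableOn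
    -- the transpose on test functions supported in `V`
    have transpose_test : ∀ ψ, LipTest ψ → tsupport ψ ⊆ V → ∀ᵐ y ∂μ.restrict U,
        opFn T' ψ y - ∫ x, κ x y * ψ x ∂μ = 0 := by
      intro ψ hψ hψV
      have hψs : BddSupp μ ψ := hψ.bddSupp
      have hI := (hint' ψ (hψs.integrable hμ)).integral_prod_left
      refine ae_eq_zero_of_integral_lipTest hU (hintOn _ _ U (memLp_opFn T' ψ) hI hUt)
        fun φ hφ hφU => ?_
      have hφs : BddSupp μ φ := hφ.bddSupp
      have hpair := hk.pairing φ ψ hφ hψ ⟨ε, hε, fun y hy x hx => by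
        rw [dist_comm]; exact hsep x (hψV hx) y (hφU hy)⟩
      have hκk : ∫ x, ∫ y, k x y * φ y * ψ x ∂μ ∂μ = ∫ x, (∫ y, κ x y * φ y ∂μ) * ψ x ∂μ := by
        refine integral_congr_ae (Eventually.of_forall fun x => ?_)
        simp only
        rw [← integral_mul_const]
        refine integral_congr_ae (Eventually.of_forall fun y => ?_)
        simp only
        by_cases hx : x ∈ V
        · by_cases hy : y ∈ U
          · rw [hκeq x hx y hy]
          · rw [image_eq_zero_of_notMem_tsupport fun h => hy (hφU h), mul_zero, mul_zero]
        · rw [image_eq_zero_of_notMem_tsupport fun h => hx (hψV h), mul_zero, mul_zero]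
      rw [hsplit _ _ _ (memLp_opFn T' ψ) hI hφs, ← hswap φ ψ hφs hψs, ← hκk, ← hpair,
        hTT' φ ψ hφs hψs, sub_eq_zero]
      exact integral_congr_ae (Eventually.of_forall fun x => mul_comm _ _)
    have op_eq : ∀ f, BddSupp μ f → (∀ x, x ∉ U → f x = 0) → ∀ᵐ x ∂μ.restrict V,
        opFn T f x - ∫ y, κ x y * f y ∂μ = 0 := by
      intro f hf hfU
      have hI := (hint f (hf.integrable hμ)).integral_prod_left
      refine ae_eq_zero_of_integral_lipTest hV (hintOn _ _ V (memLp_opFn T f) hI hVt)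
        fun ψ hψ hψV => ?_
      have hψs : BddSupp μ ψ := hψ.bddSupp
      rw [hsplit _ _ _ (memLp_opFn T f) hI hψs, hswap f ψ hf hψs, hTT' f ψ hf hψs, sub_eq_zero]
      refine integral_congr_ae ?_
      filter_upwards [(ae_restrict_iff' hU.measurableSet).1 (transpose_test ψ hψ hψV)] with y hy
      by_cases hyU : y ∈ U
      · rw [← sub_eq_zero.1 (hy hyU), mul_comm]
      · rw [hfU y hyU, zero_mul, mul_zero]
    have transpose_eq : ∀ g, BddSupp μ g → (∀ x, x ∉ V → g x = 0) → ∀ᵐ y ∂μ.restrict U,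
        opFn T' g y - ∫ x, κ x y * g x ∂μ = 0 := by
      intro g hg hgV
      have hI := (hint' g (hg.integrable hμ)).integral_prod_left
      refine ae_eq_zero_of_integral_lipTest hU (hintOn _ _ U (memLp_opFn T' g) hI hUt)
        fun φ hφ hφU => ?_
      have hφs : BddSupp μ φ := hφ.bddSupp
      have hφ0 : ∀ x, x ∉ U → φ x = 0 := fun x hx =>
        image_eq_zero_of_notMem_tsupport fun h => hx (hφU h)
      rw [hsplit _ _ _ (memLp_opFn T' g) hI hφs, ← hswap φ g hφs hg, sub_eq_zero]
      have h1 := hTT' φ g hφs hg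
      simp_rw [mul_comm (φ _)] at h1
      rw [← h1]
      refine integral_congr_ae ?_
      filter_upwards [(ae_restrict_iff' hV.measurableSet).1 (op_eq φ hφs hφ0)] with x hx
      by_cases hxV : x ∈ V
      · rw [← sub_eq_zero.1 (hx hxV)]
      · rw [hgV x hxV, mul_zero, mul_zero]
    refine ⟨fun f hf hfU => ?_, fun g hg hgV => ?_⟩
    · filter_upwards [op_eq f hf hfU, ae_restrict_mem hV.measurableSet,
        ae_restrict_of_ae (hint f (hf.integrable hμ)).prod_right_ae] with x hx hxV hxi
      have hcongr : (fun y => κ x y * f y) = fun y => k x y * f y := by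
        ext y
        by_cases hy : y ∈ U
        · rw [hκeq x hxV y hy]
        · rw [hfU y hy, mul_zero, mul_zero]
      simp only [hcongr] at hx hxi
      exact ⟨hxi, sub_eq_zero.1 hx⟩
    · filter_upwards [transpose_eq g hg hgV, ae_restrict_mem hU.measurableSet,
        ae_restrict_of_ae (hint' g (hg.integrable hμ)).prod_right_ae] with y hy hyU hyi
      have hcongr : (fun x => κ x y * g x) = fun x => k x y * g x := by
        ext x
        by_cases hx : x ∈ V
        · rw [hκeq x hx y hyU]
        · rw [hgV x hx, mul_zero, mul_zero]
      simp only [hcongr] at hy hyi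
      exact ⟨hyi, sub_eq_zero.1 hy⟩
  refine ⟨fun U V ε hU hV hUb hVb hε hsep f hf hfU =>
    (main U V ε hU hV hUb hVb hε hsep).1 f hf hfU,
    fun U V ε hU hV hUb hVb hε hsep f hf hfU =>
    (main V U ε hV hU hVb hUb hε fun x hx y hy => ?_).2 f hf hfU⟩
  rw [dist_comm]
  exact hsep y hy x hx

/-- The Hölder regularity of the kernel in its first variable implies off-diagonal smoothness. On the
annulus `2 ^ j * r ≤ dist x₀ y < 2 ^ (j + 1) * r` the kernel varies by `(2 ^ (-j)) ^ η` relative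
to its size when the first variable moves within `ball x₀ r`. -/
theorem HasKernel.offDiag (hμ : IsDoubling μ D) {T : Lp ℂ 2 μ →L[ℂ] Lp ℂ 2 μ} {k : X → X → ℂ}
    (hk : HasKernel μ T k) {n₀ : ℕ} (hn₀ : 2 ≤ n₀) {η : ℝ} (hη : 0 < η) {C : ℝ≥0}
    (hsm : ∀ x x' y, x ≠ y → 2 ^ n₀ * dist x x' ≤ dist x y →
      ‖k x y - k x' y‖ₑ * μ (ball x (dist x y)) ≤
        C * ENNReal.ofReal ((dist x x' / dist x y) ^ η)) :
    OffDiag μ T n₀ (ENNReal.ofReal ((1 / 2 : ℝ) ^ η))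
      (2 * (C * D * (ENNReal.ofReal ((1 / 2 : ℝ) ^ η))⁻¹)) := by
  intro h hh x₀ r hr h0
  set θ : ℝ≥0∞ := ENNReal.ofReal ((1 / 2 : ℝ) ^ η) with hθ
  have hθ0 : θ ≠ 0 := (ENNReal.ofReal_pos.2 (by positivity)).ne'
  have hθt : θ ≠ ∞ := ENNReal.ofReal_ne_top
  have hθpow : ∀ j : ℕ, ENNReal.ofReal (((1 / 2 : ℝ) ^ j) ^ η) = θ ^ j := fun j => by
    rw [hθ, ← ENNReal.ofReal_pow (by positivity), ← Real.rpow_natCast, ← Real.rpow_natCast,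
      ← Real.rpow_mul (by norm_num), ← Real.rpow_mul (by norm_num), mul_comm]
  set w : ℕ → X → ℝ≥0∞ := fun j =>
    (ball x₀ (2 ^ j * r)).indicator fun _ => θ ^ j * (μ (ball x₀ (2 ^ j * r)))⁻¹ with hw
  -- compare the kernel at a point of the ball with the kernel at its centre
  have hcentre : ∀ x ∈ ball x₀ r, ∀ y, y ∉ ball x₀ (2 ^ n₀ * r) →
      ‖k x₀ y - k x y‖ₑ ≤ C * D * θ⁻¹ * ∑' j, w j y := by
    intro x hx y hy
    rw [mem_ball, not_lt, dist_comm] at hy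
    rw [mem_ball, dist_comm] at hx
    have hrd : r ≤ dist x₀ y := (le_mul_of_one_le_left hr.le (one_le_pow₀ one_le_two)).trans hy
    have hd : 0 < dist x₀ y := hr.trans_le hrd
    have hne : x₀ ≠ y := dist_pos.1 hd
    obtain ⟨j, hj1, hj2⟩ := exists_nat_pow_near ((one_le_div hr).2 hrd) (one_lt_two : (1 : ℝ) < 2)
    rw [le_div_iff₀ hr] at hj1
    rw [div_lt_iff₀ hr] at hj2
    have h1 := hsm x₀ x y hne ((by gcongr : 2 ^ n₀ * dist x₀ x ≤ 2 ^ n₀ * r).trans hy)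
    have hB0 := (hμ.pos x₀ (2 ^ (j + 1) * r) (by positivity)).ne'
    have hBt := hμ.ne_top x₀ (2 ^ (j + 1) * r)
    have hratio : ENNReal.ofReal ((dist x₀ x / dist x₀ y) ^ η) ≤ θ ^ j := by
      rw [← hθpow]
      refine ENNReal.ofReal_le_ofReal (Real.rpow_le_rpow (by positivity) ?_ hη.le)
      rw [div_le_iff₀ hd]
      calc dist x₀ x ≤ r := hx.le
        _ = (1 / 2) ^ j * (2 ^ j * r) := by
            rw [← mul_assoc, ← mul_pow]; norm_num
        _ ≤ (1 / 2) ^ j * dist x₀ y := by gcongr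
    calc ‖k x₀ y - k x y‖ₑ ≤ C * D * θ ^ j * (μ (ball x₀ (2 ^ (j + 1) * r)))⁻¹ := by
          rw [← div_eq_mul_inv, ENNReal.le_div_iff_mul_le (Or.inl hB0) (Or.inl hBt)]
          calc ‖k x₀ y - k x y‖ₑ * μ (ball x₀ (2 ^ (j + 1) * r))
              ≤ ‖k x₀ y - k x y‖ₑ * (D ^ 1 * μ (ball x₀ (dist x₀ y))) := by
                gcongr
                refine hμ.measure_le x₀ hd 1 (ball_subset_ball ?_)
                rw [pow_succ]; linarith
            _ = D * (‖k x₀ y - k x y‖ₑ * μ (ball x₀ (dist x₀ y))) := by ring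
            _ ≤ D * (C * θ ^ j) := by
                exact mul_le_mul' le_rfl (h1.trans (mul_le_mul' le_rfl hratio))
            _ = C * D * θ ^ j := by ring
      _ = C * D * θ⁻¹ * w (j + 1) y := by
          simp only [hw]
          rw [indicator_of_mem (mem_ball'.2 hj2), pow_succ θ]
          have : θ⁻¹ * θ = 1 := ENNReal.inv_mul_cancel hθ0 hθt
          calc _ = C * D * θ ^ j * 1 * (μ (ball x₀ (2 ^ (j + 1) * r)))⁻¹ := by rw [mul_one]
            _ = C * D * θ ^ j * (θ⁻¹ * θ) * (μ (ball x₀ (2 ^ (j + 1) * r)))⁻¹ := by rw [this]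
            _ = _ := by ring
      _ ≤ _ := by gcongr; exact ENNReal.le_tsum (f := fun j => w j y) (j + 1)
  have hwm : ∀ j, Measurable (w j) := fun j => measurable_const.indicator measurableSet_ball
  have hsum : ∫⁻ y, (∑' j, w j y) * ‖h y‖ₑ ∂μ = ∑' j : ℕ, θ ^ j *
      ((∫⁻ z in ball x₀ (2 ^ j * r), ‖h z‖ₑ ∂μ) / μ (ball x₀ (2 ^ j * r))) := by
    simp_rw [← ENNReal.tsum_mul_right]
    rw [lintegral_tsum (f := fun j y => w j y * ‖h y‖ₑ) fun j => (hwm j).aemeasurable.mul hh.aesm.enorm]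
    refine tsum_congr fun j => ?_
    have hne : θ ^ j * (μ (ball x₀ (2 ^ j * r)))⁻¹ ≠ ∞ := ENNReal.mul_ne_top
      (ENNReal.pow_ne_top hθt) (ENNReal.inv_ne_top.2 (hμ.pos _ _ (by positivity)).ne')
    rw [ENNReal.div_eq_inv_mul, ← mul_assoc, ← lintegral_const_mul' _ _ hne,
      ← lintegral_indicator measurableSet_ball]
    refine lintegral_congr fun y => ?_
    by_cases hy : y ∈ ball x₀ (2 ^ j * r)
    · simp [hw, hy]
    · simp [hw, hy]
  obtain ⟨x₁, R, hR⟩ := hh.supp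
  set U : Set X := ball x₁ R ∩ {y | 2 * r < dist y x₀} with hU
  have hUo : IsOpen U := isOpen_ball.inter (isOpen_lt continuous_const (by fun_prop))
  have hpow4 : (4 : ℝ) ≤ 2 ^ n₀ := by
    calc (4 : ℝ) = 2 ^ 2 := by norm_num
      _ ≤ 2 ^ n₀ := pow_le_pow_right₀ one_le_two hn₀
  have hU0 : ∀ x, x ∉ U → h x = 0 := fun x hx => by
    by_cases hx1 : x ∈ ball x₁ R
    · refine h0 x (mem_ball.2 ?_)
      have h2 : dist x x₀ ≤ 2 * r := not_lt.1 fun h => hx ⟨hx1, h⟩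
      nlinarith
    · exact hR x hx1
  have hrep := hk U (ball x₀ r) r hUo isOpen_ball (isBounded_ball.subset inter_subset_left)
    isBounded_ball hr (fun x hx y hy => by
      have h1 : 2 * r < dist y x₀ := hy.2
      have h2 := dist_triangle y x x₀
      have h3 := mem_ball.1 hx
      rw [dist_comm y x] at h2
      linarith) h hh hU0
  -- the constant is the value of `T h` at a generic point of the ball
  have hrep' := hrep.and (ae_restrict_mem measurableSet_ball)
  have hne : (ae (μ.restrict (ball x₀ r))).NeBot := by
    rw [ae_neBot, Ne, Measure.restrict_eq_zero]
    exact (hμ.pos x₀ r hr).ne'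
  obtain ⟨x', ⟨hx'i, hx'e⟩, hx'B⟩ := hrep'.exists
  refine ⟨opFn T h x', ?_⟩
  filter_upwards [hrep'] with x hx
  obtain ⟨⟨hxi, hxe⟩, hxB⟩ := hx
  rw [hxe, hx'e, ← integral_sub hxi hx'i, ← hsum,
    ← lintegral_const_mul'' (f := fun y => (∑' j, w j y) * ‖h y‖ₑ) _
      ((Measurable.tsum hwm).aemeasurable.mul hh.aesm.enorm)]
  refine (enorm_integral_le_lintegral_enorm _).trans (lintegral_mono fun y => ?_)
  rw [← sub_mul, enorm_mul]
  by_cases hy : y ∈ ball x₀ (2 ^ n₀ * r)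
  · simp [h0 y hy]
  rw [← mul_assoc]
  gcongr
  calc ‖k x y - k x' y‖ₑ = ‖(k x₀ y - k x' y) - (k x₀ y - k x y)‖ₑ := by
        congr 1; ring
    _ ≤ ‖k x₀ y - k x' y‖ₑ + ‖k x₀ y - k x y‖ₑ := enorm_sub_le
    _ ≤ C * D * θ⁻¹ * ∑' j, w j y + C * D * θ⁻¹ * ∑' j, w j y :=
        add_le_add (hcentre x' hx'B y hy) (hcentre x hxB y hy)
    _ = _ := by ring

end Kernel

/-! ### The quasi-distance and its metric snowflake -/

namespace HomogeneousStructure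

section Quasidistance

variable {X : Type*} [TopologicalSpace X] [MeasurableSpace X] {μ : Measure X}
  (H : HomogeneousStructure X μ)

theorem c_pos : 0 < H.c := zero_lt_one.trans H.one_lt_c

theorem qdist_nonneg (x y : X) : 0 ≤ H.qdist x y := Real.sInf_nonneg fun _ ht => ht.1.le

theorem qdist_le {x y : X} {t : ℝ} (ht : 0 < t) (hy : y ∈ H.ball x t) (hx : x ∈ H.ball y t) :
    H.qdist x y ≤ t :=
  csInf_le ⟨0, fun _ hs => hs.1.le⟩ ⟨ht, hy, hx⟩

theorem qdist_self (x : X) : H.qdist x x = 0 :=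
  le_antisymm (le_of_forall_pos_le_add fun t ht => by
    rw [zero_add]
    exact H.qdist_le ht (H.mem_ball_self x t ht) (H.mem_ball_self x t ht)) (H.qdist_nonneg x x)

theorem mem_ball_of_qdist_lt {x y : X} {t : ℝ} (h : H.qdist x y < t) : y ∈ H.ball x t := by
  obtain ⟨r, hr, hy⟩ := H.iUnion_ball x y
  obtain ⟨s, hs, hx⟩ := H.iUnion_ball y x
  have hne : {t : ℝ | 0 < t ∧ y ∈ H.ball x t ∧ x ∈ H.ball y t}.Nonempty :=
    ⟨max r s, lt_max_of_lt_left hr, H.ball_mono x _ _ hr (le_max_left _ _) hy,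
      H.ball_mono y _ _ hs (le_max_right _ _) hx⟩
  obtain ⟨u, ⟨hu, hyu, -⟩, hut⟩ := exists_lt_of_csInf_lt hne h
  exact H.ball_mono x _ _ hu hut.le hyu

/-- The converse inclusion to `mem_ball_of_qdist_lt`, up to the constant `c`; the symmetry
`x ∈ ball y (c * t)` comes from engulfing. -/
theorem qdist_le_of_mem {x y : X} {t : ℝ} (ht : 0 < t) (h : y ∈ H.ball x t) :
    H.qdist x y ≤ H.c * t := by
  have htc : t ≤ H.c * t := le_mul_of_one_le_left ht.le H.one_lt_c.le
  exact H.qdist_le (mul_pos H.c_pos ht) (H.ball_mono x _ _ ht htc h)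
    (H.engulfing y x t t ht le_rfl ⟨y, H.mem_ball_self y t ht, h⟩ (H.mem_ball_self x t ht))

theorem qdist_pos [T2Space X] {x y : X} (h : x ≠ y) : 0 < H.qdist x y := by
  obtain ⟨r, hr, hsub⟩ := (H.nhds_basis x).mem_iff.1 (isOpen_compl_singleton.mem_nhds h)
  refine hr.trans_le (not_lt.1 fun hlt => ?_)
  exact hsub (H.mem_ball_of_qdist_lt hlt) rfl

theorem measure_ball_pow_le (n : ℕ) (x : X) {t : ℝ} (ht : 0 < t) :
    μ (H.ball x (H.c ^ n * t)) ≤ H.K ^ n * μ (H.ball x t) := by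
  induction n with
  | zero => simp
  | succ n ih =>
    rw [pow_succ', mul_assoc, pow_succ', mul_assoc]
    exact (H.doubling x _ (mul_pos (pow_pos H.c_pos n) ht)).trans (mul_le_mul' le_rfl ih)

theorem exists_le_c_pow (a : ℝ) : ∃ n : ℕ, a ≤ H.c ^ n :=
  (pow_unbounded_of_one_lt a H.one_lt_c).imp fun _ h => h.le

/-- A metric comparable to a power of the quasi-distance induces the given topology. The Hausdorff
property makes it a metric rather than a pseudometric. -/
theorem exists_metricSpace [T2Space X] {δ : ℝ} (hδ : H.IsHolderExponent δ) :
    ∃ d : MetricSpace X, d.toUniformSpace.toTopologicalSpace = ‹TopologicalSpace X› ∧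
      ∃ A : ℝ, 0 < A ∧ ∀ x y, d.dist x y ≤ A * H.qdist x y ^ δ ∧
        H.qdist x y ^ δ ≤ A * d.dist x y := by
  obtain ⟨hδ0, m, hsymm, htri, A, hA, hm⟩ := hδ
  have hm0 : ∀ x y, 0 ≤ m x y := fun x y => nonneg_of_mul_nonneg_right
    ((Real.rpow_nonneg (H.qdist_nonneg x y) δ).trans (hm x y).2) hA
  have hself : ∀ x, m x x = 0 := fun x => by
    refine le_antisymm ?_ (hm0 x x)
    have := (hm x x).1
    rwa [H.qdist_self, Real.zero_rpow hδ0.ne', mul_zero] at this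
  have heq : ∀ {x y}, m x y = 0 → x = y := fun {x y} h => by
    by_contra hne
    have := (hm x y).2
    rw [h, mul_zero] at this
    exact this.not_gt (Real.rpow_pos_of_pos (H.qdist_pos hne) δ)
  let d : MetricSpace X :=
    { dist := m
      dist_self := hself
      dist_comm := hsymm
      dist_triangle := htri
      eq_of_dist_eq_zero := heq }
  refine ⟨d, ?_, A, hA, hm⟩
  refine TopologicalSpace.ext_nhds fun x => ?_
  refine (Metric.nhds_basis_ball (α := X)).ext (H.nhds_basis x) (fun r hr => ?_) fun t ht => ?_
  · have h0 : Tendsto (fun t : ℝ => A * (H.c * t) ^ δ) (𝓝[>] 0) (𝓝 0) := by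
      have : ContinuousAt (fun t : ℝ => A * (H.c * t) ^ δ) 0 :=
        continuousAt_const.mul ((continuousAt_const.mul continuousAt_id).rpow_const
          (Or.inr hδ0.le))
      have h2 := this.tendsto
      simp only [mul_zero, Real.zero_rpow hδ0.ne'] at h2
      exact h2.mono_left nhdsWithin_le_nhds
    obtain ⟨t, ht, ht0⟩ := ((h0.eventually_lt_const hr).and self_mem_nhdsWithin).exists
    refine ⟨t, ht0, fun y hy => ?_⟩
    show m y x < r
    rw [hsymm]
    refine ((hm x y).1.trans ?_).trans_lt ht
    gcongr
    · exact H.qdist_nonneg x y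
    · exact H.qdist_le_of_mem ht0 hy
  · refine ⟨t ^ δ / A, by positivity, fun y hy => H.mem_ball_of_qdist_lt ?_⟩
    have hy' : m y x < t ^ δ / A := hy
    rw [lt_div_iff₀ hA, hsymm, mul_comm] at hy'
    exact (Real.rpow_lt_rpow_iff (H.qdist_nonneg x y) ht.le hδ0).1 ((hm x y).2.trans_lt hy')

end Quasidistance

section Snowflake

variable {X : Type*} [MetricSpace X] [MeasurableSpace X] {μ : Measure X}

/-- The metric of `X` is comparable, with constant `A`, to the power `δ` of the quasi-distance. -/
structure IsSnowflake (H : HomogeneousStructure X μ) (δ A : ℝ) : Prop where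
  exp_pos : 0 < δ
  const_pos : 0 < A
  dist_le : ∀ x y, dist x y ≤ A * H.qdist x y ^ δ
  le_dist : ∀ x y, H.qdist x y ^ δ ≤ A * dist x y

namespace IsSnowflake

variable {H : HomogeneousStructure X μ} {δ A : ℝ}

theorem ball_subset_metricBall (h : H.IsSnowflake δ A) {x : X} {t r : ℝ} (ht : 0 < t)
    (htr : A * (H.c * t) ^ δ < r) : H.ball x t ⊆ Metric.ball x r := fun y hy => by
  rw [mem_ball']
  refine ((h.dist_le x y).trans ?_).trans_lt htr
  have := h.const_pos
  have := h.exp_pos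
  gcongr
  · exact H.qdist_nonneg x y
  · exact H.qdist_le_of_mem ht hy

theorem metricBall_subset_ball (h : H.IsSnowflake δ A) {x : X} {t r : ℝ} (ht : 0 < t)
    (htr : A * r ≤ t ^ δ) : Metric.ball x r ⊆ H.ball x t := fun y hy => by
  rw [mem_ball'] at hy
  refine H.mem_ball_of_qdist_lt ?_
  refine (Real.rpow_lt_rpow_iff (H.qdist_nonneg x y) ht.le h.exp_pos).1 ?_
  exact (h.le_dist x y).trans_lt (((mul_lt_mul_iff_right₀ h.const_pos).2 hy).trans_le htr)

/-- Metric balls are squeezed between balls of the homogeneous structure of comparable radii. -/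
theorem exists_sandwich (h : H.IsSnowflake δ A) : ∃ n : ℕ, ∀ x r, 0 < r → ∃ t, 0 < t ∧
    H.ball x t ⊆ Metric.ball x r ∧ Metric.ball x (2 * r) ⊆ H.ball x (H.c ^ n * t) := by
  have hA := h.const_pos
  have hδ := h.exp_pos
  have hc := H.c_pos
  -- the ratio of the radii `(2 A r) ^ (1 / δ)` and `(r / (2 A)) ^ (1 / δ) / c`, outside and inside
  obtain ⟨n, hn⟩ := H.exists_le_c_pow (H.c * (4 * A ^ 2) ^ (1 / δ))
  refine ⟨n, fun x r hr => ?_⟩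
  have hpow : ∀ s : ℝ, 0 ≤ s → (s ^ (1 / δ)) ^ δ = s := fun s hs => by
    rw [← Real.rpow_mul hs, one_div_mul_cancel hδ.ne', Real.rpow_one]
  refine ⟨(r / (2 * A)) ^ (1 / δ) / H.c, by positivity, ?_, ?_⟩
  · refine h.ball_subset_metricBall (by positivity) ?_
    rw [mul_div_cancel₀ _ hc.ne', hpow _ (by positivity)]
    have : A * (r / (2 * A)) = r / 2 := by field_simp
    rw [this]; linarith
  · refine h.metricBall_subset_ball (by positivity) ?_
    calc A * (2 * r) = (4 * A ^ 2) * (r / (2 * A)) := by field_simp; ring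
      _ = ((4 * A ^ 2) ^ (1 / δ) * (r / (2 * A)) ^ (1 / δ)) ^ δ := by
        rw [Real.mul_rpow (by positivity) (by positivity), hpow _ (by positivity),
          hpow _ (by positivity)]
      _ = (H.c * (4 * A ^ 2) ^ (1 / δ) * ((r / (2 * A)) ^ (1 / δ) / H.c)) ^ δ := by
        congr 1; field_simp
      _ ≤ _ := by gcongr

theorem isDoubling (h : H.IsSnowflake δ A) : ∃ D : ℝ≥0, IsDoubling μ D := by
  obtain ⟨n, hn⟩ := h.exists_sandwich
  refine ⟨H.K ^ n, fun x r hr => ?_, fun x r => ?_, fun x r hr => ?_⟩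
  · obtain ⟨t, ht, hsub, -⟩ := hn x r hr
    exact (H.measure_ball_pos x t ht).trans_le (measure_mono hsub)
  · rcases le_or_gt r 0 with hr | hr
    · simp [ball_eq_empty.2 hr]
    · obtain ⟨t, ht, -, hsub⟩ := hn x r hr
      exact (measure_mono ((ball_subset_ball (by linarith)).trans hsub)).trans_lt
        (H.measure_ball_lt_top x _ (mul_pos (pow_pos H.c_pos n) ht))
  · obtain ⟨t, ht, hsub, hsub'⟩ := hn x r hr
    calc μ (Metric.ball x (2 * r)) ≤ μ (H.ball x (H.c ^ n * t)) := measure_mono hsub'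
      _ ≤ H.K ^ n * μ (H.ball x t) := H.measure_ball_pow_le n x ht
      _ ≤ H.K ^ n * μ (Metric.ball x r) := by gcongr
      _ = _ := by rw [ENNReal.coe_pow]

/-- `μ (ball x (dist x y))` is at most a constant multiple of `λ(x, y)`. -/
theorem exists_measure_ball_le_lam (h : H.IsSnowflake δ A) : ∃ n : ℕ, ∀ x y, x ≠ y →
    μ (Metric.ball x (dist x y)) ≤ ENNReal.ofReal (H.K ^ n * H.lam x y) ∧ 0 < H.lam x y := by
  have hA := h.const_pos
  have hδ := h.exp_pos
  obtain ⟨n, hn⟩ := H.exists_le_c_pow ((A ^ 2) ^ (1 / δ))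
  refine ⟨n, fun x y hxy => ?_⟩
  have hq := H.qdist_pos hxy
  have hfin := H.measure_ball_lt_top x _ hq
  have hsub : Metric.ball x (dist x y) ⊆ H.ball x (H.c ^ n * H.qdist x y) := by
    refine h.metricBall_subset_ball (mul_pos (pow_pos H.c_pos n) hq) ?_
    calc A * dist x y ≤ A * (A * H.qdist x y ^ δ) := by gcongr; exact h.dist_le x y
      _ = ((A ^ 2) ^ (1 / δ) * H.qdist x y) ^ δ := by
        rw [Real.mul_rpow (by positivity) hq.le, ← Real.rpow_mul (by positivity),
          one_div_mul_cancel hδ.ne', Real.rpow_one]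
        ring
      _ ≤ _ := by gcongr
  refine ⟨?_, ENNReal.toReal_pos (H.measure_ball_pos x _ hq).ne' hfin.ne⟩
  refine ((measure_mono hsub).trans (H.measure_ball_pow_le n x hq)).trans_eq ?_
  rw [lam, Measure.real, ENNReal.ofReal_mul (by positivity), ENNReal.ofReal_toReal hfin.ne,
    ENNReal.ofReal_pow (by positivity), ENNReal.ofReal_coe_nnreal]

/-- The size and regularity of a standard kernel in terms of the metric. The Hölder exponent becomes
`ε / δ`, and the separation `c * d(x, x') ≤ d(x, y)` follows from a large enough separation in
the metric. -/
theorem kernel_bounds (h : H.IsSnowflake δ A) {k : X → X → ℂ} (hk : H.IsStandardKernel k) :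
    ∃ (n₀ : ℕ) (η : ℝ) (C : ℝ≥0), 2 ≤ n₀ ∧ 0 < η ∧
      (∀ x y, x ≠ y → ‖k x y‖ₑ * μ (Metric.ball x (dist x y)) ≤ C) ∧
      ∀ x x' y, x ≠ y → 2 ^ n₀ * dist x x' ≤ dist x y →
        (‖k x y - k x' y‖ₑ + ‖k y x - k y x'‖ₑ) * μ (Metric.ball x (dist x y)) ≤
          C * ENNReal.ofReal ((dist x x' / dist x y) ^ η) := by
  have hA := h.const_pos
  have hδ := h.exp_pos
  have hc := H.c_pos
  obtain ⟨ε, C, hε, hC, hsize, hreg⟩ := hk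
  obtain ⟨n, hn⟩ := h.exists_measure_ball_le_lam
  obtain ⟨m, hm⟩ := pow_unbounded_of_one_lt (H.c ^ δ * A ^ 2) one_lt_two
  have hK : (0 : ℝ) < H.K ^ n := by
    have : (0 : ℝ) < H.K := by exact_mod_cast zero_lt_one.trans H.one_lt_K
    positivity
  have hAη : (0 : ℝ) < (A ^ 2) ^ (ε / δ) := by positivity
  refine ⟨m + 2, ε / δ, (C * H.K ^ n * (1 + (A ^ 2) ^ (ε / δ))).toNNReal, by omega,
    by positivity, fun x y hxy => ?_, fun x x' y hxy hd => ?_⟩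
  · obtain ⟨h1, h2⟩ := hn x y hxy
    rw [← ofReal_norm]
    refine (mul_le_mul' le_rfl h1).trans ?_
    rw [← ENNReal.ofReal_mul (norm_nonneg _)]
    refine ENNReal.ofReal_le_ofReal ?_
    calc ‖k x y‖ * (H.K ^ n * H.lam x y) ≤ C / H.lam x y * (H.K ^ n * H.lam x y) := by
          gcongr; exact hsize x y hxy
      _ = C * H.K ^ n * 1 := by field_simp
      _ ≤ _ := by gcongr; linarith
  · obtain ⟨h1, h2⟩ := hn x y hxy
    have hq := H.qdist_pos hxy
    have hq' := H.qdist_nonneg x x'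
    have hdxy : 0 < dist x y := dist_pos.2 hxy
    have hle : H.c * H.qdist x x' ≤ H.qdist x y := by
      refine (Real.rpow_le_rpow_iff (by positivity) hq.le hδ).1 ?_
      rw [Real.mul_rpow hc.le hq']
      have h3 : H.c ^ δ * A ^ 2 ≤ 2 ^ (m + 2) :=
        hm.le.trans (pow_le_pow_right₀ one_le_two (by omega))
      have h4 : A * (H.c ^ δ * H.qdist x x' ^ δ) ≤ A * H.qdist x y ^ δ := by
        calc A * (H.c ^ δ * H.qdist x x' ^ δ) ≤ A * (H.c ^ δ * (A * dist x x')) := by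
              gcongr; exact h.le_dist x x'
          _ = H.c ^ δ * A ^ 2 * dist x x' := by ring
          _ ≤ 2 ^ (m + 2) * dist x x' := by gcongr
          _ ≤ dist x y := hd
          _ ≤ _ := h.dist_le x y
      exact le_of_mul_le_mul_left h4 hA
    have hpow : (H.qdist x x' / H.qdist x y) ^ ε ≤
        (A ^ 2) ^ (ε / δ) * (dist x x' / dist x y) ^ (ε / δ) := by
      rw [← Real.mul_rpow (by positivity) (by positivity)]
      calc (H.qdist x x' / H.qdist x y) ^ ε
          = ((H.qdist x x' / H.qdist x y) ^ δ) ^ (ε / δ) := by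
            rw [← Real.rpow_mul (by positivity), mul_div_cancel₀ _ hδ.ne']
        _ ≤ _ := by
            gcongr
            rw [Real.div_rpow hq' hq.le, div_le_iff₀ (by positivity)]
            calc H.qdist x x' ^ δ ≤ A * dist x x' := h.le_dist x x'
              _ = A * (dist x x' / dist x y) * dist x y := by field_simp
              _ ≤ A * (dist x x' / dist x y) * (A * H.qdist x y ^ δ) := by
                gcongr; exact h.dist_le x y
              _ = _ := by ring
    rw [← ofReal_norm, ← ofReal_norm, ← ENNReal.ofReal_add (norm_nonneg _) (norm_nonneg _)]
    refine (mul_le_mul' le_rfl h1).trans ?_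
    rw [← ENNReal.ofReal_mul (by positivity), ← ENNReal.ofReal_coe_nnreal,
      ← ENNReal.ofReal_mul (by positivity), Real.coe_toNNReal _ (by positivity)]
    refine ENNReal.ofReal_le_ofReal ?_
    calc (‖k x y - k x' y‖ + ‖k y x - k y x'‖) * (H.K ^ n * H.lam x y)
        ≤ ((H.qdist x x' / H.qdist x y) ^ ε * (C / H.lam x y)) * (H.K ^ n * H.lam x y) := by
          gcongr; exact hreg x x' y hxy hle
      _ = C * H.K ^ n * (H.qdist x x' / H.qdist x y) ^ ε := by field_simp
      _ ≤ C * H.K ^ n * ((A ^ 2) ^ (ε / δ) * (dist x x' / dist x y) ^ (ε / δ)) := by gcongr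
      _ = C * H.K ^ n * (A ^ 2) ^ (ε / δ) * (dist x x' / dist x y) ^ (ε / δ) := by ring
      _ ≤ _ := by gcongr; linarith

/-- A function in `BMO` has bounded mean oscillation on metric balls, measured against its means over
slightly larger balls of the homogeneous structure. -/
theorem bmoWith [BorelSpace X] (h : H.IsSnowflake δ A) {b : X → ℂ} (hb : H.IsBMO b) :
    ∃ (a : X → ℝ → ℂ) (M : ℝ≥0∞), M ≠ ∞ ∧ BMOWith μ b a M := by
  obtain ⟨hint, M, hM⟩ := hb
  obtain ⟨n, hn⟩ := h.exists_sandwich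
  choose! t ht hsub hsub' using hn
  refine ⟨fun x r => ⨍ z in H.ball x (H.c ^ n * t x r), b z ∂μ, ENNReal.ofReal M * H.K ^ n,
    ENNReal.mul_ne_top ENNReal.ofReal_ne_top (ENNReal.pow_ne_top ENNReal.coe_ne_top),
    fun x r hr => ?_⟩
  have hs : 0 < H.c ^ n * t x r := mul_pos (pow_pos H.c_pos n) (ht x r hr)
  set B := H.ball x (H.c ^ n * t x r) with hB
  have hBt := H.measure_ball_lt_top x _ hs
  have hB0 := H.measure_ball_pos x _ hs
  have hi : IntegrableOn (fun y => b y - ⨍ z in B, b z ∂μ) B μ :=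
    (hint x _ hs).sub (integrableOn_const hBt.ne)
  have hBpos : 0 < μ.real B := ENNReal.toReal_pos hB0.ne' hBt.ne
  have hMx := hM x _ hs
  rw [← hB, setAverage_eq, smul_eq_mul, inv_mul_le_iff₀ hBpos] at hMx
  calc ∫⁻ z in Metric.ball x r, ‖b z - ⨍ z in B, b z ∂μ‖ₑ ∂μ
      ≤ ∫⁻ z in B, ‖b z - ⨍ z in B, b z ∂μ‖ₑ ∂μ :=
        lintegral_mono_set ((ball_subset_ball (by linarith)).trans (hsub' x r hr))
    _ = ENNReal.ofReal (∫ z in B, ‖b z - ⨍ z in B, b z ∂μ‖ ∂μ) :=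
        (ofReal_integral_norm_eq_lintegral_enorm hi).symm
    _ ≤ ENNReal.ofReal (μ.real B * M) := ENNReal.ofReal_le_ofReal hMx
    _ = ENNReal.ofReal M * μ B := by
        rw [ENNReal.ofReal_mul measureReal_nonneg, Measure.real, ENNReal.ofReal_toReal hBt.ne,
          mul_comm]
    _ ≤ ENNReal.ofReal M * (H.K ^ n * μ (Metric.ball x r)) :=
        mul_le_mul' le_rfl ((H.measure_ball_pow_le n x (ht x r hr)).trans
          (mul_le_mul' le_rfl (measure_mono (hsub x r hr))))
    _ = _ := by rw [mul_assoc]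

/-- Lipschitz functions for the metric are Hölder functions of order `δ`, so association on `Λ_δ` may
be tested on them. -/
theorem weakKernel [BorelSpace X] (h : H.IsSnowflake δ A) {T : Lp ℂ 2 μ →L[ℂ] Lp ℂ 2 μ}
    {k : X → X → ℂ} (hk : H.IsStandardKernel k) (hT : H.IsAssociated δ T k) [Nonempty X] :
    WeakKernel μ T k := by
  obtain ⟨D, hD⟩ := h.isDoubling
  have := hD.secondCountable
  obtain ⟨-, -, C, -, -, hsize, -⟩ := h.kernel_bounds hk
  have htest : ∀ f, LipTest f → H.IsTest δ f := fun f hf => by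
    obtain ⟨hf1, L, hL⟩ := hf
    refine ⟨hf1, |L| * A, fun x y => (hL x y).trans ?_⟩
    calc L * dist x y ≤ |L| * (A * H.qdist x y ^ δ) := by
          gcongr
          · exact le_abs_self L
          · exact h.dist_le x y
      _ = _ := by ring
  refine ⟨hT.1.aestronglyMeasurable, ⟨C, hsize⟩, fun f g hf hg ⟨η, hη, hsep⟩ => ?_⟩
  have hf2 : MemLp f 2 μ := hf.bddSupp.memLp hD
  rw [opFn_eq T hf2]
  refine hT.2 f g (htest f hf) (htest g hg) ⟨(η / A) ^ (1 / δ), ?_, fun x hx y hy => ?_⟩ hf2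
  · have := h.const_pos
    positivity
  · have hA := h.const_pos
    refine (Real.rpow_le_rpow_iff (by positivity) (H.qdist_nonneg x y) h.exp_pos).1 ?_
    rw [← Real.rpow_mul (by positivity), one_div_mul_cancel h.exp_pos.ne', Real.rpow_one,
      div_le_iff₀ hA, mul_comm]
    exact (hsep x hx y hy).trans (h.dist_le x y)

end IsSnowflake

end Snowflake

/-- The space is a countable union of balls on which `b` is integrable. -/
theorem IsBMO.aestronglyMeasurable {X : Type*} [TopologicalSpace X] [MeasurableSpace X]
    {μ : Measure X} {H : HomogeneousStructure X μ} {b : X → ℂ} (hb : H.IsBMO b) :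
    AEStronglyMeasurable b μ := by
  rcases isEmpty_or_nonempty X with hX | ⟨⟨x₀⟩⟩
  · rw [Subsingleton.elim b 0]
    exact aestronglyMeasurable_zero
  have hU : ⋃ n : ℕ, H.ball x₀ (n + 1) = univ := by
    refine eq_univ_of_forall fun y => ?_
    obtain ⟨r, hr, hy⟩ := H.iUnion_ball x₀ y
    obtain ⟨n, hn⟩ := exists_nat_gt r
    exact mem_iUnion.2 ⟨n, H.ball_mono x₀ _ _ hr (by linarith) hy⟩
  rw [← Measure.restrict_univ (μ := μ), ← hU, aestronglyMeasurable_iUnion_iff]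
  exact fun n => (hb.1 x₀ (n + 1) (by positivity)).1

end HomogeneousStructure

/-! ### The transpose of a bounded operator on `L²` -/

section Transpose

variable {X : Type*} [MeasurableSpace X] {μ : Measure X}

/-- The transpose of `T` for the bilinear pairing `∫ f g`, that is `f ↦ conj (T† (conj f))`. -/
noncomputable def transposeLp (T : Lp ℂ 2 μ →L[ℂ] Lp ℂ 2 μ) : Lp ℂ 2 μ →L[ℂ] Lp ℂ 2 μ :=
  LinearMap.mkContinuous
    { toFun := fun f => star (T.adjoint (star f))
      map_add' := fun f g => by
        have hadd : ∀ f g : Lp ℂ 2 μ, star (f + g) = star f + star g := fun f g => by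
          refine Lp.ext ?_
          filter_upwards [Lp.coeFn_star (f + g), Lp.coeFn_star f, Lp.coeFn_star g,
            Lp.coeFn_add f g, Lp.coeFn_add (star f) (star g)] with x h1 h2 h3 h4 h5
          rw [h1, h5, Pi.star_apply, h4, Pi.add_apply, Pi.add_apply, h2, h3, star_add]
          rfl
        rw [hadd, map_add, hadd]
      map_smul' := fun c f => by
        have hsmul : ∀ (c : ℂ) (f : Lp ℂ 2 μ), star (c • f) = star c • star f := fun c f => by
          refine Lp.ext ?_
          filter_upwards [Lp.coeFn_star (c • f), Lp.coeFn_star f, Lp.coeFn_smul c f,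
            Lp.coeFn_smul (star c) (star f)] with x h1 h2 h3 h4
          rw [h1, h4, Pi.star_apply, h3, Pi.smul_apply, Pi.smul_apply, h2, star_smul]
          rfl
        rw [hsmul, map_smul, hsmul, star_star, RingHom.id_apply] }
    ‖T.adjoint‖ fun f => by
      have hnorm : ∀ f : Lp ℂ 2 μ, ‖star f‖ = ‖f‖ := fun f => by
        refine le_antisymm (Lp.norm_le_norm_of_ae_le ?_) (Lp.norm_le_norm_of_ae_le ?_) <;>
        · filter_upwards [Lp.coeFn_star f] with x hx
          rw [hx, Pi.star_apply, norm_star]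
      show ‖star (T.adjoint (star f))‖ ≤ _
      rw [hnorm, ← hnorm f]
      exact T.adjoint.le_opNorm _

theorem integral_mul_transposeLp (T : Lp ℂ 2 μ →L[ℂ] Lp ℂ 2 μ) (f g : Lp ℂ 2 μ) :
    ∫ x, T f x * g x ∂μ = ∫ x, f x * transposeLp T g x ∂μ := by
  have hpair : ∀ u v : Lp ℂ 2 μ, ∫ x, u x * v x ∂μ = inner ℂ (star v) u := fun u v => by
    rw [L2.inner_def]
    refine integral_congr_ae ?_
    filter_upwards [Lp.coeFn_star v] with x hx
    rw [hx, Pi.star_apply, RCLike.inner_apply, ← starRingEnd_apply, RCLike.conj_conj]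
  rw [hpair, hpair]
  show _ = inner ℂ (star (star (T.adjoint (star g)))) f
  rw [star_star, ContinuousLinearMap.adjoint_inner_left]

end Transpose

theorem isTransposeOf_transposeLp {X : Type*} [MetricSpace X] [MeasurableSpace X] [BorelSpace X]
    {μ : Measure X} {D : ℝ≥0} (hμ : IsDoubling μ D) (T : Lp ℂ 2 μ →L[ℂ] Lp ℂ 2 μ) :
    IsTransposeOf μ T (transposeLp T) := fun f g hf hg => by
  have hf2 := hf.memLp hμ
  have hg2 := hg.memLp hμ
  rw [opFn_eq T hf2, opFn_eq _ hg2]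
  calc ∫ x, T (hf2.toLp f) x * g x ∂μ = ∫ x, T (hf2.toLp f) x * hg2.toLp g x ∂μ := by
        refine integral_congr_ae ?_
        filter_upwards [hg2.coeFn_toLp] with x hx
        rw [hx]
    _ = ∫ x, hf2.toLp f x * transposeLp T (hg2.toLp g) x ∂μ := integral_mul_transposeLp _ _ _
    _ = _ := by
        refine integral_congr_ae ?_
        filter_upwards [hf2.coeFn_toLp] with x hx
        rw [hx]

/-! ### The commutator on `L^p` -/

/-- The `L^p` bound for the commutator on its domain. -/
theorem HomogeneousStructure.IsSnowflake.exists_commutator_bound {X : Type*} [MetricSpace X]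
    [LocallyCompactSpace X] [MeasurableSpace X] [BorelSpace X] {μ : Measure X}
    {H : HomogeneousStructure X μ} {δ A : ℝ} (h : H.IsSnowflake δ A)
    {T : Lp ℂ 2 μ →L[ℂ] Lp ℂ 2 μ} {k : X → X → ℂ} (hk : H.IsStandardKernel k)
    (hT : H.IsAssociated δ T k) {b : X → ℂ} (hb : H.IsBMO b) {p : ℝ} (hp : 1 < p) :
    ∃ C : ℝ≥0∞, C ≠ ∞ ∧ ∀ f, StronglyMeasurable f → MemLp f 2 μ →
      MemLp (fun x => b x * f x) 2 μ →
      ∫⁻ x, ‖b x * opFn T f x - opFn T (fun z => b z * f z) x‖ₑ ^ p ∂μ ≤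
        C * ∫⁻ x, ‖f x‖ₑ ^ p ∂μ := by
  rcases isEmpty_or_nonempty X with hX | hX
  · exact ⟨0, ENNReal.zero_ne_top, fun f _ _ _ => by simp [lintegral_of_isEmpty]⟩
  obtain ⟨D, hμ⟩ := h.isDoubling
  have hTT' := isTransposeOf_transposeLp hμ T
  obtain ⟨hker, hker'⟩ := (h.weakKernel hk hT).hasKernel hμ hTT'
  obtain ⟨n₀, η, C, hn₀, hη, -, hreg⟩ := h.kernel_bounds hk
  have hoff := hker.offDiag hμ hn₀ hη (C := C) fun x x' y hxy hd =>
    (mul_le_mul' le_self_add le_rfl).trans (hreg x x' y hxy hd)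
  have hoff' := hker'.offDiag hμ hn₀ hη (C := C) fun x x' y hxy hd =>
    (mul_le_mul' le_add_self le_rfl).trans (hreg x x' y hxy hd)
  have hθ0 : ENNReal.ofReal ((1 / 2 : ℝ) ^ η) ≠ 0 := (ENNReal.ofReal_pos.2 (by positivity)).ne'
  have hθ1 : ENNReal.ofReal ((1 / 2 : ℝ) ^ η) < 1 :=
    ENNReal.ofReal_lt_one.2 (Real.rpow_lt_one (by norm_num) (by norm_num) hη)
  have hC' : 2 * (C * D * (ENNReal.ofReal ((1 / 2 : ℝ) ^ η))⁻¹) ≠ ∞ :=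
    ENNReal.mul_ne_top ENNReal.ofNat_ne_top (ENNReal.mul_ne_top
      (ENNReal.mul_ne_top ENNReal.coe_ne_top ENNReal.coe_ne_top) (ENNReal.inv_ne_top.2 hθ0))
  obtain ⟨A', hA', hmain⟩ := hμ.commutator_bound hθ0 hθ1 hC' hoff
    (fun s hs => hμ.boundedOn hTT' hθ0 hθ1 hC' hoff hoff' hs) hp
  obtain ⟨a, M, hM, hbmo⟩ := h.bmoWith hb
  exact ⟨A' * M ^ p, ENNReal.mul_ne_top hA' (ENNReal.rpow_ne_top_of_nonneg (by linarith) hM),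
    fun f hf hf2 hbf => hmain b a M hb.aestronglyMeasurable hbmo f hf hf2 hbf⟩

section Extension

variable {X : Type*} [MeasurableSpace X] {μ : Measure X} {b : X → ℂ} {p : ℝ≥0∞}

/-- Truncations of `f` to sets of finite measure on which `f` and `b` are bounded lie in the domain of
the commutator and converge to `f`. -/
theorem dense_commutatorDomain [SigmaFinite μ] (hb : AEStronglyMeasurable b μ) [Fact (1 ≤ p)]
    (hp : p ≠ ∞) : Dense (commutatorDomain μ b p) := fun f => by
  have hp0 : p ≠ 0 := (zero_lt_one.trans_le (Fact.out : 1 ≤ p)).ne'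
  have hpr : 0 < p.toReal := ENNReal.toReal_pos hp0 hp
  have hfm := Lp.stronglyMeasurable f
  set b' := hb.mk b with hb'
  have hbm : StronglyMeasurable b' := hb.stronglyMeasurable_mk
  set E : ℕ → Set X := fun n => spanningSets μ n ∩ {x | ‖f x‖ ≤ n} ∩ {x | ‖b' x‖ ≤ n} with hE
  have hEm : ∀ n, MeasurableSet (E n) := fun n =>
    ((measurableSet_spanningSets μ n).inter
      (measurableSet_le hfm.measurable.norm measurable_const)).inter
      (measurableSet_le hbm.measurable.norm measurable_const)
  have hEfin : ∀ n, μ (E n) < ∞ := fun n =>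
    (measure_mono (inter_subset_left.trans inter_subset_left)).trans_lt
      (measure_spanningSets_lt_top μ n)
  have hEev : ∀ x, ∀ᶠ n in atTop, x ∈ E n := fun x => by
    obtain ⟨N, hN⟩ := exists_nat_gt (max ‖f x‖ ‖b' x‖)
    filter_upwards [eventually_ge_atTop N, eventually_ge_atTop (spanningSetsIndex μ x)]
      with n hn hn'
    have hnN : (N : ℝ) ≤ n := by exact_mod_cast hn
    exact ⟨⟨monotone_spanningSets μ hn' (mem_spanningSetsIndex μ x),
      ((le_max_left _ _).trans hN.le).trans hnN⟩, ((le_max_right _ _).trans hN.le).trans hnN⟩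
  have hfp : MemLp f p μ := Lp.memLp f
  have hgp : ∀ n, MemLp ((E n).indicator f) p μ := fun n => hfp.indicator (hEm n)
  have hlim : Tendsto (fun n => (hgp n).toLp _) atTop (𝓝 (hfp.toLp f)) := by
    rw [Lp.tendsto_Lp_iff_tendsto_eLpNorm'']
    simp_rw [eLpNorm_eq_lintegral_rpow_enorm_toReal hp0 hp]
    have h0 : Tendsto (fun n => ∫⁻ x, ‖((E n).indicator f - f) x‖ₑ ^ p.toReal ∂μ) atTop (𝓝 0) := by
      rw [← lintegral_zero (μ := μ)]
      refine tendsto_lintegral_of_dominated_convergence' (fun x => ‖f x‖ₑ ^ p.toReal)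
        (fun n => ((hgp n).1.sub hfp.1).enorm.pow_const _)
        (fun n => Eventually.of_forall fun x => ?_) ?_ (Eventually.of_forall fun x => ?_)
      · refine ENNReal.rpow_le_rpow ?_ hpr.le
        by_cases hx : x ∈ E n <;> simp [hx]
      · exact (lintegral_rpow_enorm_lt_top_of_eLpNorm_lt_top hp0 hp hfp.2).ne
      · refine tendsto_const_nhds.congr' ?_
        filter_upwards [hEev x] with n hn
        simp [hn, hpr]
    have h1 := h0.ennrpow_const (1 / p.toReal)
    rwa [ENNReal.zero_rpow_of_pos (by positivity)] at h1
  rw [Lp.toLp_coeFn] at hlim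
  refine mem_closure_of_tendsto hlim (Eventually.of_forall fun n => ?_)
  have hcoe := (hgp n).coeFn_toLp
  have hfinite : IsFiniteMeasure (μ.restrict (E n)) := ⟨by simpa using hEfin n⟩
  have h2 : MemLp ((E n).indicator f) 2 μ := by
    rw [memLp_indicator_iff_restrict (hEm n)]
    refine MemLp.of_bound hfm.aestronglyMeasurable n ?_
    filter_upwards [ae_restrict_mem (hEm n)] with x hx using hx.1.2
  have h3 : MemLp ((E n).indicator fun x => b' x * f x) 2 μ := by
    rw [memLp_indicator_iff_restrict (hEm n)]
    refine MemLp.of_bound (hbm.mul hfm).aestronglyMeasurable (n * n) ?_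
    filter_upwards [ae_restrict_mem (hEm n)] with x hx
    rw [norm_mul]
    exact mul_le_mul hx.2 hx.1.2 (norm_nonneg _) n.cast_nonneg
  refine ⟨h2.ae_eq hcoe.symm, h3.ae_eq ?_⟩
  filter_upwards [hcoe, hb.ae_eq_mk] with x hx hbx
  rw [hx, hbx]
  by_cases hxE : x ∈ E n <;> simp [hxE, hb']

theorem commutatorFun_eq_opFn {X : Type*} [MetricSpace X] [MeasurableSpace X] [BorelSpace X]
    {μ : Measure X} {b : X → ℂ} (T : Lp ℂ 2 μ →L[ℂ] Lp ℂ 2 μ) (f : X → ℂ) (hf : MemLp f 2 μ)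
    (hbf : MemLp (fun x => b x * f x) 2 μ) : commutatorFun T b f hf hbf =
      fun x => b x * opFn T f x - opFn T (fun z => b z * f z) x := by
  rw [opFn_eq T hf, opFn_eq T hbf]
  rfl

variable [Fact (1 ≤ p)]

/-- The domain of the commutator as a subspace of `L^p`. -/
def commutatorSubmodule (μ : Measure X) (b : X → ℂ) (p : ℝ≥0∞) [Fact (1 ≤ p)] :
    Submodule ℂ (Lp ℂ p μ) where
  carrier := commutatorDomain μ b p
  zero_mem' := by
    refine ⟨MemLp.zero.ae_eq (Lp.coeFn_zero ℂ p μ).symm, MemLp.zero.ae_eq ?_⟩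
    filter_upwards [Lp.coeFn_zero ℂ p μ] with x hx
    rw [hx, Pi.zero_apply, mul_zero]
  add_mem' := fun {f g} hf hg => by
    refine ⟨(hf.1.add hg.1).ae_eq (Lp.coeFn_add f g).symm, (hf.2.add hg.2).ae_eq ?_⟩
    filter_upwards [Lp.coeFn_add f g] with x hx
    rw [hx, Pi.add_apply, Pi.add_apply, mul_add]
  smul_mem' := fun c f hf => by
    refine ⟨(hf.1.const_smul c).ae_eq (Lp.coeFn_smul c f).symm, (hf.2.const_smul c).ae_eq ?_⟩
    filter_upwards [Lp.coeFn_smul c f] with x hx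
    rw [hx, Pi.smul_apply, Pi.smul_apply, smul_eq_mul, smul_eq_mul, mul_left_comm]

/-- A commutator which is bounded in the `L^p` norm on its dense domain extends to `L^p`. -/
theorem exists_extension_commutatorFun (T : Lp ℂ 2 μ →L[ℂ] Lp ℂ 2 μ)
    (hb : AEStronglyMeasurable b μ) (hdense : Dense (commutatorDomain μ b p)) {C : ℝ≥0}
    (hC : ∀ (f : Lp ℂ p μ) (hf : f ∈ commutatorDomain μ b p),
      eLpNorm (commutatorFun T b f hf.1 hf.2) p μ ≤ C * eLpNorm f p μ) :
    ∃ S : Lp ℂ p μ →L[ℂ] Lp ℂ p μ, ∀ f : Lp ℂ p μ, ∀ hf : f ∈ commutatorDomain μ b p,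
      S f =ᵐ[μ] commutatorFun T b f hf.1 hf.2 := by
  have hmem : ∀ (f : Lp ℂ p μ) (hf : f ∈ commutatorDomain μ b p),
      MemLp (commutatorFun T b f hf.1 hf.2) p μ := fun f hf =>
    ⟨(hb.mul (Lp.aestronglyMeasurable _)).sub (Lp.aestronglyMeasurable _),
      (hC f hf).trans_lt (ENNReal.mul_lt_top ENNReal.coe_lt_top (Lp.eLpNorm_lt_top f))⟩
  let L : commutatorSubmodule μ b p →ₗ[ℂ] Lp ℂ p μ :=
    { toFun := fun f => (hmem f.1 f.2).toLp _
      map_add' := fun f g => by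
        refine Lp.ext ?_
        have h1 : (f + g).2.1.toLp ((f + g : commutatorSubmodule μ b p) : Lp ℂ p μ) =
            f.2.1.toLp _ + g.2.1.toLp _ := by
          rw [← MemLp.toLp_add]
          exact MemLp.toLp_congr _ _ (Lp.coeFn_add f.1 g.1)
        have h2 : (f + g).2.2.toLp _ = f.2.2.toLp _ + g.2.2.toLp _ := by
          rw [← MemLp.toLp_add]
          refine MemLp.toLp_congr _ _ ?_
          filter_upwards [Lp.coeFn_add f.1 g.1] with x hx
          show b x * (f.1 + g.1) x = b x * f.1 x + b x * g.1 x
          rw [hx, Pi.add_apply, mul_add]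
        filter_upwards [(hmem _ (f + g).2).coeFn_toLp, (hmem _ f.2).coeFn_toLp,
          (hmem _ g.2).coeFn_toLp, Lp.coeFn_add ((hmem _ f.2).toLp _) ((hmem _ g.2).toLp _),
          Lp.coeFn_add (T (f.2.1.toLp _)) (T (g.2.1.toLp _)),
          Lp.coeFn_add (T (f.2.2.toLp _)) (T (g.2.2.toLp _))] with x e1 e2 e3 e4 e5 e6
        rw [e1, e4, Pi.add_apply, e2, e3]
        simp only [commutatorFun]
        rw [h1, h2, map_add, map_add, e5, e6, Pi.add_apply, Pi.add_apply]
        ring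
      map_smul' := fun c f => by
        refine Lp.ext ?_
        have h1 : (c • f).2.1.toLp ((c • f : commutatorSubmodule μ b p) : Lp ℂ p μ) =
            c • f.2.1.toLp _ := by
          rw [← MemLp.toLp_const_smul]
          exact MemLp.toLp_congr _ _ (Lp.coeFn_smul c f.1)
        have h2 : (c • f).2.2.toLp _ = c • f.2.2.toLp _ := by
          rw [← MemLp.toLp_const_smul]
          refine MemLp.toLp_congr _ _ ?_
          filter_upwards [Lp.coeFn_smul c f.1] with x hx
          show b x * (c • f.1) x = c • (b x * f.1 x)
          rw [hx, Pi.smul_apply, smul_eq_mul, smul_eq_mul, mul_left_comm]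
        filter_upwards [(hmem _ (c • f).2).coeFn_toLp, (hmem _ f.2).coeFn_toLp,
          Lp.coeFn_smul c ((hmem _ f.2).toLp _), Lp.coeFn_smul c (T (f.2.1.toLp _)),
          Lp.coeFn_smul c (T (f.2.2.toLp _))] with x e1 e2 e3 e4 e5
        rw [e1, RingHom.id_apply, e3, Pi.smul_apply, e2]
        simp only [commutatorFun]
        rw [h1, h2, map_smul, map_smul, e4, e5, Pi.smul_apply, Pi.smul_apply]
        simp only [smul_eq_mul]
        ring }
  have hLC : ∀ f : commutatorSubmodule μ b p,
      ‖L f‖ ≤ C * ‖(commutatorSubmodule μ b p).subtype f‖ := fun f => by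
    show ‖(hmem f.1 f.2).toLp _‖ ≤ C * ‖f.1‖
    rw [Lp.norm_toLp, Lp.norm_def, ← ENNReal.coe_toReal, ← ENNReal.toReal_mul]
    exact ENNReal.toReal_mono (ENNReal.mul_ne_top ENNReal.coe_ne_top (Lp.eLpNorm_ne_top _))
      (hC f.1 f.2)
  have hrange : DenseRange (commutatorSubmodule μ b p).subtype := by
    have : range (commutatorSubmodule μ b p).subtype = commutatorDomain μ b p :=
      Subtype.range_coe
    rw [DenseRange, this]
    exact hdense
  refine ⟨L.extendOfNorm (commutatorSubmodule μ b p).subtype, fun f hf => ?_⟩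
  have h := LinearMap.extendOfNorm_eq hrange ⟨C, hLC⟩ ⟨f, hf⟩
  rw [Submodule.subtype_apply] at h
  rw [h]
  exact (hmem f hf).coeFn_toLp

end Extension

theorem corollary6p3 {X : Type*} [TopologicalSpace X] [T2Space X] [LocallyCompactSpace X]
    [MeasurableSpace X] [BorelSpace X] (μ : Measure X) [μ.Regular]
    (H : HomogeneousStructure X μ)
    (T : Lp ℂ 2 μ →L[ℂ] Lp ℂ 2 μ) (k : X → X → ℂ) (hT : H.IsCalderonZygmund T k)
    (b : X → ℂ) (hb : H.IsBMO b)
    (p : ℝ≥0∞) [Fact (1 ≤ p)] (hp₁ : 1 < p) (hp₂ : p < ∞) :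
    Dense (commutatorDomain μ b p) ∧
      ∃ S : Lp ℂ p μ →L[ℂ] Lp ℂ p μ, ∀ f : Lp ℂ p μ, ∀ hf : f ∈ commutatorDomain μ b p,
        S f =ᵐ[μ] commutatorFun T b f hf.1 hf.2 := by
  obtain ⟨hk, δ, hδ, hTk⟩ := hT
  obtain ⟨d, rfl, A, hA, hd⟩ := H.exists_metricSpace hδ
  have h : H.IsSnowflake δ A := ⟨hδ.1, hA, fun x y => (hd x y).1, fun x y => (hd x y).2⟩
  have hb' := hb.aestronglyMeasurable
  obtain ⟨D, hμ⟩ := h.isDoubling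
  have := hμ.sigmaFinite
  have hdense := dense_commutatorDomain hb' hp₂.ne
  refine ⟨hdense, ?_⟩
  have hp0 : p ≠ 0 := (zero_lt_one.trans hp₁).ne'
  have hpr : 1 < p.toReal := by
    rw [← ENNReal.toReal_one]
    exact (ENNReal.toReal_lt_toReal ENNReal.one_ne_top hp₂.ne).2 hp₁
  obtain ⟨C, hC, hbound⟩ := h.exists_commutator_bound hk hTk hb hpr
  refine exists_extension_commutatorFun T hb' hdense (C := (C ^ (1 / p.toReal)).toNNReal)
    fun f hf => ?_
  rw [ENNReal.coe_toNNReal (ENNReal.rpow_ne_top_of_nonneg (by positivity) hC),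
    commutatorFun_eq_opFn, eLpNorm_eq_lintegral_rpow_enorm_toReal hp0 hp₂.ne,
    eLpNorm_eq_lintegral_rpow_enorm_toReal hp0 hp₂.ne,
    ← ENNReal.mul_rpow_of_nonneg _ _ (by positivity)]
  exact ENNReal.rpow_le_rpow (hbound f (Lp.stronglyMeasurable f) hf.1 hf.2) (by positivity)
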